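/- Let $G=(V,E)$ be a finite undirected graph without loops or multiple edges, with at least one edge, and let $\Delta(G)$ be its largest vertex degree. Let $m=(\mu_1,\dots,\mu_k)$ be a vector of positive integers with $\mu_1+\dots+\mu_k=|V|$. For a complex matrix $B=(b^{uv}_{ij})$ with entries indexed by the edges $\{u,v\}\in E$ and the unordered pairs $\{i,j\}$, $1\le i,j\le k$ (with $i=j$ allowed), and for a symmetric complex $k\times k$ matrix $A=(a_{ij})$, let $$Q_{G,m}(B)=\sum_{\phi}\ \prod_{\{u,v\}\in E} b^{uv}_{\phi(u)\phi(v)},\qquad P_{G,m}(A)=\sum_{\phi}\ \prod_{\{u,v\}\in E} a_{\phi(u)\phi(v)},$$ both sums over all maps $\phi:V\to\{1,\dots,k\}$ with $|\phi^{-1}(i)|=\mu_i$ for $i=1,\dots,k$. Let $J$ denote the matrix of all ones (of either format) and let $\gamma=0.1$. Model of computation. An algorithm is a program (assignments, sequencing, branching, while-loops) of a deterministic random access machine with finitely many arrays of natural numbers, on which it can perform addition, truncated subtraction, comparison and indirect addressing, and finitely many arrays of complex numbers, on which it can perform exact $+,-,\times,\div$ (with $x\div 0=0$) and comparison of real parts;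 natural numbers can be converted to complex numbers, and the only constants in a program are natural numbers. Every operation, memory access, assignment and test takes one unit of time. The input consists of $|V|$, $k$, $|E|$, the multiplicities, a list of the edges in any order, $\epsilon$, and the entries of $B$ (respectively $A$). Theorem. There is an absolute constant $C$ and there are two such algorithms, one for $Q_{G,m}$ and one for $P_{G,m}$, such that the following holds for all $G$, $m$ as above and all real $\epsilon>0$. Put $$L=\ln(|E|+1)+\max(0,-\ln\epsilon).$$ (1) Let $B$ satisfy $|b^{uv}_{ij}-1|\le\gamma/\Delta(G)$ for all $\{u,v\}\in E$ and all $1\le i,j\le k$. Then $Q_{G,m}(B)\ne0$, and on the input $(G,m,B,\epsilon)$ the first algorithm halts after at most $$(|E|k+1)^{C L}+C\,|V|$$ steps. Moreover the function $g(z)=Q_{G,m}(J+z(B-J))$ has no zeros in the disc $|z|\le1$, and, if $f$ is the branch of $\ln g$ that is analytic there and real at $z=0$, the algorithm outputs an integer $n$ with $0\le n\le C L$, the exact value of $$T=\sum_{j=1}^{n}\frac{f^{(j)}(0)}{j!},\qquad\text{for which}\qquad |f(1)-(f(0)+T)|<\epsilon,$$ and a complex number $\tilde Q\ne0$ such that $|f(1)-\ln\tilde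 Q|<\epsilon$ for some choice of the logarithm $\ln\tilde Q$, and $|\tilde Q-Q_{G,m}(B)|\le\epsilon\,|Q_{G,m}(B)|$. (2) The same holds for the second algorithm on the input $(G,m,A,\epsilon)$, for every symmetric complex $k\times k$ matrix $A$ with $|a_{ij}-1|\le\gamma/\Delta(G)$ for all $i,j$, with $P_{G,m}(A)$ and $g(z)=P_{G,m}(J+z(A-J))$ in place of $Q_{G,m}(B)$ and $g$. -/

import Mathlib

open Finset

/-! ## The partition functions -/

/-- Maps `φ` from the vertices to `{1, …, k}` with `|φ⁻¹(i)| = μ i` for every `i`. -/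
def mapsWithMult {N k : ℕ} (μ : Fin k → ℕ) : Finset (Fin N → Fin k) :=
  univ.filter fun φ => ∀ i, (univ.filter fun v => φ v = i).card = μ i

/-- `Q_{G,m}(B)`: the partition function of edge-colored graph homomorphisms with multiplicities.
The entry `b^{uv}_{ij}` is `B s(u, v) s(i, j)`; only the entries with `s(u, v)` an edge matter. -/
def partQ {N k : ℕ} (G : SimpleGraph (Fin N)) [DecidableRel G.Adj] (μ : Fin k → ℕ)
    (B : Sym2 (Fin N) → Sym2 (Fin k) → ℂ) : ℂ :=
  ∑ φ ∈ mapsWithMult μ, ∏ e ∈ G.edgeFinset, B e (e.map φ)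

/-- `P_{G,m}(A)`: the partition function of graph homomorphisms with multiplicities. Each edge
`{u, v}` contributes `A (φ u) (φ v)`; for symmetric `A` the order of the ends is irrelevant. -/
noncomputable def partP {N k : ℕ} (G : SimpleGraph (Fin N)) [DecidableRel G.Adj] (μ : Fin k → ℕ)
    (A : Matrix (Fin k) (Fin k) ℂ) : ℂ :=
  ∑ φ ∈ mapsWithMult μ, ∏ e ∈ G.edgeFinset, A (φ e.out.1) (φ e.out.2)

/-- `z ↦ Q_{G,m}(J + z (B - J))`, with `J` the all-ones matrix. -/
def segQ {N k : ℕ} (G : SimpleGraph (Fin N)) [DecidableRel G.Adj] (μ : Fin k → ℕ)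
    (B : Sym2 (Fin N) → Sym2 (Fin k) → ℂ) (z : ℂ) : ℂ :=
  partQ G μ fun e p => 1 + z * (B e p - 1)

/-- `z ↦ P_{G,m}(J + z (A - J))`, with `J` the all-ones matrix. -/
noncomputable def segP {N k : ℕ} (G : SimpleGraph (Fin N)) [DecidableRel G.Adj] (μ : Fin k → ℕ)
    (A : Matrix (Fin k) (Fin k) ℂ) (z : ℂ) : ℂ :=
  partP G μ (Matrix.of fun i j => 1 + z * (A i j - 1))

/-- `f` is the branch of `ln g` on the closed unit disc that is real at `0`
(its values on the disc are determined by these conditions when `g 0 > 0`). -/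
structure IsLogBranch (g f : ℂ → ℂ) : Prop where
  analytic : AnalyticOnNhd ℂ f (Metric.closedBall 0 1)
  exp_eq : ∀ z ∈ Metric.closedBall (0 : ℂ) 1, Complex.exp (f z) = g z
  real_zero : (f 0).im = 0

/-! ## The machine model: a random access machine over the complex numbers

A program has finitely many arrays of natural numbers (used for counting and addressing) and
finitely many arrays of complex numbers. On natural numbers it can add, subtract (truncated at
zero) and compare. On complex numbers it can perform the four field operations exactly and compare
real parts. The only constants are natural numbers. Every operation, memory access, assignment and
test takes one unit of time. -/

/-- Memory: `int a i` and `num a i` are the contents of cell `i` of the `a`-th array of natural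
numbers and of the `a`-th array of complex numbers. -/
structure Store where
  int : ℕ → ℕ → ℕ
  num : ℕ → ℕ → ℂ

/-- Write the natural number `x` to cell `i` of the `a`-th integer array. -/
def Store.setInt (σ : Store) (a i x : ℕ) : Store :=
  { σ with int := fun b j => if b = a ∧ j = i then x else σ.int b j }

/-- Write the complex number `x` to cell `i` of the `a`-th number array. -/
noncomputable def Store.setNum (σ : Store) (a i : ℕ) (x : ℂ) : Store :=
  { σ with num := fun b j => if b = a ∧ j = i then x else σ.num b j }

/-- Integer expressions. In `get a i` the array name `a` is fixed, the index `i` is computed. -/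
inductive IExp : Type
  | lit (n : ℕ) : IExp
  | get (a : ℕ) (i : IExp) : IExp
  | add (x y : IExp) : IExp
  | sub (x y : IExp) : IExp

/-- Complex expressions. -/
inductive CExp : Type
  | cast (x : IExp) : CExp
  | get (a : ℕ) (i : IExp) : CExp
  | add (x y : CExp) : CExp
  | sub (x y : CExp) : CExp
  | mul (x y : CExp) : CExp
  | div (x y : CExp) : CExp

/-- Tests: `le` compares natural numbers, `reLe` compares real parts of complex numbers. -/
inductive BExp : Type
  | le (x y : IExp) : BExp
  | reLe (x y : CExp) : BExp
  | not (b : BExp) : BExp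
  | and (b c : BExp) : BExp

/-- Programs. -/
inductive Cmd : Type
  | skip : Cmd
  | setInt (a : ℕ) (i x : IExp) : Cmd
  | setNum (a : ℕ) (i : IExp) (x : CExp) : Cmd
  | seq (c d : Cmd) : Cmd
  | ite (b : BExp) (c d : Cmd) : Cmd
  | loop (b : BExp) (c : Cmd) : Cmd

def IExp.eval (σ : Store) : IExp → ℕ
  | lit n => n
  | get a i => σ.int a (i.eval σ)
  | add x y => x.eval σ + y.eval σ
  | sub x y => x.eval σ - y.eval σ

noncomputable def CExp.eval (σ : Store) : CExp → ℂ
  | cast x => (x.eval σ : ℂ)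
  | get a i => σ.num a (i.eval σ)
  | add x y => x.eval σ + y.eval σ
  | sub x y => x.eval σ - y.eval σ
  | mul x y => x.eval σ * y.eval σ
  | div x y => x.eval σ / y.eval σ

def BExp.Holds (σ : Store) : BExp → Prop
  | le x y => x.eval σ ≤ y.eval σ
  | reLe x y => (x.eval σ).re ≤ (y.eval σ).re
  | not b => ¬ b.Holds σ
  | and b c => b.Holds σ ∧ c.Holds σ

/-- The time to evaluate an integer expression: its number of operations. -/
def IExp.time : IExp → ℕ
  | lit _ => 1
  | get _ i => i.time + 1
  | add x y => x.time + y.time + 1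
  | sub x y => x.time + y.time + 1

def CExp.time : CExp → ℕ
  | cast x => x.time + 1
  | get _ i => i.time + 1
  | add x y => x.time + y.time + 1
  | sub x y => x.time + y.time + 1
  | mul x y => x.time + y.time + 1
  | div x y => x.time + y.time + 1

def BExp.time : BExp → ℕ
  | le x y => x.time + y.time + 1
  | reLe x y => x.time + y.time + 1
  | not b => b.time + 1
  | and b c => b.time + c.time + 1

/-- `Exec c σ t τ`: started in `σ`, the program `c` halts after `t` steps with memory `τ`.
`loop b c` repeats `c` as long as the test `b` holds. -/
inductive Exec : Cmd → Store → ℕ → Store → Prop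
  | skip (σ : Store) : Exec Cmd.skip σ 1 σ
  | setInt (a : ℕ) (i x : IExp) (σ : Store) :
      Exec (Cmd.setInt a i x) σ (i.time + x.time + 1) (σ.setInt a (i.eval σ) (x.eval σ))
  | setNum (a : ℕ) (i : IExp) (x : CExp) (σ : Store) :
      Exec (Cmd.setNum a i x) σ (i.time + x.time + 1) (σ.setNum a (i.eval σ) (x.eval σ))
  | seq {c d : Cmd} {σ σ' τ : Store} {s t : ℕ} :
      Exec c σ s σ' → Exec d σ' t τ → Exec (Cmd.seq c d) σ (s + t) τ
  | ite_true {b : BExp} {c d : Cmd} {σ τ : Store} {t : ℕ} :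
      b.Holds σ → Exec c σ t τ → Exec (Cmd.ite b c d) σ (b.time + t + 1) τ
  | ite_false {b : BExp} {c d : Cmd} {σ τ : Store} {t : ℕ} :
      ¬ b.Holds σ → Exec d σ t τ → Exec (Cmd.ite b c d) σ (b.time + t + 1) τ
  | loop_false {b : BExp} {c : Cmd} {σ : Store} :
      ¬ b.Holds σ → Exec (Cmd.loop b c) σ (b.time + 1) σ
  | loop_true {b : BExp} {c : Cmd} {σ σ' τ : Store} {s t : ℕ} :
      b.Holds σ → Exec c σ s σ' → Exec (Cmd.loop b c) σ' t τ →
      Exec (Cmd.loop b c) σ (b.time + s + t + 1) τ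

/-- The machine is deterministic: the initial memory determines the running time and the result. -/
theorem Exec.deterministic {c : Cmd} {σ τ τ' : Store} {t t' : ℕ}
    (h : Exec c σ t τ) (h' : Exec c σ t' τ') : t = t' ∧ τ = τ' := by
  induction h generalizing t' τ' with
  | skip => cases h'; exact ⟨rfl, rfl⟩
  | setInt => cases h'; exact ⟨rfl, rfl⟩
  | setNum => cases h'; exact ⟨rfl, rfl⟩
  | seq _ _ ih₁ ih₂ =>
    cases h' with
    | seq k₁ k₂ =>
      obtain ⟨rfl, rfl⟩ := ih₁ k₁
      obtain ⟨rfl, rfl⟩ := ih₂ k₂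
      exact ⟨rfl, rfl⟩
  | ite_true hb _ ih =>
    cases h' with
    | ite_true _ k => obtain ⟨rfl, rfl⟩ := ih k; exact ⟨rfl, rfl⟩
    | ite_false hn _ => exact absurd hb hn
  | ite_false hb _ ih =>
    cases h' with
    | ite_true hn _ => exact absurd hn hb
    | ite_false _ k => obtain ⟨rfl, rfl⟩ := ih k; exact ⟨rfl, rfl⟩
  | loop_false hb =>
    cases h' with
    | loop_false _ => exact ⟨rfl, rfl⟩
    | loop_true hn _ _ => exact absurd hn hb
  | loop_true hb _ _ ih₁ ih₂ =>
    cases h' with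
    | loop_false hn => exact absurd hb hn
    | loop_true _ k₁ k₂ =>
      obtain ⟨rfl, rfl⟩ := ih₁ k₁
      obtain ⟨rfl, rfl⟩ := ih₂ k₂
      exact ⟨rfl, rfl⟩

/-! ## Input and output -/

/-- `edge` lists every edge of `G` exactly once, each with its two ends in some order. -/
def IsEdgeList {N : ℕ} (G : SimpleGraph (Fin N)) {M : ℕ} (edge : Fin M → Fin N × Fin N) : Prop :=
  Set.BijOn (fun e => s((edge e).1, (edge e).2)) Set.univ G.edgeSet

/-- The memory `σ` holds the numbers of vertices, colors and edges, the multiplicities, the list of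
edges and the accuracy `ε`. Cells that are not mentioned may hold anything. -/
structure HoldsGraph (σ : Store) {N k M : ℕ} (μ : Fin k → ℕ) (edge : Fin M → Fin N × Fin N)
    (ε : ℝ) : Prop where
  vertices : σ.int 0 0 = N
  colors : σ.int 0 1 = k
  edges : σ.int 0 2 = M
  mult : ∀ i : Fin k, σ.int 1 i = μ i
  fst : ∀ e : Fin M, σ.int 2 e = (edge e).1
  snd : ∀ e : Fin M, σ.int 3 e = (edge e).2
  accuracy : σ.num 0 0 = (ε : ℂ)

/-- The memory `σ` holds the matrix `B`, edge after edge, each block row by row. -/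
def HoldsEdgeMatrix (σ : Store) {N k M : ℕ} (edge : Fin M → Fin N × Fin N)
    (B : Sym2 (Fin N) → Sym2 (Fin k) → ℂ) : Prop :=
  ∀ (e : Fin M) (i j : Fin k),
    σ.num 1 (((e : ℕ) * k + i) * k + j) = B s((edge e).1, (edge e).2) s(i, j)

/-- The memory `σ` holds the matrix `A`, row by row. -/
def HoldsMatrix (σ : Store) {k : ℕ} (A : Matrix (Fin k) (Fin k) ℂ) : Prop :=
  ∀ i j : Fin k, σ.num 2 ((i : ℕ) * k + j) = A i j

/-- The final memory `τ` holds a degree `n ≤ D`, the `n`-th Taylor sum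
`∑_{j=1}^n f⁽ʲ⁾(0) / j!` of the branch `f` of `ln g`, which gives `f 1 = ln (g 1)` up to an error
less than `ε` when added to `f 0`, and a nonzero number that approximates `g 1` within relative
error `ε`, both in the logarithmic and in the ordinary sense. -/
def IsApproximation (τ : Store) (g : ℂ → ℂ) (ε D : ℝ) : Prop :=
  ∃ f : ℂ → ℂ, IsLogBranch g f ∧
    (τ.int 4 0 : ℝ) ≤ D ∧
    τ.num 3 1 = ∑ j ∈ Icc 1 (τ.int 4 0), iteratedDeriv j f 0 / (j.factorial : ℂ) ∧
    ‖f 1 - (f 0 + τ.num 3 1)‖ < ε ∧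
    τ.num 3 0 ≠ 0 ∧
    (∃ w : ℂ, Complex.exp w = τ.num 3 0 ∧ ‖f 1 - w‖ < ε) ∧
    ‖τ.num 3 0 - g 1‖ ≤ ε * ‖g 1‖

/-- `ln (|E| + 1) + max (0, - ln ε)`, the order of magnitude `ln |E| - ln ε`. -/
noncomputable def logSize (M : ℕ) (ε : ℝ) : ℝ :=
  Real.log ((M : ℝ) + 1) + max 0 (-Real.log ε)

/-- The time bound `(|E| k + 1) ^ (C (ln (|E| + 1) + max (0, - ln ε))) + C |V|`. -/
noncomputable def timeBound (C : ℝ) (N k M : ℕ) (ε : ℝ) : ℝ :=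
  ((M : ℝ) * k + 1) ^ (C * logSize M ε) + C * N

/-!
# Partition functions of graph homomorphisms with multiplicities

**No zeros.** Fix the colors of the vertices one after the other. A partition function restricted to
the maps with prescribed values on a set `D` of vertices is the sum of the restricted functions in
which one more vertex `v` is fixed (`restrictedSum_eq_sum_colors`), and up to an integer factor also
the sum of those in which one more vertex gets a given color
(`mul_restrictedSum_eq_sum_vertices`). By descending induction on `D`, the summands pairwise enclose
a small angle (`alignedExtensions`). Indeed, the restricted functions in which `v` and `w` have the
colors `i, j` and `j, i` differ only in the weights of the at most `2 Δ(G)` edges at `v` and `w`,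
each of which is within `0.1 / Δ(G)` of `1`; since there is little cancellation in a sum of vectors
enclosing small angles (`sum_norm_le_of_nearlyAligned`), one such weight changes the function by a
factor `1 + O(1 / Δ(G))`, and together they change it by a bounded factor
(`AlignedExtensions.norm_sub_swap_le`). Hence the partition function is not zero
(`sum_prod_ne_zero`), and the constants leave room for the disc `‖z‖ ≤ 1.005`.

**Interpolation.** So `g` is a polynomial of degree at most `|E|` whose zeros `1 / a` satisfy
`‖a‖ ≤ 200 / 201`, and `ln g` is `ln (g 0)` plus a sum of functions `ln (1 - a z)`. Its Taylor
coefficients decrease geometrically, and they are obtained from the coefficients of `g` by Newton's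
identities (`exists_isLogExpansion`). A degree `n` of order `ln |E| - ln ε` is enough
(`exists_degree`).

**Coefficients.** The coefficient of `z ^ j` in `g` is a sum over sets of `j` triples of an edge and
two colors for its ends. These sets are enumerated as increasing words of length `j` over an
alphabet of `K = |E| k ^ 2` letters (`sum_wordProd`). For each of them, the algorithm computes the
probability that a random map with the given multiplicities has the prescribed colors, as a product
of conditional probabilities (`Partial.Represents.assign`); this takes only `O(j)` assignments of
colors. The number of words is `K ^ j`, which gives the exponent of order `ln |E| - ln ε` in the
running time (`steps_le_timeBound`). Only the vertices that are ends of edges are touched; the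
remaining vertices enter through the number of all maps, a multinomial coefficient computed in
`O(|V|)` steps.

**Output.** The machine has no exponential function, so `exp T` is replaced by `(1 + T / R) ^ R`
with `R` of order `|E| ^ 2 / ε` (`exists_exp_eq_one_add_div_pow`).

The programs are verified with the rules for `Runs`, which bounds the running time and describes the
final memory; `Frame` says which arrays are left alone. The case of a symmetric matrix `A` is that
of the matrix `B` whose rows all are equal to `A` (`segP_eq_segQ`); only the expression that reads
an entry differs.
-/

/-! ### Sums of complex numbers of nearly equal argument -/

/-- `x` and `y` make an angle of cosine at least `c`; this holds if one of them is zero. -/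
def NearlyAligned (c : ℝ) (x y : ℂ) : Prop :=
  c * (‖x‖ * ‖y‖) ≤ (x * (starRingEnd ℂ) y).re

theorem NearlyAligned.self {c : ℝ} (hc : c ≤ 1) (x : ℂ) : NearlyAligned c x x := by
  unfold NearlyAligned
  rw [Complex.mul_conj, Complex.ofReal_re, Complex.normSq_eq_norm_sq]
  nlinarith [sq_nonneg ‖x‖]

theorem NearlyAligned.of_smul {c : ℝ} {x y : ℂ} {a b : ℕ} (ha : 0 < a) (hb : 0 < b)
    (h : NearlyAligned c (a * x) (b * y)) : NearlyAligned c x y := by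
  unfold NearlyAligned at *
  have ha' : (0 : ℝ) < a := by exact_mod_cast ha
  have hb' : (0 : ℝ) < b := by exact_mod_cast hb
  have e : ((a : ℂ) * x * (starRingEnd ℂ) (b * y)) =
      ((a * b : ℝ) : ℂ) * (x * (starRingEnd ℂ) y) := by
    rw [map_mul, Complex.conj_natCast]; push_cast; ring
  rw [e, Complex.re_ofReal_mul, norm_mul, norm_mul, Complex.norm_natCast,
    Complex.norm_natCast] at h
  have : (a * b : ℝ) * (c * (‖x‖ * ‖y‖)) ≤ (a * b) * (x * (starRingEnd ℂ) y).re := by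
    linarith
  exact le_of_mul_le_mul_left this (by positivity)

/-- There is little cancellation in a sum of pairwise nearly aligned numbers. -/
theorem sum_norm_le_of_nearlyAligned {ι : Type*} (s : Finset ι) (x : ι → ℂ) {κ : ℝ}
    (h : ∀ i ∈ s, ∀ j ∈ s, NearlyAligned (κ ^ 2) (x i) (x j)) :
    κ * ∑ i ∈ s, ‖x i‖ ≤ ‖∑ i ∈ s, x i‖ := by
  apply le_of_sq_le_sq _ (norm_nonneg _)
  have e : ‖∑ i ∈ s, x i‖ ^ 2 = ∑ i ∈ s, ∑ j ∈ s, (x i * (starRingEnd ℂ) (x j)).re := by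
    rw [← Complex.normSq_eq_norm_sq, ← Complex.ofReal_re (Complex.normSq _), ← Complex.mul_conj,
      map_sum, sum_mul_sum]
    simp only [Complex.re_sum]
  rw [e, mul_pow, sq (∑ i ∈ s, ‖x i‖), sum_mul_sum, mul_sum]
  refine sum_le_sum fun i hi => ?_
  rw [mul_sum]
  exact sum_le_sum fun j hj => h i hi j hj

theorem nearlyAligned_of_norm_sub_le {x y : ℂ} {s : ℝ} (hs : 0 ≤ s) (hs1 : s ≤ 1)
    (h : ‖x - y‖ ≤ s * (‖x‖ + ‖y‖)) : NearlyAligned (1 - 2 * s ^ 2) x y := by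
  unfold NearlyAligned
  have h2 : ‖x - y‖ ^ 2 ≤ (s * (‖x‖ + ‖y‖)) ^ 2 := by gcongr
  have e : ‖x - y‖ ^ 2 = ‖x‖ ^ 2 + ‖y‖ ^ 2 - 2 * (x * (starRingEnd ℂ) y).re := by
    rw [← Complex.normSq_eq_norm_sq, ← Complex.normSq_eq_norm_sq, ← Complex.normSq_eq_norm_sq,
      Complex.normSq_sub]
  have h3 : s ^ 2 ≤ 1 := by nlinarith
  nlinarith [mul_nonneg (sub_nonneg.2 h3) (sq_nonneg (‖x‖ - ‖y‖))]

theorem NearlyAligned.mono {c c' : ℝ} {x y : ℂ} (h : NearlyAligned c x y) (hc : c' ≤ c) :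
    NearlyAligned c' x y :=
  le_trans (mul_le_mul_of_nonneg_right hc (by positivity)) h

/-- If two families of nearly aligned numbers are termwise close, then so are their sums. -/
theorem nearlyAligned_sum_sum {ι : Type*} (t : Finset ι) (x y : ι → ℂ) {κ s : ℝ} (hκ : 0 < κ)
    (hs : 0 ≤ s) (hsκ : s ≤ κ) (hκs : κ ^ 2 ≤ 1 - 2 * (s / κ) ^ 2)
    (hx : ∀ i ∈ t, ∀ j ∈ t, NearlyAligned (κ ^ 2) (x i) (x j))
    (hy : ∀ i ∈ t, ∀ j ∈ t, NearlyAligned (κ ^ 2) (y i) (y j))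
    (h : ∀ i ∈ t, ‖x i - y i‖ ≤ s * (‖x i‖ + ‖y i‖)) :
    NearlyAligned (κ ^ 2) (∑ i ∈ t, x i) (∑ i ∈ t, y i) := by
  refine (nearlyAligned_of_norm_sub_le (s := s / κ) (by positivity) ?_ ?_).mono hκs
  · rwa [div_le_one hκ]
  have h1 := sum_norm_le_of_nearlyAligned t x hx
  have h2 := sum_norm_le_of_nearlyAligned t y hy
  calc ‖∑ i ∈ t, x i - ∑ i ∈ t, y i‖ = ‖∑ i ∈ t, (x i - y i)‖ := by rw [sum_sub_distrib]
    _ ≤ ∑ i ∈ t, s * (‖x i‖ + ‖y i‖) := norm_sum_le_of_le _ h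
    _ = s / κ * (κ * ∑ i ∈ t, ‖x i‖ + κ * ∑ i ∈ t, ‖y i‖) := by
        rw [← mul_sum, sum_add_distrib]; field_simp
    _ ≤ _ := by gcongr

/-! ### Restricted partition functions -/

/-- The maps with multiplicities `μ` that agree with `ψ` on `D`. -/
def mapsExtending {N k : ℕ} (μ : Fin k → ℕ) (D : Finset (Fin N)) (ψ : Fin N → Fin k) :
    Finset (Fin N → Fin k) :=
  (mapsWithMult μ).filter fun φ => ∀ v ∈ D, φ v = ψ v

/-- The part of a partition function that belongs to the maps agreeing with `ψ` on `D`. The factor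
of an edge `e` is `W e φ`, which is allowed to be any function of the map `φ`. -/
def restrictedSum {N k : ℕ} (μ : Fin k → ℕ) (E : Finset (Sym2 (Fin N)))
    (W : Sym2 (Fin N) → (Fin N → Fin k) → ℂ) (D : Finset (Fin N)) (ψ : Fin N → Fin k) : ℂ :=
  ∑ φ ∈ mapsExtending μ D ψ, ∏ e ∈ E, W e φ

/-- Admissible edge weights: `W e φ` depends only on the colors of the ends of `e`, and is within
`r` of `1` for the edges in `E`. -/
structure IsEdgeWeight {N k : ℕ} (E : Finset (Sym2 (Fin N))) (r : ℝ)
    (W : Sym2 (Fin N) → (Fin N → Fin k) → ℂ) : Prop where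
  congr : ∀ e φ φ', (∀ v ∈ e, φ v = φ' v) → W e φ = W e φ'
  near : ∀ e ∈ E, ∀ φ, ‖W e φ - 1‖ ≤ r

section Restricted

variable {N k : ℕ} {μ : Fin k → ℕ} {E : Finset (Sym2 (Fin N))} {r : ℝ}
  {W W' : Sym2 (Fin N) → (Fin N → Fin k) → ℂ}

theorem mem_mapsExtending {D : Finset (Fin N)} {ψ φ : Fin N → Fin k} :
    φ ∈ mapsExtending μ D ψ ↔ φ ∈ mapsWithMult μ ∧ ∀ v ∈ D, φ v = ψ v := by
  simp [mapsExtending]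

theorem mem_mapsWithMult {φ : Fin N → Fin k} :
    φ ∈ mapsWithMult μ ↔ ∀ i, (univ.filter fun v => φ v = i).card = μ i := by
  simp [mapsWithMult]

theorem mem_mapsExtending_insert {D : Finset (Fin N)} {v : Fin N} (hv : v ∉ D)
    {ψ φ : Fin N → Fin k} {i : Fin k} :
    φ ∈ mapsExtending μ (insert v D) (Function.update ψ v i) ↔
      φ ∈ mapsExtending μ D ψ ∧ φ v = i := by
  simp only [mem_mapsExtending, mem_insert, forall_eq_or_imp, Function.update_self]
  constructor
  · rintro ⟨h1, h2, h3⟩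
    refine ⟨⟨h1, fun u hu => ?_⟩, h2⟩
    rw [h3 u hu, Function.update_of_ne (ne_of_mem_of_not_mem hu hv)]
  · rintro ⟨⟨h1, h3⟩, h2⟩
    refine ⟨h1, h2, fun u hu => ?_⟩
    rw [h3 u hu, Function.update_of_ne (ne_of_mem_of_not_mem hu hv)]

theorem mapsExtending_insert {D : Finset (Fin N)} {v : Fin N} (hv : v ∉ D)
    (ψ : Fin N → Fin k) (i : Fin k) :
    mapsExtending μ (insert v D) (Function.update ψ v i) =
      (mapsExtending μ D ψ).filter fun φ => φ v = i := by
  ext φ; rw [mem_mapsExtending_insert hv, mem_filter]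

theorem restrictedSum_eq_sum_colors {D : Finset (Fin N)} {v : Fin N} (hv : v ∉ D)
    (ψ : Fin N → Fin k) :
    restrictedSum μ E W D ψ =
      ∑ i, restrictedSum μ E W (insert v D) (Function.update ψ v i) := by
  simp only [restrictedSum, mapsExtending_insert hv]
  exact (sum_fiberwise _ _ _).symm

/-- Any of the free vertices of color `j` may be fixed first. -/
theorem mul_restrictedSum_eq_sum_vertices (D : Finset (Fin N)) (ψ : Fin N → Fin k) (j : Fin k) :
    ((μ j - (D.filter fun u => ψ u = j).card : ℕ) : ℂ) * restrictedSum μ E W D ψ =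
      ∑ w ∈ Dᶜ, restrictedSum μ E W (insert w D) (Function.update ψ w j) := by
  have e : ∀ w ∈ Dᶜ, restrictedSum μ E W (insert w D) (Function.update ψ w j) =
      ∑ φ ∈ mapsExtending μ D ψ, if φ w = j then ∏ e ∈ E, W e φ else 0 := by
    intro w hw
    rw [restrictedSum, mapsExtending_insert (mem_compl.1 hw), sum_filter]
  rw [sum_congr rfl e, sum_comm, restrictedSum, mul_sum]
  refine sum_congr rfl fun φ hφ => ?_
  rw [← sum_filter, sum_const, nsmul_eq_mul]
  congr 2
  obtain ⟨h1, h2⟩ := mem_mapsExtending.1 hφ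
  have h3 := mem_mapsWithMult.1 h1 j
  have h4 : (univ.filter fun v => φ v = j) =
      (D.filter fun u => ψ u = j) ∪ (Dᶜ.filter fun u => φ u = j) := by
    ext u
    simp only [mem_filter, mem_univ, true_and, mem_union, mem_compl]
    by_cases hu : u ∈ D
    · simp [hu, h2 u hu]
    · simp [hu]
  have h5 : Disjoint (D.filter fun u => ψ u = j) (Dᶜ.filter fun u => φ u = j) :=
    disjoint_filter_filter disjoint_compl_right
  rw [h4, card_union_of_disjoint h5] at h3
  omega

theorem restrictedSum_congr {D : Finset (Fin N)} {ψ : Fin N → Fin k}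
    (h : ∀ e ∈ E, ∀ φ, W e φ = W' e φ) :
    restrictedSum μ E W D ψ = restrictedSum μ E W' D ψ :=
  sum_congr rfl fun φ _ => prod_congr rfl fun e he => h e he φ

theorem comp_swap_mem_mapsWithMult {φ : Fin N → Fin k} (h : φ ∈ mapsWithMult μ) (v w : Fin N) :
    φ ∘ Equiv.swap v w ∈ mapsWithMult μ := by
  rw [mem_mapsWithMult] at *
  intro i
  rw [← h i]
  refine card_bij (fun u _ => Equiv.swap v w u) ?_ ?_ ?_
  · intro u hu; simpa using hu
  · intro a _ b _ hab; exact (Equiv.swap v w).injective hab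
  · intro b hb
    exact ⟨Equiv.swap v w b, by simpa using hb, by simp⟩

theorem comp_swap_mem_mapsExtending {D : Finset (Fin N)} {v w : Fin N} (hv : v ∉ D) (hw : w ∉ D)
    (hvw : v ≠ w) {ψ φ : Fin N → Fin k} {i j : Fin k}
    (h : φ ∈ mapsExtending μ (insert w (insert v D))
      (Function.update (Function.update ψ v j) w i)) :
    φ ∘ Equiv.swap v w ∈ mapsExtending μ (insert w (insert v D))
      (Function.update (Function.update ψ v i) w j) := by
  have hw' : w ∉ insert v D := by simp [hw, hvw.symm]
  rw [mem_mapsExtending_insert hw', mem_mapsExtending_insert hv, mem_mapsExtending] at h ⊢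
  obtain ⟨⟨⟨h1, h2⟩, h3⟩, h4⟩ := h
  refine ⟨⟨⟨comp_swap_mem_mapsWithMult h1 v w, fun u hu => ?_⟩, by simp [h4]⟩, by simp [h3]⟩
  rw [Function.comp_apply, Equiv.swap_apply_of_ne_of_ne (ne_of_mem_of_not_mem hu hv)
    (ne_of_mem_of_not_mem hu hw), h2 u hu]

/-- Exchanging the colors of two fixed vertices amounts to changing the weights of the edges at
these vertices. -/
theorem restrictedSum_swap {D : Finset (Fin N)} {v w : Fin N} (hv : v ∉ D) (hw : w ∉ D)
    (hvw : v ≠ w) (ψ : Fin N → Fin k) (i j : Fin k) :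
    restrictedSum μ E W (insert w (insert v D)) (Function.update (Function.update ψ v j) w i) =
    restrictedSum μ E (fun e φ => W e (Function.update (Function.update φ v j) w i))
      (insert w (insert v D)) (Function.update (Function.update ψ v i) w j) := by
  refine sum_nbij' (fun φ => φ ∘ Equiv.swap v w) (fun φ => φ ∘ Equiv.swap v w) ?_ ?_ ?_ ?_ ?_
  · intro φ hφ
    exact comp_swap_mem_mapsExtending hv hw hvw hφ
  · intro φ hφ
    exact comp_swap_mem_mapsExtending hv hw hvw hφ
  · intro φ _; ext u; simp
  · intro φ _; ext u; simp
  · intro φ hφ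
    have hw' : w ∉ insert v D := by simp [hw, hvw.symm]
    rw [mem_mapsExtending_insert hw', mem_mapsExtending_insert hv] at hφ
    refine prod_congr rfl fun e _ => ?_
    congr 1
    ext u
    by_cases h1 : u = w
    · subst h1; simp [hφ.2]
    by_cases h2 : u = v
    · subst h2; simp [h1, hφ.1.2]
    · simp [h1, h2, Equiv.swap_apply_of_ne_of_ne h2 h1]

theorem IsEdgeWeight.update {W : Sym2 (Fin N) → (Fin N → Fin k) → ℂ} (h : IsEdgeWeight E r W)
    (v w : Fin N) (i j : Fin k) :
    IsEdgeWeight E r (fun e φ => W e (Function.update (Function.update φ v j) w i)) := by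
  refine ⟨fun e φ φ' hφ => h.congr _ _ _ fun u hu => ?_, fun e he φ => h.near e he _⟩
  by_cases h1 : u = w
  · subst h1; simp
  by_cases h2 : u = v
  · subst h2; simp [h1]
  · simp [h1, h2, hφ u hu]

theorem IsEdgeWeight.piecewise (h : IsEdgeWeight E r W) (h' : IsEdgeWeight E r W')
    (F : Finset (Sym2 (Fin N))) : IsEdgeWeight E r (F.piecewise W' W) := by
  constructor
  · intro e φ φ' hφ
    by_cases he : e ∈ F
    · simp only [he, piecewise_eq_of_mem]; exact h'.congr _ _ _ hφ
    · simp only [he, not_false_eq_true, piecewise_eq_of_notMem]; exact h.congr _ _ _ hφ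
  · intro e heE φ
    by_cases he : e ∈ F
    · simp only [he, piecewise_eq_of_mem]; exact h'.near e heE φ
    · simp only [he, not_false_eq_true, piecewise_eq_of_notMem]; exact h.near e heE φ

/-- Changing the weight of an edge whose ends have fixed colors multiplies a restricted sum by a
number close to `1`. -/
theorem norm_restrictedSum_sub_le_of_fixed (hr : r < 1) (h : IsEdgeWeight E r W)
    (h' : IsEdgeWeight E r W') {e : Sym2 (Fin N)} (he : e ∈ E)
    (hW : ∀ e' ∈ E, e' ≠ e → ∀ φ, W' e' φ = W e' φ) {D : Finset (Fin N)} (hD : ∀ v ∈ e, v ∈ D)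
    (ψ : Fin N → Fin k) :
    ‖restrictedSum μ E W' D ψ - restrictedSum μ E W D ψ‖ ≤
      2 * r / (1 - r) * ‖restrictedSum μ E W D ψ‖ := by
  have key : ∀ W₀ : Sym2 (Fin N) → (Fin N → Fin k) → ℂ, IsEdgeWeight E r W₀ →
      restrictedSum μ E W₀ D ψ = W₀ e ψ * restrictedSum μ (E.erase e) W₀ D ψ := by
    intro W₀ h₀
    rw [restrictedSum, restrictedSum, mul_sum]
    refine sum_congr rfl fun φ hφ => ?_
    rw [← mul_prod_erase E _ he,
      h₀.congr e φ ψ fun v hv => (mem_mapsExtending.1 hφ).2 v (hD v hv)]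
  have e2 : restrictedSum μ (E.erase e) W' D ψ = restrictedSum μ (E.erase e) W D ψ :=
    restrictedSum_congr fun e' he' φ => hW e' (mem_of_mem_erase he') (ne_of_mem_erase he') φ
  rw [key W h, key W' h', e2, ← sub_mul, norm_mul, norm_mul, ← mul_assoc]
  refine mul_le_mul_of_nonneg_right ?_ (norm_nonneg _)
  have n1 : ‖W' e ψ - W e ψ‖ ≤ 2 * r := by
    have : W' e ψ - W e ψ = (W' e ψ - 1) - (W e ψ - 1) := by ring
    rw [this]
    exact (norm_sub_le _ _).trans (by linarith [h.near e he ψ, h'.near e he ψ])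
  have n2 : 1 - r ≤ ‖W e ψ‖ := by
    have := norm_sub_norm_le (1 : ℂ) (1 - W e ψ)
    rw [norm_one, sub_sub_cancel, norm_sub_rev] at this
    linarith [h.near e he ψ]
  have hr0 : 0 ≤ r := (norm_nonneg _).trans (h.near e he ψ)
  rw [div_mul_eq_mul_div, le_div_iff₀ (by linarith)]
  calc ‖W' e ψ - W e ψ‖ * (1 - r) ≤ 2 * r * ‖W e ψ‖ := by
        apply mul_le_mul n1 n2 (by linarith) (by linarith)

/-- The restricted sums with one more vertex fixed are nearly aligned, both when only its color
varies and when only the vertex varies; and this for all admissible weights. -/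
structure AlignedExtensions (μ : Fin k → ℕ) (E : Finset (Sym2 (Fin N))) (r κ : ℝ)
    (D : Finset (Fin N)) : Prop where
  colors : ∀ W, IsEdgeWeight E r W → ∀ (ψ : Fin N → Fin k), ∀ v ∉ D, ∀ i j,
    NearlyAligned (κ ^ 2) (restrictedSum μ E W (insert v D) (Function.update ψ v i))
      (restrictedSum μ E W (insert v D) (Function.update ψ v j))
  vertices : ∀ W, IsEdgeWeight E r W → ∀ (ψ : Fin N → Fin k), ∀ u ∉ D, ∀ w ∉ D, ∀ i,
    NearlyAligned (κ ^ 2) (restrictedSum μ E W (insert u D) (Function.update ψ u i))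
      (restrictedSum μ E W (insert w D) (Function.update ψ w i))

variable {κ : ℝ}

/-- Fixing a vertex loses at most a factor `κ` to cancellation. -/
theorem AlignedExtensions.sum_norm_le {D : Finset (Fin N)} (hA : AlignedExtensions μ E r κ D)
    (h : IsEdgeWeight E r W) {v : Fin N} (hv : v ∉ D) (ψ : Fin N → Fin k) :
    κ * ∑ i, ‖restrictedSum μ E W (insert v D) (Function.update ψ v i)‖ ≤
      ‖restrictedSum μ E W D ψ‖ := by
  rw [restrictedSum_eq_sum_colors hv ψ]
  exact sum_norm_le_of_nearlyAligned _ _ fun i _ j _ => hA.colors W h ψ v hv i j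

/-- Changing the weight of one edge at a fixed vertex. If the other end `u` is free, the restricted
sum is split according to the color of `u`. -/
theorem AlignedExtensions.norm_sub_le_one_edge {D : Finset (Fin N)}
    (hA : AlignedExtensions μ E r κ D) (hκ : 0 < κ) (hκ1 : κ ≤ 1) (hr : r < 1)
    (h : IsEdgeWeight E r W) (h' : IsEdgeWeight E r W') {e : Sym2 (Fin N)} (he : e ∈ E)
    (hW : ∀ e' ∈ E, e' ≠ e → ∀ φ, W' e' φ = W e' φ) {v : Fin N} (hv : v ∈ D) (hve : v ∈ e)
    (ψ : Fin N → Fin k) :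
    ‖restrictedSum μ E W' D ψ - restrictedSum μ E W D ψ‖ ≤
      2 * r / (1 - r) / κ * ‖restrictedSum μ E W D ψ‖ := by
  have hr0 : 0 ≤ r := (norm_nonneg _).trans (h.near e he ψ)
  have hη : 0 ≤ 2 * r / (1 - r) := div_nonneg (by linarith) (by linarith)
  obtain ⟨u, rfl⟩ := Sym2.mem_iff_exists.1 hve
  by_cases hu : u ∈ D
  · refine (norm_restrictedSum_sub_le_of_fixed hr h h' he hW (fun x hx => ?_) ψ).trans ?_
    · rcases Sym2.mem_iff.1 hx with rfl | rfl <;> assumption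
    · exact mul_le_mul_of_nonneg_right (le_div_self hη hκ hκ1) (norm_nonneg _)
  · rw [restrictedSum_eq_sum_colors (W := W') hu ψ, restrictedSum_eq_sum_colors (W := W) hu ψ,
      ← sum_sub_distrib]
    have h1 := hA.sum_norm_le h hu ψ
    rw [restrictedSum_eq_sum_colors (W := W) hu ψ] at h1
    refine (norm_sum_le_of_le _ fun i _ =>
      norm_restrictedSum_sub_le_of_fixed hr h h' he hW (fun x hx => ?_) _).trans ?_
    · rcases Sym2.mem_iff.1 hx with rfl | rfl <;> simp [hv]
    · rw [← mul_sum, div_mul_eq_mul_div _ κ, le_div_iff₀ hκ, mul_assoc, mul_comm _ κ]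
      exact mul_le_mul_of_nonneg_left h1 hη

/-- Changing the weights of several edges at a fixed vertex, one after the other. -/
theorem AlignedExtensions.norm_sub_le_star {D : Finset (Fin N)}
    (hA : AlignedExtensions μ E r κ D) (hκ : 0 < κ) (hκ1 : κ ≤ 1) (hr0 : 0 ≤ r) (hr : r < 1)
    (h : IsEdgeWeight E r W) (h' : IsEdgeWeight E r W') {v : Fin N} (hv : v ∈ D)
    (ψ : Fin N → Fin k) (F : Finset (Sym2 (Fin N))) (hFE : F ⊆ E) (hF : ∀ e ∈ F, v ∈ e) :
    ‖restrictedSum μ E (F.piecewise W' W) D ψ - restrictedSum μ E W D ψ‖ ≤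
      ((1 + 2 * r / (1 - r) / κ) ^ F.card - 1) * ‖restrictedSum μ E W D ψ‖ := by
  have hη : 0 ≤ 2 * r / (1 - r) / κ :=
    div_nonneg (div_nonneg (by linarith) (by linarith)) hκ.le
  set η := 2 * r / (1 - r) / κ
  induction F using Finset.induction_on with
  | empty => simp
  | insert e F heF ih =>
    have ih := ih (fun e he => hFE (mem_insert_of_mem he)) fun e he => hF e (mem_insert_of_mem he)
    set Z := restrictedSum μ E W D ψ
    set Z₁ := restrictedSum μ E (F.piecewise W' W) D ψ
    set Z₂ := restrictedSum μ E ((insert e F).piecewise W' W) D ψ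
    have h1 : ‖Z₂ - Z₁‖ ≤ η * ‖Z₁‖ := by
      refine hA.norm_sub_le_one_edge hκ hκ1 hr (h.piecewise h' F) (h.piecewise h' _)
        (hFE (mem_insert_self e F)) ?_ hv (hF e (mem_insert_self e F)) ψ
      intro e' _ hne φ
      simp [piecewise, mem_insert, hne]
    have h2 : ‖Z₁‖ ≤ (1 + η) ^ F.card * ‖Z‖ := by
      have := norm_sub_norm_le Z₁ Z
      linarith
    rw [card_insert_of_notMem heF, pow_succ]
    have h3 : ‖Z₂ - Z‖ ≤ ‖Z₂ - Z₁‖ + ‖Z₁ - Z‖ := norm_sub_le_norm_sub_add_norm_sub _ _ _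
    nlinarith [mul_le_mul_of_nonneg_left h2 hη]

/-- Exchanging the colors of two vertices changes a restricted sum little: at most `2 d` edges are
affected, and the comparison goes through the weights that are changed only at the first vertex. -/
theorem AlignedExtensions.norm_sub_swap_le {D : Finset (Fin N)} {v w : Fin N} (hv : v ∉ D)
    (hw : w ∉ D) (hvw : v ≠ w) (hA : AlignedExtensions μ E r κ (insert w (insert v D)))
    (hκ : 0 < κ) (hκ1 : κ ≤ 1) (hr0 : 0 ≤ r) (hr : r < 1) {d : ℕ}
    (hd : ∀ u, (E.filter fun e => u ∈ e).card ≤ d) {s : ℝ}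
    (hs : (1 + 2 * r / (1 - r) / κ) ^ d ≤ 1 + s)
    (h : IsEdgeWeight E r W) (ψ : Fin N → Fin k) (i j : Fin k) :
    let x := restrictedSum μ E W (insert w (insert v D))
      (Function.update (Function.update ψ v i) w j)
    let y := restrictedSum μ E W (insert w (insert v D))
      (Function.update (Function.update ψ v j) w i)
    ‖x - y‖ ≤ s * (‖x‖ + ‖y‖) := by
  intro x y
  set D₂ := insert w (insert v D)
  set ψ₁ := Function.update (Function.update ψ v i) w j
  set W' : Sym2 (Fin N) → (Fin N → Fin k) → ℂ :=
    fun e φ => W e (Function.update (Function.update φ v j) w i) with hW'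
  have h' : IsEdgeWeight E r W' := h.update v w i j
  have hy : y = restrictedSum μ E W' D₂ ψ₁ := restrictedSum_swap hv hw hvw ψ i j
  set F₁ := E.filter fun e => v ∈ e
  set F₂ := E.filter fun e => w ∈ e ∧ v ∉ e
  set m := restrictedSum μ E (F₁.piecewise W' W) D₂ ψ₁ with hm
  have hη : 0 ≤ 2 * r / (1 - r) / κ :=
    div_nonneg (div_nonneg (by linarith) (by linarith)) hκ.le
  have hpow : ∀ F : Finset (Sym2 (Fin N)), F.card ≤ d →
      (1 + 2 * r / (1 - r) / κ) ^ F.card - 1 ≤ s := fun F hF => by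
    have := pow_le_pow_right₀ (by linarith : 1 ≤ 1 + 2 * r / (1 - r) / κ) hF
    linarith
  have h1 : ‖m - x‖ ≤ s * ‖x‖ := by
    refine (hA.norm_sub_le_star hκ hκ1 hr0 hr h h' (by simp [D₂]) ψ₁ F₁ (filter_subset _ _)
      fun e he => (mem_filter.1 he).2).trans ?_
    exact mul_le_mul_of_nonneg_right (hpow _ (hd v)) (norm_nonneg _)
  have hm2 : m = restrictedSum μ E (F₂.piecewise W W') D₂ ψ₁ := by
    refine restrictedSum_congr fun e he φ => ?_
    by_cases hve : v ∈ e
    · rw [piecewise_eq_of_mem _ _ _ (by simp [F₁, he, hve]),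
        piecewise_eq_of_notMem _ _ _ (by simp [F₂, hve])]
    rw [piecewise_eq_of_notMem _ _ _ (by simp [F₁, hve])]
    by_cases hwe : w ∈ e
    · rw [piecewise_eq_of_mem _ _ _ (by simp [F₂, he, hve, hwe])]
    · rw [piecewise_eq_of_notMem _ _ _ (by simp [F₂, hwe])]
      refine h.congr _ _ _ fun u hu => ?_
      rw [Function.update_of_ne (ne_of_mem_of_not_mem hu hwe),
        Function.update_of_ne (ne_of_mem_of_not_mem hu hve)]
  have h2 : ‖m - y‖ ≤ s * ‖y‖ := by
    rw [hm2, hy]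
    refine (hA.norm_sub_le_star hκ hκ1 hr0 hr h' h (v := w) (by simp [D₂]) ψ₁ F₂
      (filter_subset _ _) fun e he => (mem_filter.1 he).2.1).trans ?_
    refine mul_le_mul_of_nonneg_right (hpow _ (le_trans (card_le_card ?_) (hd w))) (norm_nonneg _)
    exact monotone_filter_right _ fun e _ he => he.1
  have h3 : ‖x - y‖ ≤ ‖x - m‖ + ‖m - y‖ := norm_sub_le_norm_sub_add_norm_sub _ _ _
  rw [norm_sub_rev x m] at h3
  linarith

/-- If the multiplicity of `j` is exhausted, then no further vertex can get the color `j`. The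
hypothesis counts with `v` in another color `i`, in the form in which
`mul_restrictedSum_eq_sum_vertices` produces it. -/
theorem restrictedSum_eq_zero_of_full {D : Finset (Fin N)} {v : Fin N} (hv : v ∉ D)
    {ψ : Fin N → Fin k} {i j : Fin k} (hij : i ≠ j)
    (h : μ j - ((insert v D).filter fun u => Function.update ψ v i u = j).card = 0) :
    restrictedSum μ E W (insert v D) (Function.update ψ v j) = 0 := by
  refine sum_eq_zero fun φ hφ => ?_
  exfalso
  rw [mem_mapsExtending_insert hv, mem_mapsExtending] at hφ
  obtain ⟨⟨h1, h2⟩, h3⟩ := hφ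
  have h4 := mem_mapsWithMult.1 h1 j
  have h5 : insert v ((insert v D).filter fun u => Function.update ψ v i u = j) ⊆
      univ.filter fun u => φ u = j := by
    intro u hu
    rw [mem_insert, mem_filter, mem_insert] at hu
    rw [mem_filter]
    refine ⟨mem_univ _, ?_⟩
    by_cases huv : u = v
    · rw [huv, h3]
    · rcases hu with hu | ⟨hu | hu, hu'⟩
      · exact absurd hu huv
      · exact absurd hu huv
      · rw [h2 u hu]; rwa [Function.update_of_ne huv] at hu'
  have h6 := card_le_card h5
  rw [card_insert_of_notMem (by simp [hij]), h4] at h6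
  omega

/-- The induction step compares two restricted sums by fixing one further vertex in both, so that
the summands correspond to each other under an exchange of colors. For two colors of the same
vertex, the further vertex `w` ranges over the free vertices and gets the other color; for two
vertices in the same color, the color of the other vertex is varied. -/
theorem alignedExtensions (hκ : 0 < κ) (hκ1 : κ ≤ 1) (hr0 : 0 ≤ r) (hr : r < 1) {d : ℕ}
    (hd : ∀ u, (E.filter fun e => u ∈ e).card ≤ d) {s : ℝ} (hs0 : 0 ≤ s) (hsκ : s ≤ κ)
    (hκs : κ ^ 2 ≤ 1 - 2 * (s / κ) ^ 2)
    (hs : (1 + 2 * r / (1 - r) / κ) ^ d ≤ 1 + s) :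
    ∀ (n : ℕ) (D : Finset (Fin N)), Dᶜ.card ≤ n → AlignedExtensions μ E r κ D := by
  have hκ2 : κ ^ 2 ≤ 1 := by nlinarith
  intro n
  induction n with
  | zero =>
    intro D hD
    have : D = univ := by simpa using hD
    subst this
    exact ⟨fun W _ ψ v hv => absurd (mem_univ _) hv, fun W _ ψ v hv => absurd (mem_univ _) hv⟩
  | succ n ih =>
    intro D hD
    have ih1 : ∀ v ∉ D, AlignedExtensions μ E r κ (insert v D) := by
      intro v hv
      apply ih
      rw [compl_insert, card_erase_of_mem (by simpa using hv)]
      omega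
    have ih2 : ∀ v ∉ D, ∀ w, AlignedExtensions μ E r κ (insert w (insert v D)) := by
      intro v hv w
      by_cases hw : w ∈ insert v D
      · rw [insert_eq_of_mem hw]; exact ih1 v hv
      · apply ih
        have := card_le_card (compl_subset_compl.2 (subset_insert w (insert v D)))
        rw [compl_insert (a := v), card_erase_of_mem (by simpa using hv)] at this
        omega
    constructor
    · intro W h ψ v hv i j
      by_cases hij : i = j
      · subst hij; exact NearlyAligned.self hκ2 _
      set a := μ j - ((insert v D).filter fun u => Function.update ψ v i u = j).card with ha
      set b := μ i - ((insert v D).filter fun u => Function.update ψ v j u = i).card with hb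
      rcases Nat.eq_zero_or_pos a with ha0 | ha0
      · rw [restrictedSum_eq_zero_of_full (ψ := ψ) hv hij ha0]; simp [NearlyAligned]
      rcases Nat.eq_zero_or_pos b with hb0 | hb0
      · rw [restrictedSum_eq_zero_of_full (ψ := ψ) (i := j) hv (Ne.symm hij) hb0]
        simp [NearlyAligned]
      -- The factors `a`, `b` count the free places of the other color; if one of them is zero, then
      -- so is one of the two sums.
      refine NearlyAligned.of_smul ha0 hb0 ?_
      rw [mul_restrictedSum_eq_sum_vertices, mul_restrictedSum_eq_sum_vertices]
      refine nearlyAligned_sum_sum _ _ _ hκ hs0 hsκ hκs ?_ ?_ ?_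
      · intro w hw w' hw'
        exact (ih1 v hv).vertices W h _ w (mem_compl.1 hw) w' (mem_compl.1 hw') j
      · intro w hw w' hw'
        exact (ih1 v hv).vertices W h _ w (mem_compl.1 hw) w' (mem_compl.1 hw') i
      · intro w hw
        rw [mem_compl, mem_insert, not_or] at hw
        exact (ih2 v hv w).norm_sub_swap_le hv hw.2 (Ne.symm hw.1) hκ hκ1 hr0 hr hd hs h ψ i j
    · intro W h ψ u hu w hw i
      by_cases huw : u = w
      · subst huw; exact NearlyAligned.self hκ2 _
      rw [restrictedSum_eq_sum_colors (v := w) (D := insert u D) (by simp [hw, Ne.symm huw]),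
        restrictedSum_eq_sum_colors (v := u) (D := insert w D) (by simp [hu, huw])]
      refine nearlyAligned_sum_sum _ _ _ hκ hs0 hsκ hκs ?_ ?_ ?_
      · intro j _ j' _
        exact (ih1 u hu).colors W h _ w (by simp [hw, Ne.symm huw]) j j'
      · intro j _ j' _
        exact (ih1 w hw).colors W h _ u (by simp [hu, huw]) j j'
      · intro j _
        rw [insert_comm u w D, Function.update_comm (Ne.symm huw)]
        exact (ih2 u hu w).norm_sub_swap_le hu hw huw hκ hκ1 hr0 hr hd hs h ψ i j

theorem restrictedSum_univ_ne_zero (hr : r < 1) (h : IsEdgeWeight E r W) {ψ : Fin N → Fin k}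
    (hψ : ψ ∈ mapsWithMult μ) : restrictedSum μ E W univ ψ ≠ 0 := by
  have : mapsExtending μ univ ψ = {ψ} := by
    ext φ
    rw [mem_mapsExtending, mem_singleton]
    constructor
    · rintro ⟨_, h2⟩; ext v; rw [h2 v (mem_univ v)]
    · rintro rfl; exact ⟨hψ, fun _ _ => rfl⟩
  rw [restrictedSum, this, sum_singleton, prod_ne_zero_iff]
  intro e he h0
  have := h.near e he ψ
  rw [h0, zero_sub, norm_neg, norm_one] at this
  linarith

theorem restrictedSum_ne_zero (hκ : 0 < κ) (hr : r < 1)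
    (hA : ∀ D : Finset (Fin N), AlignedExtensions μ E r κ D) (h : IsEdgeWeight E r W)
    {ψ : Fin N → Fin k} (hψ : ψ ∈ mapsWithMult μ) :
    ∀ (n : ℕ) (D : Finset (Fin N)), Dᶜ.card = n → restrictedSum μ E W D ψ ≠ 0 := by
  intro n
  induction n with
  | zero =>
    intro D hD
    have : D = univ := by simpa using hD
    subst this
    exact restrictedSum_univ_ne_zero hr h hψ
  | succ n ih =>
    intro D hD h0
    obtain ⟨v, hv⟩ := card_pos.1 (by omega : 0 < Dᶜ.card)
    rw [mem_compl] at hv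
    have h1 := (hA D).sum_norm_le h hv ψ
    rw [h0, norm_zero] at h1
    have h2 : restrictedSum μ E W (insert v D) (Function.update ψ v (ψ v)) ≠ 0 := by
      rw [Function.update_eq_self]
      apply ih
      rw [compl_insert, card_erase_of_mem (by simpa using hv)]
      omega
    have h3 := single_le_sum (f := fun i =>
      ‖restrictedSum μ E W (insert v D) (Function.update ψ v i)‖) (fun _ _ => norm_nonneg _)
      (mem_univ (ψ v))
    have h4 := norm_pos_iff.2 h2
    nlinarith

/-- **Zero-free region.** The radius `0.1005 / d` exceeds `0.1 / d`, which leaves room for a disc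
of radius `1.005` on the segment from the all-ones matrix. The cosine of the angle is `0.89 ^ 2`. -/
theorem sum_prod_ne_zero {d : ℕ} (hd0 : 1 ≤ d) (hd : ∀ u, (E.filter fun e => u ∈ e).card ≤ d)
    (h : IsEdgeWeight E (0.1005 / d) W) (hμ : (mapsWithMult μ : Finset (Fin N → Fin k)).Nonempty) :
    ∑ φ ∈ (mapsWithMult μ : Finset (Fin N → Fin k)), ∏ e ∈ E, W e φ ≠ 0 := by
  obtain ⟨ψ, hψ⟩ := hμ
  have hd1 : (1 : ℝ) ≤ d := by exact_mod_cast hd0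
  have hr : (0.1005 / d : ℝ) ≤ 0.1005 := div_le_self (by norm_num) hd1
  have hr0 : (0 : ℝ) ≤ 0.1005 / d := by positivity
  -- The constants satisfy `exp 0.2511 ≤ 1.2855` and `0.89 ^ 2 ≤ 1 - 2 (0.2855 / 0.89) ^ 2`.
  have hpow : (1 + 2 * (0.1005 / d : ℝ) / (1 - 0.1005 / d) / 0.89) ^ d ≤ 1 + 0.2855 := by
    have h1 : 2 * (0.1005 / d : ℝ) / (1 - 0.1005 / d) / 0.89 ≤ 0.2511 / d := by
      rw [div_div, div_le_div_iff₀ (by nlinarith) (by linarith)]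
      rw [mul_div_assoc', div_mul_cancel₀ _ (by positivity)]
      linarith
    have h0 : (0 : ℝ) ≤ 2 * (0.1005 / d : ℝ) / (1 - 0.1005 / d) / 0.89 :=
      div_nonneg (div_nonneg (by linarith) (by linarith)) (by norm_num)
    calc _ ≤ (Real.exp (0.2511 / d)) ^ d := by
          refine pow_le_pow_left₀ (by linarith) ?_ d
          linarith [Real.add_one_le_exp (0.2511 / d : ℝ)]
      _ = Real.exp 0.2511 := by
          rw [← Real.exp_nat_mul, mul_div_cancel₀ _ (by positivity)]
      _ ≤ _ := by
          refine (Real.exp_bound' (n := 4) (by norm_num) (by norm_num) (by norm_num)).trans ?_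
          norm_num [sum_range_succ, Nat.factorial]
  have hA := fun D => alignedExtensions (μ := μ) (E := E) (κ := 0.89) (s := 0.2855)
    (by norm_num) (by norm_num) hr0 (by linarith) hd (by norm_num) (by norm_num) (by norm_num)
    hpow _ D le_rfl
  have := restrictedSum_ne_zero (by norm_num) (by linarith) hA h hψ _ ∅ rfl
  rwa [restrictedSum, show mapsExtending μ ∅ ψ = mapsWithMult μ by simp [mapsExtending]] at this

end Restricted

/-! ### The logarithm of a polynomial without zeros in a disc -/

section LogPolynomial

open Polynomial

theorem eq_C_coeff_zero_mul_prod_one_sub (p : ℂ[X]) (h0 : p.coeff 0 ≠ 0) :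
    p = C (p.coeff 0) * ((p.roots.map fun r => 1 - C r⁻¹ * X)).prod := by
  have hp : p ≠ 0 := by rintro rfl; simp at h0
  have hs := (IsAlgClosed.splits p).eq_prod_roots
  have hr : ∀ r ∈ p.roots, r ≠ 0 := by
    rintro r hr rfl
    exact h0 (by rw [coeff_zero_eq_eval_zero]; exact (mem_roots hp).1 hr)
  have e : (p.roots.map fun r => X - C r) =
      p.roots.map fun r => C (-r) * (1 - C r⁻¹ * X) := by
    refine Multiset.map_congr rfl fun r h => ?_
    rw [mul_sub, mul_one, ← mul_assoc, ← C_mul, neg_mul, mul_inv_cancel₀ (hr r h)]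
    simp only [map_neg, map_one]; ring
  rw [e, Multiset.prod_map_mul] at hs
  have e2 : (p.roots.map fun r => C (-r)).prod = C (p.roots.map fun r => -r).prod := by
    rw [← Multiset.prod_hom, Multiset.map_map]; rfl
  rw [e2, ← mul_assoc, ← C_mul] at hs
  set c := p.leadingCoeff * (p.roots.map fun r => -r).prod
  have hc : p.coeff 0 = c := by
    conv_lhs => rw [hs]
    rw [coeff_zero_eq_eval_zero, eval_mul, eval_C, eval_multiset_prod, Multiset.map_map]
    simp
  rw [hc]; exact hs

theorem eval_prod_one_sub (s : Multiset ℂ) (z : ℂ) :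
    ((s.map fun a => (1 - C a * X : ℂ[X])).prod).eval z = (s.map fun a => 1 - a * z).prod := by
  rw [eval_multiset_prod, Multiset.map_map]; simp

/-- Newton's identities, in the form of the logarithmic derivative of a product of formal power
series. -/
theorem derivative_prod_one_sub (s : Multiset ℂ) :
    PowerSeries.derivative ℂ ((s.map fun a => (1 - PowerSeries.C a * PowerSeries.X)).prod) =
      (s.map fun a => (1 - PowerSeries.C a * PowerSeries.X)).prod *
        PowerSeries.mk fun m => -(s.map fun a => a ^ (m + 1)).sum := by
  induction s using Multiset.induction_on with
  | empty => simp; ext; simp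
  | cons a s ih =>
    have h1 : PowerSeries.derivative ℂ (1 - PowerSeries.C a * PowerSeries.X) =
        (1 - PowerSeries.C a * PowerSeries.X) * PowerSeries.mk fun m => -a ^ (m + 1) := by
      ext m
      rw [sub_mul, one_mul, mul_assoc, PowerSeries.coeff_derivative, map_sub, map_sub,
        PowerSeries.coeff_C_mul, PowerSeries.coeff_C_mul]
      rcases m with _ | m
      · simp
      · rw [PowerSeries.coeff_succ_X_mul]
        simp [PowerSeries.coeff_X, PowerSeries.coeff_one, PowerSeries.coeff_mk]
        ring
    have h2 : (PowerSeries.mk fun m => -((a ::ₘ s).map fun a => a ^ (m + 1)).sum) =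
        (PowerSeries.mk fun m => -a ^ (m + 1)) +
          PowerSeries.mk fun m => -(s.map fun a => a ^ (m + 1)).sum := by
      ext m; simp; ring
    rw [Multiset.map_cons, Multiset.prod_cons, Derivation.leibniz, ih, h1, h2]
    simp only [smul_eq_mul]
    ring

theorem newton_prod_one_sub (s : Multiset ℂ) (j : ℕ) :
    ((j + 1 : ℕ) : ℂ) * ((s.map fun a => (1 - C a * X : ℂ[X])).prod).coeff (j + 1) =
      ∑ i ∈ Icc 1 (j + 1), (i : ℂ) * (-(s.map fun a => a ^ i).sum / i) *
        ((s.map fun a => (1 - C a * X : ℂ[X])).prod).coeff (j + 1 - i) := by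
  set P := (s.map fun a => (1 - C a * X : ℂ[X])).prod with hP
  have e : (P : PowerSeries ℂ) =
      (s.map fun a => (1 - PowerSeries.C a * PowerSeries.X)).prod := by
    rw [hP, ← Polynomial.coeToPowerSeries.ringHom_apply, map_multiset_prod, Multiset.map_map]
    congr 2
    ext1 a
    rw [Function.comp_apply, map_sub, map_mul, map_one,
      Polynomial.coeToPowerSeries.ringHom_apply, Polynomial.coeToPowerSeries.ringHom_apply,
      Polynomial.coe_C, Polynomial.coe_X]
  have h := congrArg (PowerSeries.coeff j) (derivative_prod_one_sub s)
  rw [← e, PowerSeries.coeff_derivative, Polynomial.coeff_coe, mul_comm (P : PowerSeries ℂ),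
    PowerSeries.coeff_mul, Finset.Nat.sum_antidiagonal_eq_sum_range_succ_mk] at h
  rw [mul_comm, Nat.cast_add_one, h, range_eq_Ico,
    ← Finset.Ico_add_one_right_eq_Icc, show Ico 1 (j + 1 + 1) = Ico (0 + 1) (j + 1 + 1) from rfl,
    ← Finset.sum_Ico_add' _ 0 (j + 1) 1]
  refine sum_congr rfl fun i _ => ?_
  have hi : ((i + 1 : ℕ) : ℂ) ≠ 0 := by exact_mod_cast Nat.succ_ne_zero i
  rw [PowerSeries.coeff_mk, Polynomial.coeff_coe, Nat.add_sub_add_right, mul_div_cancel₀ _ hi]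

theorem one_sub_mem_slitPlane {a z : ℂ} (ha : ‖a‖ < 1) (hz : ‖z‖ ≤ 1) :
    1 - a * z ∈ Complex.slitPlane := by
  rw [sub_eq_add_neg]
  refine Complex.mem_slitPlane_of_norm_lt_one ?_
  rw [norm_neg, norm_mul]
  nlinarith [norm_nonneg a, norm_nonneg z]

theorem analyticAt_log_one_sub {a z : ℂ} (ha : ‖a‖ < 1) (hz : ‖z‖ ≤ 1) :
    AnalyticAt ℂ (fun z => Complex.log (1 - a * z)) z :=
  AnalyticAt.clog (by fun_prop) (one_sub_mem_slitPlane ha hz)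

theorem iteratedDeriv_log_one_sub (a : ℂ) (j : ℕ) :
    iteratedDeriv (j + 1) (fun z => Complex.log (1 - a * z)) 0 = -(j.factorial * a ^ (j + 1)) := by
  have hU : ∀ᶠ z in nhds (0 : ℂ), 1 - a * z ∈ Complex.slitPlane := by
    have : ContinuousAt (fun z : ℂ => 1 - a * z) 0 := by fun_prop
    exact this.eventually_mem (Complex.isOpen_slitPlane.mem_nhds (by simp))
  have key : iteratedDeriv (j + 1) (fun z => Complex.log (1 - a * z)) =ᶠ[nhds 0]
      fun z => -(j.factorial * a ^ (j + 1)) * ((1 - a * z) ^ (j + 1))⁻¹ := by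
    induction j with
    | zero =>
      filter_upwards [hU] with z hz
      rw [iteratedDeriv_one]
      have h1 : HasDerivAt (fun z : ℂ => 1 - a * z) (-a) z := by
        simpa using ((hasDerivAt_id z).const_mul a).const_sub 1
      rw [(h1.clog hz).deriv]
      simp [div_eq_mul_inv]
    | succ j ih =>
      rw [iteratedDeriv_succ]
      refine ih.deriv.trans ?_
      filter_upwards [hU] with z hz
      have h0 := Complex.slitPlane_ne_zero hz
      have h1 : HasDerivAt (fun z : ℂ => 1 - a * z) (-a) z := by
        simpa using ((hasDerivAt_id z).const_mul a).const_sub 1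
      have h2 := ((h1.fun_pow (j + 1)).fun_inv (pow_ne_zero _ h0)).const_mul
        (-(j.factorial * a ^ (j + 1)) : ℂ)
      rw [h2.deriv, Nat.factorial_succ]
      push_cast
      field_simp
      ring
  rw [key.eq_of_nhds]; simp

/-- The logarithm of `∏ (1 - a z)`, over a multiset of numbers `a` in the unit disc, as the sum
of the principal logarithms of the factors. -/
noncomputable def logProd (s : Multiset ℂ) (z : ℂ) : ℂ :=
  (s.map fun a => Complex.log (1 - a * z)).sum

theorem logProd_cons (a : ℂ) (s : Multiset ℂ) :
    logProd (a ::ₘ s) = (fun z => Complex.log (1 - a * z)) + logProd s := by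
  ext z; simp [logProd]

theorem analyticAt_logProd {s : Multiset ℂ} (hs : ∀ a ∈ s, ‖a‖ < 1) {z : ℂ} (hz : ‖z‖ ≤ 1) :
    AnalyticAt ℂ (logProd s) z := by
  induction s using Multiset.induction_on with
  | empty =>
    have : logProd 0 = fun _ => 0 := by ext z; simp [logProd]
    rw [this]; exact analyticAt_const
  | cons a s ih =>
    rw [logProd_cons]
    exact (analyticAt_log_one_sub (hs a (Multiset.mem_cons_self a s)) hz).add
      (ih fun b hb => hs b (Multiset.mem_cons_of_mem hb))

theorem exp_logProd {s : Multiset ℂ} (hs : ∀ a ∈ s, ‖a‖ < 1) {z : ℂ} (hz : ‖z‖ ≤ 1) :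
    Complex.exp (logProd s z) = (s.map fun a => 1 - a * z).prod := by
  rw [logProd, Complex.exp_multiset_sum, Multiset.map_map]
  congr 1
  refine Multiset.map_congr rfl fun a ha => ?_
  exact Complex.exp_log (Complex.slitPlane_ne_zero (one_sub_mem_slitPlane (hs a ha) hz))

theorem iteratedDeriv_logProd {s : Multiset ℂ} (hs : ∀ a ∈ s, ‖a‖ < 1) (j : ℕ) :
    iteratedDeriv (j + 1) (logProd s) 0 = -(j.factorial * (s.map fun a => a ^ (j + 1)).sum) := by
  induction s using Multiset.induction_on with
  | empty =>
    have : logProd 0 = fun _ => 0 := by ext z; simp [logProd]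
    simp [this]
  | cons a s ih =>
    have hs' : ∀ b ∈ s, ‖b‖ < 1 := fun b hb => hs b (Multiset.mem_cons_of_mem hb)
    rw [logProd_cons, iteratedDeriv_add, ih hs', iteratedDeriv_log_one_sub, Multiset.map_cons,
      Multiset.sum_cons]
    · ring
    · exact (analyticAt_log_one_sub (hs a (Multiset.mem_cons_self a s)) (by simp)).contDiffAt
    · exact (analyticAt_logProd hs' (by simp)).contDiffAt

theorem norm_log_one_sub_add_sum_le {a : ℂ} {q : ℝ} (hq : q < 1) (ha : ‖a‖ ≤ q) (n : ℕ) :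
    ‖Complex.log (1 - a) - ∑ j ∈ Icc (1 : ℕ) n, -a ^ j / (j : ℂ)‖ ≤ q ^ (n + 1) * (1 - q)⁻¹ := by
  have h := Complex.norm_log_sub_logTaylor_le n (z := -a) (by rw [norm_neg]; linarith)
  have e : Complex.logTaylor (n + 1) (-a) = ∑ j ∈ Icc (1 : ℕ) n, -a ^ j / (j : ℂ) := by
    rw [Complex.logTaylor, sum_range_succ', range_eq_Ico, sum_Ico_add'
      (fun j : ℕ => (-1 : ℂ) ^ (j + 1) * (-a) ^ j / j), ← Finset.Ico_add_one_right_eq_Icc]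
    simp only [Nat.cast_zero, div_zero, add_zero, zero_add]
    refine sum_congr rfl fun j _ => ?_
    rw [neg_pow a, pow_succ, mul_neg_one, neg_mul, ← mul_assoc, ← mul_pow]
    simp
  rw [e, ← sub_eq_add_neg, norm_neg] at h
  refine h.trans ?_
  have hq0 : 0 ≤ q := (norm_nonneg a).trans ha
  calc ‖a‖ ^ (n + 1) * (1 - ‖a‖)⁻¹ / (n + 1) ≤ ‖a‖ ^ (n + 1) * (1 - ‖a‖)⁻¹ :=
        div_le_self (mul_nonneg (by positivity) (inv_nonneg.2 (by linarith)))
          (by linarith [(Nat.cast_nonneg n : (0 : ℝ) ≤ n)])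
    _ ≤ _ := by
        have := inv_anti₀ (by linarith : 0 < 1 - q) (by linarith : 1 - q ≤ 1 - ‖a‖)
        have h2 : 0 ≤ (1 - ‖a‖)⁻¹ := inv_nonneg.2 (by linarith)
        gcongr

theorem norm_logProd_sub_sum_le {s : Multiset ℂ} {q : ℝ} (hq : q < 1)
    (hs : ∀ a ∈ s, ‖a‖ ≤ q) (n : ℕ) :
    ‖logProd s 1 - ∑ j ∈ Icc 1 n, -(s.map fun a => a ^ j).sum / (j : ℂ)‖ ≤
      s.card * (q ^ (n + 1) * (1 - q)⁻¹) := by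
  induction s using Multiset.induction_on with
  | empty => simp [logProd]
  | cons a s ih =>
    have ih := ih fun b hb => hs b (Multiset.mem_cons_of_mem hb)
    have h1 := norm_log_one_sub_add_sum_le hq (hs a (Multiset.mem_cons_self a s)) n
    have e : logProd (a ::ₘ s) 1 - ∑ j ∈ Icc 1 n, -((a ::ₘ s).map fun a => a ^ j).sum / (j : ℂ) =
        (Complex.log (1 - a) - ∑ j ∈ Icc (1 : ℕ) n, -a ^ j / (j : ℂ)) +
        (logProd s 1 - ∑ j ∈ Icc 1 n, -(s.map fun a => a ^ j).sum / (j : ℂ)) := by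
      rw [logProd_cons]
      simp only [Pi.add_apply, mul_one, Multiset.map_cons, Multiset.sum_cons, neg_add, add_div,
        sum_add_distrib]
      ring
    rw [e, Multiset.card_cons]
    refine (norm_add_le _ _).trans ?_
    push_cast
    linarith

theorem norm_sum_pow_le {s : Multiset ℂ} {q : ℝ} (hs : ∀ a ∈ s, ‖a‖ ≤ q) (j : ℕ) :
    ‖(s.map fun a => a ^ j).sum‖ ≤ s.card * q ^ j := by
  induction s using Multiset.induction_on with
  | empty => simp
  | cons a s ih =>
    have ih := ih fun b hb => hs b (Multiset.mem_cons_of_mem hb)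
    have h1 : ‖a ^ j‖ ≤ q ^ j := by
      rw [norm_pow]; exact pow_le_pow_left₀ (norm_nonneg a) (hs a (Multiset.mem_cons_self a s)) j
    rw [Multiset.map_cons, Multiset.sum_cons, Multiset.card_cons]
    refine (norm_add_le _ _).trans ?_
    push_cast
    linarith

theorem sum_Icc_pow_le {q : ℝ} (hq0 : 0 ≤ q) (hq : q < 1) (n : ℕ) :
    ∑ j ∈ Icc 1 n, q ^ j ≤ q * (1 - q)⁻¹ := by
  have e : ∑ j ∈ Icc 1 n, q ^ j = q * ∑ j ∈ range n, q ^ j := by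
    rw [← Finset.Ico_add_one_right_eq_Icc, range_eq_Ico, mul_sum,
      show Ico 1 (n + 1) = Ico (0 + 1) (n + 1) from rfl, ← sum_Ico_add']
    exact sum_congr rfl fun j _ => by rw [pow_succ']
  rw [e]
  refine mul_le_mul_of_nonneg_left ?_ hq0
  rw [← tsum_geometric_of_lt_one hq0 hq]
  exact (summable_geometric_of_lt_one hq0 hq).sum_le_tsum _ fun _ _ => by positivity

/-- `F j`, for `j ≥ 1`, are the Taylor coefficients at `0` of the branch `f` of the logarithm of
the polynomial `p`. They satisfy Newton's identities, and the error of the Taylor sums at `1`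
decreases geometrically. -/
structure IsLogExpansion (p : ℂ[X]) (M : ℕ) (f : ℂ → ℂ) (F : ℕ → ℂ) : Prop where
  branch : IsLogBranch (fun z => p.eval z) f
  coeff : ∀ j, 1 ≤ j → F j = iteratedDeriv j f 0 / (j.factorial : ℂ)
  newton : ∀ j : ℕ, 1 ≤ j → (j : ℂ) * p.coeff j = ∑ i ∈ Icc 1 j, (i : ℂ) * F i * p.coeff (j - i)
  error : ∀ n, ‖f 1 - (f 0 + ∑ j ∈ Icc 1 n, F j)‖ ≤ 200 * M * (200 / 201) ^ n
  norm_sum_le : ∀ n, ‖∑ j ∈ Icc 1 n, F j‖ ≤ 200 * M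

/-- The numbers `a` in `p = p(0) ∏ (1 - a z)` are the inverses of the zeros, hence of norm at most
`1 / 1.005 = 200 / 201`. -/
theorem exists_isLogExpansion (p : ℂ[X]) {M : ℕ} (hM : p.natDegree ≤ M) {c : ℝ} (hc : 0 < c)
    (hpc : p.coeff 0 = c) (hp : ∀ z : ℂ, ‖z‖ ≤ 1.005 → p.eval z ≠ 0) :
    ∃ f F, IsLogExpansion p M f F := by
  have hc' : (c : ℂ) ≠ 0 := by exact_mod_cast hc.ne'
  have hfac := eq_C_coeff_zero_mul_prod_one_sub p (by rw [hpc]; exact hc')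
  obtain ⟨s, hs⟩ : ∃ s, s = p.roots.map fun r => r⁻¹ := ⟨_, rfl⟩
  have hcard : s.card ≤ M := by
    rw [hs, Multiset.card_map]; exact (card_roots' p).trans hM
  have hle : ∀ a ∈ s, ‖a‖ ≤ 200 / 201 := by
    intro a ha
    rw [hs, Multiset.mem_map] at ha
    obtain ⟨r, hr, rfl⟩ := ha
    have h1 : 1.005 < ‖r‖ := by
      by_contra h
      exact hp r (not_lt.1 h) (isRoot_of_mem_roots hr)
    rw [norm_inv, inv_le_comm₀ (by linarith) (by norm_num)]
    linarith
  have hlt : ∀ a ∈ s, ‖a‖ < 1 := fun a ha => (hle a ha).trans_lt (by norm_num)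
  have hfac2 : p = C (c : ℂ) * (s.map fun a => 1 - C a * X).prod := by
    rw [hpc] at hfac
    rw [hs, Multiset.map_map]; exact hfac
  have h0 : logProd s 0 = 0 := by simp [logProd]
  have hcM : (s.card : ℝ) ≤ M := by exact_mod_cast hcard
  refine ⟨fun z => Complex.log c + logProd s z, fun j => -(s.map fun a => a ^ j).sum / j,
    ⟨?_, ?_, ?_⟩, ?_, ?_, ?_, ?_⟩
  · intro z hz
    exact analyticAt_const.add (analyticAt_logProd hlt (by simpa using hz))
  · intro z hz
    rw [Complex.exp_add, Complex.exp_log hc', exp_logProd hlt (by simpa using hz)]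
    conv_rhs => rw [hfac2]
    rw [eval_mul, eval_C, eval_prod_one_sub]
  · simp only [h0, add_zero]
    rw [← Complex.ofReal_log hc.le, Complex.ofReal_im]
  · intro j hj
    obtain ⟨j, rfl⟩ := Nat.exists_eq_add_of_le' hj
    rw [show (fun z => Complex.log c + logProd s z) = (fun _ => Complex.log c) + logProd s from rfl,
      iteratedDeriv_add contDiffAt_const (analyticAt_logProd hlt (by simp)).contDiffAt,
      iteratedDeriv_logProd hlt, iteratedDeriv_const, if_neg (Nat.succ_ne_zero j), zero_add,
      Nat.factorial_succ]
    have h1 : (j.factorial : ℂ) ≠ 0 := by exact_mod_cast j.factorial_ne_zero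
    have h2 : ((j + 1 : ℕ) : ℂ) ≠ 0 := by exact_mod_cast Nat.succ_ne_zero j
    push_cast at h2 ⊢
    field_simp
  · intro j hj
    obtain ⟨j, rfl⟩ := Nat.exists_eq_add_of_le' hj
    have h := newton_prod_one_sub s j
    rw [hfac2]
    simp only [coeff_C_mul]
    rw [mul_left_comm, h, mul_sum]
    exact sum_congr rfl fun i _ => by ring
  · intro n
    rw [h0, add_zero, add_sub_add_left_eq_sub]
    refine (norm_logProd_sub_sum_le (by norm_num) hle n).trans ?_
    have : (200 / 201 : ℝ) ^ (n + 1) * (1 - 200 / 201)⁻¹ = 200 * (200 / 201) ^ n := by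
      rw [pow_succ]; norm_num; ring
    rw [this]
    have h3 : (0 : ℝ) ≤ 200 * (200 / 201) ^ n := by positivity
    nlinarith
  · intro n
    have h4 := sum_Icc_pow_le (q := 200 / 201) (by norm_num) (by norm_num) n
    calc _ ≤ ∑ j ∈ Icc 1 n, (M : ℝ) * (200 / 201) ^ j := by
          refine norm_sum_le_of_le _ fun j hj => ?_
          rw [norm_div, norm_neg, Complex.norm_natCast]
          have hj1 : (1 : ℝ) ≤ j := by exact_mod_cast (mem_Icc.1 hj).1
          refine (div_le_self (norm_nonneg _) hj1).trans ((norm_sum_pow_le hle j).trans ?_)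
          gcongr
      _ ≤ 200 * M := by
          rw [← mul_sum]
          norm_num at h4
          nlinarith [(Nat.cast_nonneg M : (0 : ℝ) ≤ M)]

end LogPolynomial

/-! ### Counting maps with multiplicities -/

section Counting

variable {N k : ℕ} {μ : Fin k → ℕ}

theorem mapsWithMult_nonempty (h : ∑ i, μ i = N) :
    (mapsWithMult μ : Finset (Fin N → Fin k)).Nonempty := by
  subst h
  refine ⟨fun v => (finSigmaFinEquiv.symm v).1, mem_mapsWithMult.2 fun i => ?_⟩
  refine Eq.trans (Eq.symm ?_) (Fintype.card_fin (μ i))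
  refine card_bij (fun j _ => finSigmaFinEquiv ⟨i, j⟩) ?_ ?_ ?_
  · intro j _
    rw [mem_filter, Equiv.symm_apply_apply]
    exact ⟨mem_univ _, rfl⟩
  · intro a _ b _ hab
    have h := finSigmaFinEquiv.injective hab
    rw [Sigma.mk.injEq] at h
    exact eq_of_heq h.2
  · intro v hv
    obtain ⟨_, rfl⟩ := mem_filter.1 hv
    exact ⟨(finSigmaFinEquiv.symm v).2, mem_univ _, by
      rw [Sigma.eta, Equiv.apply_symm_apply]⟩

/-- The number of maps is a multinomial coefficient: the permutations act transitively on the maps,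
and the stabilizer of a map permutes each of its fibers. -/
theorem card_mapsWithMult_mul (h : ∑ i, μ i = N) :
    (mapsWithMult μ : Finset (Fin N → Fin k)).card * ∏ i, (μ i).factorial = N.factorial := by
  obtain ⟨ψ, hψ⟩ := mapsWithMult_nonempty h
  rw [mem_mapsWithMult] at hψ
  have hmaps : ∀ g ∈ (univ : Finset (Equiv.Perm (Fin N))), ψ ∘ g ∈ mapsWithMult μ := by
    intro g _
    rw [mem_mapsWithMult]
    intro i
    rw [← hψ i]
    exact card_bij (fun u _ => g u) (fun u hu => by simpa using hu)
      (fun a _ b _ hab => g.injective hab) fun b hb => ⟨g.symm b, by simpa using hb, by simp⟩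
  have hcard := card_eq_sum_card_fiberwise hmaps
  rw [card_univ, Fintype.card_perm, Fintype.card_fin] at hcard
  rw [hcard]
  refine (sum_const_nat fun φ hφ => ?_).symm
  rw [mem_mapsWithMult] at hφ
  have e : ∀ i, Nonempty ({v // φ v = i} ≃ {v // ψ v = i}) := fun i => by
    refine ⟨Fintype.equivOfCardEq ?_⟩
    rw [Fintype.card_subtype, Fintype.card_subtype, hφ, hψ]
  set g₀ : Equiv.Perm (Fin N) := Equiv.ofFiberEquiv fun i => (e i).some
  have hg₀ : ψ ∘ g₀ = φ := by
    funext v; exact Equiv.ofFiberEquiv_map (fun i => (e i).some) v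
  have hst := DomMulAct.stabilizer_card ψ
  have h2 : ∀ i, Fintype.card {a // ψ a = i} = μ i := fun i => by
    rw [Fintype.card_subtype, hψ]
  simp only [h2] at hst
  rw [← hst, Fintype.card_subtype]
  refine card_bij (fun g _ => g₀⁻¹.trans g) ?_ ?_ ?_
  · intro g hg
    simp only [mem_filter, mem_univ, true_and] at hg ⊢
    ext v
    have := congrFun hg (g₀⁻¹ v)
    rw [Function.comp_apply] at this
    rw [Function.comp_apply, Equiv.trans_apply, this, ← hg₀]
    simp
  · intro a _ b _ hab
    ext v
    have := congrArg (fun f : Equiv.Perm (Fin N) => f (g₀ v)) hab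
    simpa using congrArg Fin.val this
  · intro g hg
    simp only [mem_filter, mem_univ, true_and] at hg
    refine ⟨g₀.trans g, ?_, by ext v; simp⟩
    simp only [mem_filter, mem_univ, true_and]
    rw [← hg₀]
    ext v
    have := congrFun hg (g₀ v)
    rw [Function.comp_apply] at this
    simp [this]

theorem card_mapsExtending_insert_eq {D : Finset (Fin N)} {v w : Fin N} (hv : v ∉ D) (hw : w ∉ D)
    (ψ : Fin N → Fin k) (i : Fin k) :
    (mapsExtending μ (insert w D) (Function.update ψ w i)).card =
      (mapsExtending μ (insert v D) (Function.update ψ v i)).card := by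
  have key : ∀ v w : Fin N, v ∉ D → w ∉ D → ∀ φ,
      φ ∈ mapsExtending μ (insert w D) (Function.update ψ w i) →
      φ ∘ Equiv.swap v w ∈ mapsExtending μ (insert v D) (Function.update ψ v i) := by
    intro v w hv hw φ hφ
    rw [mem_mapsExtending_insert hw, mem_mapsExtending] at hφ
    rw [mem_mapsExtending_insert hv, mem_mapsExtending]
    refine ⟨⟨comp_swap_mem_mapsWithMult hφ.1.1 v w, fun u hu => ?_⟩, by simp [hφ.2]⟩
    rw [Function.comp_apply, Equiv.swap_apply_of_ne_of_ne (ne_of_mem_of_not_mem hu hv)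
      (ne_of_mem_of_not_mem hu hw), hφ.1.2 u hu]
  refine card_nbij' (fun φ => φ ∘ Equiv.swap v w) (fun φ => φ ∘ Equiv.swap v w)
    (fun φ hφ => key v w hv hw φ hφ) (fun φ hφ => ?_) (fun φ _ => by ext u; simp)
    fun φ _ => by ext u; simp
  have := key w v hw hv φ hφ
  rwa [Equiv.swap_comm] at this

/-- Under the uniform distribution on the maps extending a partial map, a free vertex has color `i`
with probability the fraction of the free multiplicity of `i` among the free vertices. -/
theorem card_free_mul_card_mapsExtending {D : Finset (Fin N)} {v : Fin N} (hv : v ∉ D)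
    (ψ : Fin N → Fin k) (i : Fin k) :
    (N - D.card) * (mapsExtending μ (insert v D) (Function.update ψ v i)).card =
      (μ i - (D.filter fun u => ψ u = i).card) * (mapsExtending μ D ψ).card := by
  have h := mul_restrictedSum_eq_sum_vertices (μ := μ) (E := ∅) (W := fun _ _ => 1) D ψ i
  simp only [restrictedSum, prod_empty, sum_const, nsmul_eq_mul, mul_one] at h
  have h2 : ∀ w ∈ Dᶜ, (((mapsExtending μ (insert w D) (Function.update ψ w i)).card : ℕ) : ℂ) =
      ((mapsExtending μ (insert v D) (Function.update ψ v i)).card : ℕ) := fun w hw => by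
    rw [card_mapsExtending_insert_eq hv (mem_compl.1 hw)]
  rw [sum_congr rfl h2, sum_const, nsmul_eq_mul, card_compl, Fintype.card_fin] at h
  exact_mod_cast h.symm

end Counting

/-! ### Partial assignments with running probabilities -/

/-- A partial coloring as it is kept by the algorithm: `col v` is `0` if the vertex `v` is free and
`a + 1` if it has color `a`, `rem a` is the number of vertices that may still get color `a`, `free`
is the number of free vertices, and `wt` is a running product. -/
structure Partial where
  col : ℕ → ℕ
  rem : ℕ → ℕ
  free : ℕ
  wt : ℂ

/-- Require vertex `v` to have color `a`: multiply by the conditional probability of this. -/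
noncomputable def Partial.assign (s : Partial) (v a : ℕ) : Partial :=
  if s.col v = 0 then
    { col := Function.update s.col v (a + 1)
      rem := Function.update s.rem a (s.rem a - 1)
      free := s.free - 1
      wt := s.wt * s.rem a / s.free }
  else if s.col v = a + 1 then s else { s with wt := 0 }

section Represents

variable {N k : ℕ} {μ : Fin k → ℕ}

/-- The running product of `s`, times the number of all maps, is the sum of `F` over all maps; and
`F` is a constant `ω` times the indicator of the maps that extend the partial coloring `ψ` on `D` kept
in `s`. Only the vertices in `U` are tracked by `s.col`. No map need extend the partial coloring;
in this case the running product is zero, and the truncated subtraction in `s.rem` is harmless. -/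
def Partial.Represents (s : Partial) (μ : Fin k → ℕ) (U : Finset (Fin N))
    (F : (Fin N → Fin k) → ℂ) : Prop :=
  ∃ (D : Finset (Fin N)) (ψ : Fin N → Fin k) (ω : ℂ),
    (∀ v ∈ U, s.col v = if v ∈ D then (ψ v : ℕ) + 1 else 0) ∧
    (∀ a : Fin k, s.rem a = μ a - (D.filter fun u => ψ u = a).card) ∧
    s.free = N - D.card ∧
    s.wt * (mapsWithMult μ : Finset (Fin N → Fin k)).card = ω * (mapsExtending μ D ψ).card ∧
    ∀ φ, F φ = ω * if ∀ v ∈ D, φ v = ψ v then 1 else 0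

theorem Partial.Represents.sum_eq {s : Partial} {U : Finset (Fin N)} {F : (Fin N → Fin k) → ℂ}
    (h : s.Represents μ U F) :
    s.wt * (mapsWithMult μ : Finset (Fin N → Fin k)).card = ∑ φ ∈ mapsWithMult μ, F φ := by
  obtain ⟨D, ψ, ω, -, -, -, h4, h5⟩ := h
  simp only [h4, h5, ← mul_sum, sum_boole, mapsExtending]

theorem Partial.Represents.mul {s : Partial} {U : Finset (Fin N)} {F : (Fin N → Fin k) → ℂ}
    (h : s.Represents μ U F) (x : ℂ) :
    ({ s with wt := s.wt * x } : Partial).Represents μ U (fun φ => F φ * x) := by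
  obtain ⟨D, ψ, ω, h1, h2, h3, h4, h5⟩ := h
  refine ⟨D, ψ, ω * x, h1, h2, h3, ?_, fun φ => ?_⟩
  · show s.wt * x * _ = _
    linear_combination x * h4
  · show F φ * x = _
    rw [h5]; ring

theorem Partial.represents_init {s : Partial} [hk : Nonempty (Fin N → Fin k)] {U : Finset (Fin N)}
    (hc : ∀ v ∈ U, s.col v = 0) (hr : ∀ a : Fin k, s.rem a = μ a) (hf : s.free = N)
    (hw : s.wt = 1) : s.Represents μ U (fun _ => 1) := by
  refine ⟨∅, hk.some, 1, ?_, ?_, ?_, ?_, ?_⟩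
  · intro v hv; simp [hc v hv]
  · intro a; simp [hr a]
  · simp [hf]
  · simp [hw, mapsExtending]
  · simp

/-- If `v` is already in `D`, the condition on the color of `v` is void or contradictory; otherwise
its conditional probability is given by `card_free_mul_card_mapsExtending`. -/
theorem Partial.Represents.assign {s : Partial} {U : Finset (Fin N)} {F : (Fin N → Fin k) → ℂ}
    (h : s.Represents μ U F) {v : Fin N} (hv : v ∈ U) (a : Fin k) :
    (s.assign v a).Represents μ U (fun φ => F φ * if φ v = a then 1 else 0) := by
  obtain ⟨D, ψ, ω, h1, h2, h3, h4, h5⟩ := h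
  unfold Partial.assign
  by_cases hD : v ∈ D
  · have hcol : s.col v = (ψ v : ℕ) + 1 := by rw [h1 v hv, if_pos hD]
    rw [if_neg (by omega)]
    by_cases hψ : ψ v = a
    · rw [if_pos (by rw [hcol, hψ])]
      refine ⟨D, ψ, ω, h1, h2, h3, h4, fun φ => ?_⟩
      show F φ * _ = _
      rw [h5]
      by_cases hφ : ∀ v ∈ D, φ v = ψ v
      · simp [hφ v hD, hψ]
      · simp [hφ]
    · rw [if_neg (by rw [hcol]; intro h; exact hψ (Fin.ext (by omega)))]
      refine ⟨D, ψ, 0, h1, h2, h3, by simp, fun φ => ?_⟩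
      show F φ * _ = _
      rw [h5, zero_mul]
      by_cases hφ : ∀ v ∈ D, φ v = ψ v
      · simp [hφ v hD, hψ]
      · simp [hφ]
  · rw [if_pos (by rw [h1 v hv, if_neg hD])]
    have hne : ∀ u ∈ D, u ≠ v := fun u hu => ne_of_mem_of_not_mem hu hD
    refine ⟨insert v D, Function.update ψ v a, ω, ?_, ?_, ?_, ?_, ?_⟩
    · intro u hu
      by_cases huv : u = v
      · subst huv; simp
      · have : (u : ℕ) ≠ v := fun h => huv (Fin.ext h)
        simp [this, huv, h1 u hu]
    · intro b
      have hcnt : ((insert v D).filter fun u => Function.update ψ v a u = b) =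
          if a = b then insert v (D.filter fun u => ψ u = b) else D.filter fun u => ψ u = b := by
        rw [filter_insert, Function.update_self]
        have : (D.filter fun u => Function.update ψ v a u = b) = D.filter fun u => ψ u = b :=
          filter_congr fun u hu => by rw [Function.update_of_ne (hne u hu)]
        rw [this]
      rw [hcnt]
      by_cases hab : a = b
      · subst hab
        rw [if_pos rfl, card_insert_of_notMem (by simp [hD])]
        simp [h2]; omega
      · have : (b : ℕ) ≠ a := fun h => hab (Fin.ext h.symm)
        simp [this, hab, h2]
    · show s.free - 1 = _
      rw [card_insert_of_notMem hD, h3]; omega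
    · show s.wt * s.rem a / s.free * _ = _
      -- The free vertex `v` shows that the denominator is not zero.
      have hlt : D.card < N := by
        have := card_lt_card (ssubset_univ_iff.2 fun h : D = univ => hD (h ▸ mem_univ v))
        simpa using this
      have hf : (s.free : ℂ) ≠ 0 := by
        rw [h3]; exact_mod_cast (by omega : N - D.card ≠ 0)
      have hc := card_free_mul_card_mapsExtending (μ := μ) hD ψ a
      rw [← h3, ← h2] at hc
      have hc' : (s.free : ℂ) * (mapsExtending μ (insert v D) (Function.update ψ v a)).card =
          s.rem a * (mapsExtending μ D ψ).card := by exact_mod_cast hc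
      field_simp
      linear_combination (s.rem a : ℂ) * h4 - ω * hc'
    · intro φ
      show F φ * _ = _
      rw [h5, mul_assoc]
      congr 1
      have : (∀ u ∈ insert v D, φ u = Function.update ψ v a u) ↔
          (∀ u ∈ D, φ u = ψ u) ∧ φ v = a := by
        rw [forall_mem_insert, Function.update_self, and_comm]
        refine and_congr_left fun _ => forall₂_congr fun u hu => ?_
        rw [Function.update_of_ne (hne u hu)]
      by_cases h1 : φ v = a <;> by_cases h2 : ∀ u ∈ D, φ u = ψ u <;>
        simp only [this, h1, h2, if_true, if_false, and_true, and_false, mul_one,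
          mul_zero]

end Represents

/-! ### Coefficients of products as sums over increasing words -/

section Words

open Polynomial

/-- The first `j` digits of `c` in base `K`, low digits first, are read as a word. The product of
`h` over its letters if the word increases and starts at `lo` or above, and `0` otherwise. -/
noncomputable def wordProd (K : ℕ) (h : ℕ → ℂ) : ℕ → ℕ → ℕ → ℂ
  | 0, _, _ => 1
  | j + 1, lo, c =>
    (if lo ≤ c % K then h (c % K) else 0) * wordProd K h j (c % K + 1) (c / K)

theorem sum_range_mul_add {A : Type*} [AddCommMonoid A] (f : ℕ → A) (m K : ℕ) :
    ∑ c ∈ range (m * K), f c = ∑ y ∈ range m, ∑ x ∈ range K, f (y * K + x) := by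
  induction m with
  | zero => simp
  | succ m ih => rw [Nat.succ_mul, sum_range_add, ih, sum_range_succ]

theorem prod_range_mul_add {A : Type*} [CommMonoid A] (f : ℕ → A) (m K : ℕ) :
    ∏ c ∈ range (m * K), f c = ∏ y ∈ range m, ∏ x ∈ range K, f (y * K + x) := by
  induction m with
  | zero => simp
  | succ m ih => rw [Nat.succ_mul, prod_range_add, ih, prod_range_succ]

/-- Split the coefficient according to the smallest index that is used. -/
theorem coeff_prod_Ico (h : ℕ → ℂ) (K j lo : ℕ) :
    (∏ x ∈ Ico lo K, (1 + X * C (h x))).coeff (j + 1) =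
      ∑ x ∈ Ico lo K, h x * (∏ y ∈ Ico (x + 1) K, (1 + X * C (h y))).coeff j := by
  by_cases hlo : lo ≤ K
  · induction hlo using Nat.decreasingInduction with
    | self => simp [coeff_one]
    | of_succ lo hlo ih =>
      rw [prod_eq_prod_Ico_succ_bot hlo, sum_eq_sum_Ico_succ_bot hlo, ← ih, add_mul, one_mul,
        coeff_add, mul_assoc, coeff_X_mul, coeff_C_mul, add_comm]
  · rw [Ico_eq_empty (by omega)]; simp [coeff_one]

/-- An elementary symmetric function is a sum over increasing words. -/
theorem sum_wordProd (h : ℕ → ℂ) (K j : ℕ) : ∀ lo,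
    ∑ c ∈ range (K ^ j), wordProd K h j lo c =
      (∏ x ∈ Ico lo K, (1 + X * C (h x))).coeff j := by
  induction j with
  | zero =>
    intro lo
    rw [coeff_zero_eq_eval_zero, eval_prod]
    simp [wordProd]
  | succ j ih =>
    intro lo
    rw [coeff_prod_Ico, pow_succ, sum_range_mul_add, sum_comm]
    have e : ∀ x ∈ range K, ∑ y ∈ range (K ^ j), wordProd K h (j + 1) lo (y * K + x) =
        if lo ≤ x then h x * (∏ y ∈ Ico (x + 1) K, (1 + X * C (h y))).coeff j else 0 := by
      intro x hx
      have hx' := mem_range.1 hx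
      have h1 : ∀ y, (y * K + x) % K = x := fun y => by
        rw [Nat.mul_add_mod', Nat.mod_eq_of_lt hx']
      have h2 : ∀ y, (y * K + x) / K = y := fun y => by
        rw [mul_comm, Nat.mul_add_div (by omega), Nat.div_eq_of_lt hx', add_zero]
      simp only [wordProd, h1, h2, ← mul_sum, ih]
      split_ifs <;> simp
    rw [sum_congr rfl e, ← sum_filter]
    congr 1
    ext x; simp [and_comm]

end Words

/-! ### Reasoning about programs -/

/-- Started in `σ`, the program `c` halts after at most `t` steps in a memory satisfying `P`. -/
def Runs (c : Cmd) (σ : Store) (t : ℕ) (P : Store → Prop) : Prop :=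
  ∃ s τ, Exec c σ s τ ∧ s ≤ t ∧ P τ

/-- The commands of a list, one after the other. -/
def block : List Cmd → Cmd
  | [] => Cmd.skip
  | c :: l => Cmd.seq c (block l)

/-- Whether `c` contains an assignment to the `a`-th integer array. -/
def Cmd.writesInt : Cmd → ℕ → Bool
  | skip, _ => false
  | setInt b _ _, a => a == b
  | setNum _ _ _, _ => false
  | seq c d, a => c.writesInt a || d.writesInt a
  | ite _ c d, a => c.writesInt a || d.writesInt a
  | loop _ c, a => c.writesInt a

/-- Whether `c` contains an assignment to the `a`-th number array. -/
def Cmd.writesNum : Cmd → ℕ → Bool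
  | skip, _ => false
  | setInt _ _ _, _ => false
  | setNum b _ _, a => a == b
  | seq c d, a => c.writesNum a || d.writesNum a
  | ite _ c d, a => c.writesNum a || d.writesNum a
  | loop _ c, a => c.writesNum a

/-- `σ` and `τ` agree on all arrays to which `c` does not write. -/
structure Frame (c : Cmd) (σ τ : Store) : Prop where
  int : ∀ a, c.writesInt a = false → τ.int a = σ.int a
  num : ∀ a, c.writesNum a = false → τ.num a = σ.num a

theorem Frame.refl (c : Cmd) (σ : Store) : Frame c σ σ := ⟨fun _ _ => rfl, fun _ _ => rfl⟩

theorem Exec.frame {c : Cmd} {σ τ : Store} {t : ℕ} (h : Exec c σ t τ) : Frame c σ τ := by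
  induction h with
  | skip => exact Frame.refl _ _
  | setInt b i x σ =>
    refine ⟨fun a ha => ?_, fun a _ => rfl⟩
    have : a ≠ b := by simpa [Cmd.writesInt] using ha
    funext j; simp [Store.setInt, this]
  | setNum b i x σ =>
    refine ⟨fun a _ => rfl, fun a ha => ?_⟩
    have : a ≠ b := by simpa [Cmd.writesNum] using ha
    funext j; simp [Store.setNum, this]
  | seq _ _ ih₁ ih₂ =>
    constructor
    · intro a ha
      simp only [Cmd.writesInt, Bool.or_eq_false_iff] at ha
      rw [ih₂.int a ha.2, ih₁.int a ha.1]
    · intro a ha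
      simp only [Cmd.writesNum, Bool.or_eq_false_iff] at ha
      rw [ih₂.num a ha.2, ih₁.num a ha.1]
  | ite_true _ _ ih =>
    constructor
    · intro a ha
      simp only [Cmd.writesInt, Bool.or_eq_false_iff] at ha
      exact ih.int a ha.1
    · intro a ha
      simp only [Cmd.writesNum, Bool.or_eq_false_iff] at ha
      exact ih.num a ha.1
  | ite_false _ _ ih =>
    constructor
    · intro a ha
      simp only [Cmd.writesInt, Bool.or_eq_false_iff] at ha
      exact ih.int a ha.2
    · intro a ha
      simp only [Cmd.writesNum, Bool.or_eq_false_iff] at ha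
      exact ih.num a ha.2
  | loop_false => exact Frame.refl _ _
  | loop_true _ _ _ ih₁ ih₂ =>
    exact ⟨fun a ha => (ih₂.int a ha).trans (ih₁.int a ha),
      fun a ha => (ih₂.num a ha).trans (ih₁.num a ha)⟩

section Rules

variable {c d : Cmd} {σ : Store} {s t : ℕ} {P Q : Store → Prop}

theorem Runs.mono (h : Runs c σ s P) (hst : s ≤ t) (hPQ : ∀ τ, P τ → Q τ) : Runs c σ t Q := by
  obtain ⟨r, τ, h1, h2, h3⟩ := h
  exact ⟨r, τ, h1, h2.trans hst, hPQ τ h3⟩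

/-- The rule for sequencing. The facts about arrays to which the first command does not write are
supplied by the frame. -/
theorem Runs.cons {l : List Cmd} (h : Runs c σ s P)
    (hl : ∀ τ, P τ → Frame c σ τ → Runs (block l) τ t Q) : Runs (block (c :: l)) σ (s + t) Q := by
  obtain ⟨r, τ, h1, h2, h3⟩ := h
  obtain ⟨r', τ', h1', h2', h3'⟩ := hl τ h3 h1.frame
  exact ⟨r + r', τ', Exec.seq h1 h1', Nat.add_le_add h2 h2', h3'⟩

theorem Runs.nil (h : P σ) : Runs (block []) σ 1 P := ⟨1, σ, Exec.skip σ, le_rfl, h⟩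

theorem Runs.skip (h : P σ) : Runs Cmd.skip σ 1 P := ⟨1, σ, Exec.skip σ, le_rfl, h⟩

theorem Runs.consInt {l : List Cmd} {a : ℕ} {i x : IExp}
    (h : Runs (block l) (σ.setInt a (i.eval σ) (x.eval σ)) t P) :
    Runs (block (Cmd.setInt a i x :: l)) σ (i.time + x.time + 1 + t) P := by
  obtain ⟨r, τ, h1, h2, h3⟩ := h
  exact ⟨_, τ, Exec.seq (Exec.setInt a i x σ) h1, Nat.add_le_add_left h2 _, h3⟩

theorem Runs.consNum {l : List Cmd} {a : ℕ} {i : IExp} {x : CExp}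
    (h : Runs (block l) (σ.setNum a (i.eval σ) (x.eval σ)) t P) :
    Runs (block (Cmd.setNum a i x :: l)) σ (i.time + x.time + 1 + t) P := by
  obtain ⟨r, τ, h1, h2, h3⟩ := h
  exact ⟨_, τ, Exec.seq (Exec.setNum a i x σ) h1, Nat.add_le_add_left h2 _, h3⟩

theorem Runs.ite {b : BExp} (h1 : b.Holds σ → Runs c σ t P) (h2 : ¬ b.Holds σ → Runs d σ t P) :
    Runs (Cmd.ite b c d) σ (b.time + t + 1) P := by
  by_cases hb : b.Holds σ
  · obtain ⟨r, τ, h1, h2, h3⟩ := h1 hb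
    exact ⟨_, τ, Exec.ite_true hb h1, by omega, h3⟩
  · obtain ⟨r, τ, h1, h2, h3⟩ := h2 hb
    exact ⟨_, τ, Exec.ite_false hb h1, by omega, h3⟩

/-- The rule for a loop that is run through `n` times, with the invariant `I m` after `m` rounds. -/
theorem Runs.loop {b : BExp} (n : ℕ) (T : ℕ → ℕ) (I : ℕ → Store → Prop) (h0 : I 0 σ)
    (hc : ∀ m < n, ∀ τ, Frame c σ τ → I m τ → b.Holds τ ∧ Runs c τ (T m) (I (m + 1)))
    (hn : ∀ τ, Frame c σ τ → I n τ → ¬ b.Holds τ) :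
    Runs (Cmd.loop b c) σ (∑ m ∈ range n, (T m + b.time + 1) + b.time + 1)
      (fun τ => I n τ ∧ Frame c σ τ) := by
  suffices H : ∀ r m, m + r = n → ∀ τ, Frame c σ τ → I m τ →
      Runs (Cmd.loop b c) τ (∑ i ∈ Ico m n, (T i + b.time + 1) + b.time + 1)
        (fun τ => I n τ ∧ Frame c σ τ) by
    rw [range_eq_Ico]; exact H n 0 (zero_add n) σ (Frame.refl c σ) h0
  intro r
  induction r with
  | zero =>
    intro m hm τ hF hI
    obtain rfl : m = n := by simpa using hm
    exact ⟨_, τ, Exec.loop_false (hn τ hF hI), by omega, hI, hF⟩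
  | succ r ih =>
    intro m hm τ hF hI
    obtain ⟨hb, s, τ', h1, h2, h3⟩ := hc m (by omega) τ hF hI
    have hF' : Frame c σ τ' :=
      ⟨fun a ha => (h1.frame.int a ha).trans (hF.int a ha),
        fun a ha => (h1.frame.num a ha).trans (hF.num a ha)⟩
    obtain ⟨s', τ'', h1', h2', h3'⟩ := ih (m + 1) (by omega) τ' hF' h3
    refine ⟨_, τ'', Exec.loop_true hb h1 h1', ?_, h3'⟩
    rw [sum_eq_sum_Ico_succ_bot (by omega : m < n)]
    omega

/-- The rule for a loop whose rounds take bounded time. -/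
theorem Runs.loop_const {b : BExp} (n T : ℕ) (I : ℕ → Store → Prop) (h0 : I 0 σ)
    (hc : ∀ m < n, ∀ τ, Frame c σ τ → I m τ → b.Holds τ ∧ Runs c τ T (I (m + 1)))
    (hn : ∀ τ, Frame c σ τ → I n τ → ¬ b.Holds τ) :
    Runs (Cmd.loop b c) σ (n * (T + b.time + 1) + b.time + 1)
      (fun τ => I n τ ∧ Frame c σ τ) := by
  have h := Runs.loop n (fun _ => T) I h0 hc hn
  simpa using h

end Rules

@[simp] theorem Store.setInt_num (σ : Store) (a i x : ℕ) : (σ.setInt a i x).num = σ.num := rfl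

@[simp] theorem Store.setNum_int (σ : Store) (a i : ℕ) (x : ℂ) : (σ.setNum a i x).int = σ.int := rfl

@[simp] theorem Store.setInt_int (σ : Store) (a i x b j : ℕ) :
    (σ.setInt a i x).int b j = if b = a ∧ j = i then x else σ.int b j := rfl

@[simp] theorem Store.setNum_num (σ : Store) (a i : ℕ) (x : ℂ) (b j : ℕ) :
    (σ.setNum a i x).num b j = if b = a ∧ j = i then x else σ.num b j := rfl

attribute [simp] IExp.eval CExp.eval BExp.Holds IExp.time CExp.time BExp.time

/-! ### The program -/

/-- The integer variable kept in cell `0` of array `a`. -/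
abbrev ivar (a : ℕ) : IExp := IExp.get a (IExp.lit 0)

/-- The complex variable kept in cell `0` of array `a`. -/
abbrev cvar (a : ℕ) : CExp := CExp.get a (IExp.lit 0)

/-- Assignment to an integer variable. -/
abbrev setI (a : ℕ) (x : IExp) : Cmd := Cmd.setInt a (IExp.lit 0) x

/-- Assignment to a complex variable. -/
abbrev setC (a : ℕ) (x : CExp) : Cmd := Cmd.setNum a (IExp.lit 0) x

/-- The strict comparison `x < y` of natural numbers. -/
abbrev ltB (x y : IExp) : BExp := BExp.not (BExp.le y x)

/-- The number of colors. -/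
abbrev colorsE : IExp := IExp.get 0 (IExp.lit 1)

/-- The number of edges. -/
abbrev edgesE : IExp := IExp.get 0 (IExp.lit 2)

-- Names of arrays. A name ending in `V` stands for an array of which only cell `0` is used, as a
-- variable. Integer arrays 0 to 4 hold the input and the degree, which is part of the output.
notation "multA" => (1 : ℕ)
notation "fstA" => (2 : ℕ)
notation "sndA" => (3 : ℕ)
notation "degV" => (4 : ℕ)
notation "entryV" => (5 : ℕ)
notation "edgeV" => (6 : ℕ)
notation "rowV" => (7 : ℕ)
notation "colV" => (8 : ℕ)
notation "posV" => (9 : ℕ)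
notation "headA" => (10 : ℕ)
notation "tailA" => (11 : ℕ)
notation "headColorA" => (12 : ℕ)
notation "tailColorA" => (13 : ℕ)
notation "levelV" => (14 : ℕ)
notation "wordV" => (15 : ℕ)
notation "restV" => (16 : ℕ)
notation "quotV" => (17 : ℕ)
notation "stepV" => (18 : ℕ)
notation "lowV" => (19 : ℕ)
notation "freeV" => (20 : ℕ)
notation "remA" => (21 : ℕ)
notation "colorA" => (22 : ℕ)
notation "idxV" => (23 : ℕ)
notation "countV" => (24 : ℕ)
notation "roundsV" => (25 : ℕ)
-- Number arrays 0 to 3 hold the accuracy, the matrices and the output.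
notation "tolV" => (4 : ℕ)
notation "entryA" => (5 : ℕ)
notation "errV" => (6 : ℕ)
notation "powV" => (7 : ℕ)
notation "wtV" => (8 : ℕ)
notation "coeffA" => (9 : ℕ)
notation "logA" => (10 : ℕ)
notation "convV" => (11 : ℕ)
notation "sumV" => (12 : ℕ)
notation "totalV" => (13 : ℕ)
notation "needV" => (14 : ℕ)
notation "factorV" => (15 : ℕ)

/-- Choose the degree of the Taylor sum: the first `n` with `800 M (200 / 201) ^ n ≤ min ε 1`, where
`M` is the number of edges. The value `min ε 1` is kept in `tolV`. -/
def degreeCmd : Cmd := block [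
  setC tolV (cvar 0),
  Cmd.ite (BExp.reLe (CExp.cast (IExp.lit 1)) (cvar tolV)) (setC tolV (CExp.cast (IExp.lit 1)))
    Cmd.skip,
  setC errV (CExp.mul (CExp.cast (IExp.lit 800)) (CExp.cast edgesE)),
  setI degV (IExp.lit 0),
  Cmd.loop (BExp.not (BExp.reLe (cvar errV) (cvar tolV))) (block [
    setC errV (CExp.div (CExp.mul (cvar errV) (CExp.cast (IExp.lit 200)))
      (CExp.cast (IExp.lit 201))),
    setI degV (IExp.add (ivar degV) (IExp.lit 1))])]

/-- Tabulate, for every triple of an edge and two colors, the ends of the edge, the colors, and the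
matrix entry minus one. The expression `src` gives the entry; it may use the index `entryV` of the
triple and the index `posV` of the pair of colors. As there is no division of natural numbers, the
edge and the two colors are updated by carrying. -/
def tableCmd (src : CExp) : Cmd := block [
  setI entryV (IExp.lit 0),
  setI edgeV (IExp.lit 0),
  setI rowV (IExp.lit 0),
  setI colV (IExp.lit 0),
  setI posV (IExp.lit 0),
  Cmd.loop (ltB (ivar edgeV) edgesE) (block [
    Cmd.setInt headA (ivar entryV) (IExp.get fstA (ivar edgeV)),
    Cmd.setInt tailA (ivar entryV) (IExp.get sndA (ivar edgeV)),
    Cmd.setInt headColorA (ivar entryV) (ivar rowV),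
    Cmd.setInt tailColorA (ivar entryV) (ivar colV),
    Cmd.setNum entryA (ivar entryV) (CExp.sub src (CExp.cast (IExp.lit 1))),
    setI entryV (IExp.add (ivar entryV) (IExp.lit 1)),
    setI posV (IExp.add (ivar posV) (IExp.lit 1)),
    setI colV (IExp.add (ivar colV) (IExp.lit 1)),
    Cmd.ite (BExp.le colorsE (ivar colV)) (block [
      setI colV (IExp.lit 0),
      setI rowV (IExp.add (ivar rowV) (IExp.lit 1)),
      Cmd.ite (BExp.le colorsE (ivar rowV)) (block [
        setI rowV (IExp.lit 0),
        setI posV (IExp.lit 0),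
        setI edgeV (IExp.add (ivar edgeV) (IExp.lit 1))]) Cmd.skip]) Cmd.skip])]

/-- Forget the partial coloring. Only the ends of edges are visited, which keeps the number of
vertices out of the running time. -/
def resetCmd : Cmd := block [
  setI idxV (IExp.lit 0),
  Cmd.loop (ltB (ivar idxV) edgesE) (block [
    Cmd.setInt colorA (IExp.get fstA (ivar idxV)) (IExp.lit 0),
    Cmd.setInt colorA (IExp.get sndA (ivar idxV)) (IExp.lit 0),
    setI idxV (IExp.add (ivar idxV) (IExp.lit 1))]),
  setI idxV (IExp.lit 0),
  Cmd.loop (ltB (ivar idxV) colorsE) (block [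
    Cmd.setInt remA (ivar idxV) (IExp.get multA (ivar idxV)),
    setI idxV (IExp.add (ivar idxV) (IExp.lit 1))]),
  setI freeV (IExp.get 0 (IExp.lit 0)),
  setC wtV (CExp.cast (IExp.lit 1))]

/-- Require the vertex `v` to have color `a`, as in `Partial.assign`. -/
def assignCmd (v a : IExp) : Cmd :=
  Cmd.ite (BExp.le (IExp.get colorA v) (IExp.lit 0))
    (block [
      setC wtV (CExp.div (CExp.mul (cvar wtV) (CExp.cast (IExp.get remA a)))
        (CExp.cast (ivar freeV))),
      Cmd.setInt remA a (IExp.sub (IExp.get remA a) (IExp.lit 1)),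
      setI freeV (IExp.sub (ivar freeV) (IExp.lit 1)),
      Cmd.setInt colorA v (IExp.add a (IExp.lit 1))])
    (Cmd.ite (BExp.and (BExp.le (IExp.get colorA v) (IExp.add a (IExp.lit 1)))
        (BExp.le (IExp.add a (IExp.lit 1)) (IExp.get colorA v)))
      Cmd.skip
      (setC wtV (CExp.cast (IExp.lit 0))))

/-- Split off the lowest digit of a number in base `entryV`, which at this stage is the number of
entries in the table. -/
def divideCmd : Cmd := block [
  setI quotV (IExp.lit 0),
  Cmd.loop (BExp.le (ivar entryV) (ivar restV)) (block [
    setI restV (IExp.sub (ivar restV) (ivar entryV)),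
    setI quotV (IExp.add (ivar quotV) (IExp.lit 1))])]

/-- Read the next letter of a word and multiply its contribution to the running product; `lowV` is
the least letter that is allowed in an increasing word. -/
def letterCmd : Cmd := block [
  divideCmd,
  setC wtV (CExp.mul (cvar wtV) (CExp.get entryA (ivar restV))),
  Cmd.ite (BExp.le (ivar lowV) (ivar restV)) Cmd.skip (setC wtV (CExp.cast (IExp.lit 0))),
  setI lowV (IExp.add (ivar restV) (IExp.lit 1)),
  assignCmd (IExp.get headA (ivar restV)) (IExp.get headColorA (ivar restV)),
  assignCmd (IExp.get tailA (ivar restV)) (IExp.get tailColorA (ivar restV)),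
  setI restV (ivar quotV),
  setI stepV (IExp.add (ivar stepV) (IExp.lit 1))]

/-- Add the contribution of a word of length `levelV`. -/
def wordCmd : Cmd := block [
  resetCmd,
  setI restV (ivar wordV),
  setI stepV (IExp.lit 0),
  setI lowV (IExp.lit 0),
  Cmd.loop (ltB (ivar stepV) (ivar levelV)) letterCmd,
  setC sumV (CExp.add (cvar sumV) (cvar wtV)),
  setI wordV (IExp.add (ivar wordV) (IExp.lit 1))]

/-- Compute the next coefficient of the polynomial `g`, divided by the number of maps. The number of
words is kept as a complex number, as there is no multiplication of natural numbers. -/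
def coeffCmd : Cmd := block [
  setI levelV (IExp.add (ivar levelV) (IExp.lit 1)),
  setC powV (CExp.mul (cvar powV) (CExp.cast (ivar entryV))),
  setI wordV (IExp.lit 0),
  setC sumV (CExp.cast (IExp.lit 0)),
  Cmd.loop (BExp.not (BExp.reLe (cvar powV) (CExp.cast (ivar wordV)))) wordCmd,
  Cmd.setNum coeffA (ivar levelV) (cvar sumV)]

/-- Compute the next Taylor coefficient of the logarithm by Newton's identities. -/
def newtonCmd : Cmd := block [
  setC convV (CExp.cast (IExp.lit 0)),
  setI idxV (IExp.lit 1),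
  Cmd.loop (ltB (ivar idxV) (ivar levelV)) (block [
    setC convV (CExp.add (cvar convV) (CExp.mul (CExp.mul (CExp.cast (ivar idxV))
      (CExp.get logA (ivar idxV))) (CExp.get coeffA (IExp.sub (ivar levelV) (ivar idxV))))),
    setI idxV (IExp.add (ivar idxV) (IExp.lit 1))]),
  Cmd.setNum logA (ivar levelV) (CExp.sub (CExp.get coeffA (ivar levelV))
    (CExp.div (cvar convV) (CExp.cast (ivar levelV)))),
  Cmd.setNum 3 (IExp.lit 1) (CExp.add (CExp.get 3 (IExp.lit 1)) (CExp.get logA (ivar levelV)))]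

/-- Compute the Taylor sum. -/
def taylorCmd : Cmd := block [
  setI levelV (IExp.lit 0),
  setC powV (CExp.cast (IExp.lit 1)),
  Cmd.setNum 3 (IExp.lit 1) (CExp.cast (IExp.lit 0)),
  Cmd.loop (ltB (ivar levelV) (ivar degV)) (block [coeffCmd, newtonCmd])]

/-- Compute the number of maps, a multinomial coefficient, as a product of quotients. -/
def totalCmd : Cmd := block [
  setC totalV (CExp.cast (IExp.lit 1)),
  setI countV (IExp.lit 0),
  setI idxV (IExp.lit 0),
  Cmd.loop (ltB (ivar idxV) colorsE) (block [
    setI restV (IExp.lit 0),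
    Cmd.loop (ltB (ivar restV) (IExp.get multA (ivar idxV))) (block [
      setI restV (IExp.add (ivar restV) (IExp.lit 1)),
      setI countV (IExp.add (ivar countV) (IExp.lit 1)),
      setC totalV (CExp.div (CExp.mul (cvar totalV) (CExp.cast (ivar countV)))
        (CExp.cast (ivar restV)))]),
    setI idxV (IExp.add (ivar idxV) (IExp.lit 1))])]

/-- Approximate the exponential of the Taylor sum `T` by `(1 + T / R) ^ R`, where `R` is the least
integer with `160000 M ^ 2 / min ε 1 ≤ R`. -/
def expCmd : Cmd := block [
  setC needV (CExp.div (CExp.mul (CExp.mul (CExp.cast (IExp.lit 160000)) (CExp.cast edgesE))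
    (CExp.cast edgesE)) (cvar tolV)),
  setI roundsV (IExp.lit 0),
  Cmd.loop (BExp.not (BExp.reLe (cvar needV) (CExp.cast (ivar roundsV))))
    (setI roundsV (IExp.add (ivar roundsV) (IExp.lit 1))),
  setC factorV (CExp.add (CExp.cast (IExp.lit 1))
    (CExp.div (CExp.get 3 (IExp.lit 1)) (CExp.cast (ivar roundsV)))),
  setC 3 (cvar totalV),
  setI idxV (IExp.lit 0),
  Cmd.loop (ltB (ivar idxV) (ivar roundsV)) (block [
    setC 3 (CExp.mul (cvar 3) (cvar factorV)),
    setI idxV (IExp.add (ivar idxV) (IExp.lit 1))])]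

/-- The whole algorithm, with the matrix entries given by `src`. -/
def mainCmd (src : CExp) : Cmd :=
  block [degreeCmd, tableCmd src, taylorCmd, totalCmd, expCmd]

/-! ### The degree -/

theorem runs_degreeCmd {σ : Store} {M n : ℕ} {ε : ℝ} (hM : σ.int 0 2 = M)
    (hε : σ.num 0 0 = (ε : ℂ))
    (hn : 800 * (M : ℝ) * (200 / 201) ^ n ≤ min ε 1)
    (hlt : ∀ m < n, min ε 1 < 800 * (M : ℝ) * (200 / 201) ^ m) :
    Runs degreeCmd σ (30 * n + 50) fun τ =>
      τ.int degV 0 = n ∧ τ.num tolV 0 = ((min ε 1 : ℝ) : ℂ) := by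
  refine Runs.mono (Runs.consNum <| Runs.cons (P := fun τ => τ.num tolV 0 = ((min ε 1 : ℝ) : ℂ))
    (Runs.ite (t := 4) (fun h => ?_) fun h => ?_) fun τ hτ hF =>
      Runs.consNum <| Runs.consInt <| Runs.cons
        (Runs.loop_const n 20 (fun m τ => τ.int degV 0 = m ∧
          τ.num errV 0 = ((800 * (M : ℝ) * (200 / 201) ^ m : ℝ) : ℂ)) ?_ ?_ ?_)
        fun τ' hτ' hF' => Runs.nil ?_) ?_ fun _ h => h
  · refine ⟨_, _, Exec.setNum _ _ _ _, by simp, ?_⟩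
    simp [hε] at h
    simp [h]
  · refine Runs.mono (Runs.skip ?_) (by norm_num) fun _ h => h
    simp [hε] at h
    simp [hε, h.le]
  · have h1 : τ.int 0 = σ.int 0 := by rw [hF.int 0 rfl]; rfl
    simp [h1, hM]
  · intro m hm τ' hF' hI
    have h1 : τ'.num tolV 0 = ((min ε 1 : ℝ) : ℂ) := by
      rw [hF'.num tolV rfl]; simpa using hτ
    refine ⟨?_, Runs.mono (Runs.consNum <| Runs.consInt <| Runs.nil ?_) (by simp) fun _ h => h⟩
    · rw [BExp.Holds, BExp.Holds, CExp.eval, CExp.eval, IExp.eval, h1, hI.2, Complex.ofReal_re,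
        Complex.ofReal_re]
      exact not_le.2 (hlt m hm)
    · simp [hI.1, hI.2, pow_succ]
      ring
  · intro τ' hF' hI
    have h1 : τ'.num tolV 0 = ((min ε 1 : ℝ) : ℂ) := by
      rw [hF'.num tolV rfl]; simpa using hτ
    rw [BExp.Holds, BExp.Holds, CExp.eval, CExp.eval, IExp.eval, h1, hI.2, Complex.ofReal_re,
        Complex.ofReal_re]
    exact not_not.2 hn
  · refine ⟨hτ'.1.1, ?_⟩
    rw [hF'.num tolV rfl]; simpa using hτ
  · simp; omega

/-! ### The table of entries -/

/-- The position of the entry of the edge `e` and the colors `i`, `j` determines `e`, `i` and `j`. -/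
theorem entry_decode {k e i j : ℕ} (hi : i < k) (hj : j < k) :
    ((e * k + i) * k + j) % k = j ∧ ((e * k + i) * k + j) / k = e * k + i ∧
      ((e * k + i) * k + j) / k % k = i ∧ ((e * k + i) * k + j) / k / k = e ∧
      ((e * k + i) * k + j) % (k * k) = i * k + j := by
  have h2 : ((e * k + i) * k + j) / k = e * k + i := by
    rw [mul_comm, Nat.mul_add_div (by omega), Nat.div_eq_of_lt hj, add_zero]
  have h1 : ((e * k + i) * k + j) % k = j := by
    rw [Nat.mul_add_mod', Nat.mod_eq_of_lt hj]
  have h3 : (e * k + i) % k = i := by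
    rw [Nat.mul_add_mod', Nat.mod_eq_of_lt hi]
  refine ⟨h1, h2, by rw [h2, h3], ?_, ?_⟩
  · rw [h2, mul_comm, Nat.mul_add_div (by omega), Nat.div_eq_of_lt hi, add_zero]
  · rw [Nat.mod_mul, h1, h2, h3]; ring

theorem entry_encode (k m : ℕ) : m = (m / k / k * k + m / k % k) * k + m % k := by
  rw [Nat.div_add_mod', Nat.div_add_mod']

/-- The table is filled in for the entries below `m`. -/
structure TableUpTo (k : ℕ) (fst snd : ℕ → ℕ) (ent : ℕ → ℂ) (m : ℕ) (τ : Store) : Prop where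
  head : ∀ x < m, τ.int headA x = fst (x / k / k)
  tail : ∀ x < m, τ.int tailA x = snd (x / k / k)
  headColor : ∀ x < m, τ.int headColorA x = x / k % k
  tailColor : ∀ x < m, τ.int tailColorA x = x % k
  entry : ∀ x < m, τ.num entryA x = ent x - 1

theorem TableUpTo.succ {k m : ℕ} {fst snd : ℕ → ℕ} {ent : ℕ → ℂ} {τ τ' : Store}
    (h : TableUpTo k fst snd ent m τ)
    (h1 : ∀ x, τ'.int headA x = if x = m then fst (m / k / k) else τ.int headA x)
    (h2 : ∀ x, τ'.int tailA x = if x = m then snd (m / k / k) else τ.int tailA x)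
    (h3 : ∀ x, τ'.int headColorA x = if x = m then m / k % k else τ.int headColorA x)
    (h4 : ∀ x, τ'.int tailColorA x = if x = m then m % k else τ.int tailColorA x)
    (h5 : ∀ x, τ'.num entryA x = if x = m then ent m - 1 else τ.num entryA x) :
    TableUpTo k fst snd ent (m + 1) τ' := by
  constructor <;> intro x hx <;> simp only [h1, h2, h3, h4, h5] <;> split_ifs with hxm
  · rw [hxm]
  · exact h.head x (by omega)
  · rw [hxm]
  · exact h.tail x (by omega)
  · rw [hxm]
  · exact h.headColor x (by omega)
  · rw [hxm]
  · exact h.tailColor x (by omega)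
  · rw [hxm]
  · exact h.entry x (by omega)

theorem runs_tableCmd {σ : Store} {M k : ℕ} (hk : 0 < k) (hσk : σ.int 0 1 = k)
    (hσM : σ.int 0 2 = M) (src : CExp) (ent : ℕ → ℂ)
    (hsrc : ∀ τ : Store, τ.num 1 = σ.num 1 → τ.num 2 = σ.num 2 →
      τ.int posV 0 = τ.int entryV 0 % (k * k) → src.eval τ = ent (τ.int entryV 0)) :
    Runs (tableCmd src) σ (M * k * k * (src.time + 100) + 30) fun τ =>
      τ.int entryV 0 = M * k * k ∧
      TableUpTo k (σ.int fstA) (σ.int sndA) ent (M * k * k) τ := by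
  have hdiv : ∀ m, m / k / k < M ↔ m < M * k * k := fun m => by
    rw [Nat.div_lt_iff_lt_mul hk, Nat.div_lt_iff_lt_mul hk]
  refine Runs.mono (Runs.consInt <| Runs.consInt <| Runs.consInt <| Runs.consInt <|
    Runs.consInt <| Runs.cons (Runs.loop_const (M * k * k) (src.time + 90) (fun m τ =>
      τ.int entryV 0 = m ∧ τ.int edgeV 0 = m / k / k ∧ τ.int rowV 0 = m / k % k ∧
      τ.int colV 0 = m % k ∧ τ.int posV 0 = m % (k * k) ∧
      TableUpTo k (σ.int fstA) (σ.int sndA) ent m τ) ?_ ?_ ?_)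
    fun τ hτ _ => Runs.nil ⟨hτ.1.1, hτ.1.2.2.2.2.2⟩) ?_ fun _ h => h
  · refine ⟨by simp, by simp, by simp, by simp, by simp, ?_⟩
    constructor <;> intro x hx <;> omega
  · rintro m hm τ hF ⟨h1, h2, h3, h4, h5, h6⟩
    have hτ0 : τ.int 0 = σ.int 0 := hF.int 0 rfl
    have hτ2 : τ.int 2 = σ.int 2 := hF.int 2 rfl
    have hτ3 : τ.int 3 = σ.int 3 := hF.int 3 rfl
    have hτn1 : τ.num 1 = σ.num 1 := hF.num 1 rfl
    have hτn2 : τ.num 2 = σ.num 2 := hF.num 2 rfl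
    refine ⟨by simpa [h2, hτ0, hσM] using (hdiv m).2 hm, ?_⟩
    obtain ⟨e, i, j, hi, hj, hme⟩ : ∃ e i j, i < k ∧ j < k ∧ m = (e * k + i) * k + j :=
      ⟨m / k / k, m / k % k, m % k, Nat.mod_lt _ hk, Nat.mod_lt _ hk, entry_encode k m⟩
    obtain ⟨d1, -, d3, d4, d5⟩ := entry_decode (e := e) hi hj
    rw [← hme] at d1 d3 d4 d5
    rw [d4] at h2; rw [d3] at h3; rw [d1] at h4; rw [d5] at h5
    have hs : src.eval ((((τ.setInt headA m (σ.int fstA e)).setInt tailA m (σ.int sndA e)).setInt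
        headColorA m i).setInt tailColorA m j) = ent m := by
      rw [hsrc]
      · simp [h1]
      · simp [hτn1]
      · simp [hτn2]
      · simp [h1, h5, d5]
    set Q : Store → Prop := fun τ =>
      τ.int entryV 0 = m + 1 ∧ τ.int edgeV 0 = (m + 1) / k / k ∧ τ.int rowV 0 = (m + 1) / k % k ∧
      τ.int colV 0 = (m + 1) % k ∧ τ.int posV 0 = (m + 1) % (k * k) ∧
      TableUpTo k (σ.int fstA) (σ.int sndA) ent (m + 1) τ with hQ
    refine Runs.mono (Runs.consInt <| Runs.consInt <| Runs.consInt <| Runs.consInt <|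
      Runs.consNum <| Runs.consInt <| Runs.consInt <| Runs.consInt <| Runs.cons (P := Q) (Runs.ite
      (fun hb => Runs.consInt <| Runs.consInt <| Runs.cons (P := Q) (Runs.ite (P := Q)
          (fun hb2 => Runs.consInt <| Runs.consInt <| Runs.consInt <| Runs.nil ?_)
          fun hb2 => Runs.mono (P := Q) (Runs.skip ?_) (by simp) fun _ h => h)
        fun τ hτ _ => Runs.nil hτ)
      fun hb => Runs.mono (P := Q) (Runs.skip ?_) (by simp) fun _ h => h)
      fun τ hτ _ => Runs.nil hτ) (by simp; omega) fun _ h => h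
    · simp [h1, h2, h3, h4, h5, hτ0, hτ2, hτ3, hσk, hs] at hb hb2
      have hme' : m + 1 = ((e + 1) * k + 0) * k + 0 := by
        rw [hme]
        obtain rfl : k = i + 1 := by omega
        obtain rfl : i = j := by omega
        ring
      obtain ⟨c1, -, c3, c4, c5⟩ := entry_decode (e := e + 1) hk hk
      rw [← hme'] at c1 c3 c4 c5
      refine ⟨by simp [h1], by simp [h2, c4], by simp [c3], by simp [c1], by simp [c5], ?_⟩
      refine h6.succ ?_ ?_ ?_ ?_ ?_ <;> intro x <;>
        simp [h1, h2, h3, h4, d1, d3, d4, hτ2, hτ3, hs]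
    · simp [h1, h2, h3, h4, h5, hτ0, hτ2, hτ3, hσk, hs] at hb hb2
      have hme' : m + 1 = (e * k + (i + 1)) * k + 0 := by
        rw [hme]
        obtain rfl : k = j + 1 := by omega
        ring
      obtain ⟨c1, -, c3, c4, c5⟩ := entry_decode (e := e) hb2 hk
      rw [← hme'] at c1 c3 c4 c5
      refine ⟨by simp [h1], by simp [h2, c4], by simp [h3, c3], by simp [c1], ?_, ?_⟩
      · simp [h5, c5]
        obtain rfl : k = j + 1 := by omega
        ring
      refine h6.succ ?_ ?_ ?_ ?_ ?_ <;> intro x <;>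
        simp [h1, h2, h3, h4, d1, d3, d4, hτ2, hτ3, hs]
    · simp [h1, h2, h3, h4, h5, hτ0, hτ2, hτ3, hσk, hs] at hb
      have hme' : m + 1 = (e * k + i) * k + (j + 1) := by rw [hme]; ring
      obtain ⟨c1, -, c3, c4, c5⟩ := entry_decode (e := e) hi hb
      rw [← hme'] at c1 c3 c4 c5
      refine ⟨by simp [h1], by simp [h2, c4], by simp [h3, c3], by simp [h4, c1], ?_, ?_⟩
      · simp [h5, c5]; ring
      refine h6.succ ?_ ?_ ?_ ?_ ?_ <;> intro x <;>
        simp [h1, h2, h3, h4, d1, d3, d4, hτ2, hτ3, hs]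
  · rintro τ hF ⟨h1, h2, h3, h4, h5, h6⟩
    have hτ0 : τ.int 0 = σ.int 0 := hF.int 0 rfl
    have := (hdiv (M * k * k)).not.2 (lt_irrefl _)
    simpa [h2, hτ0, hσM] using this
  · simp
    nlinarith [Nat.zero_le (M * k * k)]

/-! ### The contribution of a word -/

/-- The partial coloring kept in the memory. -/
noncomputable def partialOf (τ : Store) : Partial where
  col := τ.int colorA
  rem := τ.int remA
  free := τ.int freeV 0
  wt := τ.num wtV 0

theorem partialOf_setInt {τ : Store} {a i x : ℕ} (h : a ≠ freeV ∧ a ≠ remA ∧ a ≠ colorA) :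
    partialOf (τ.setInt a i x) = partialOf τ := by
  simp [partialOf, funext_iff, h.1.symm, h.2.1.symm, h.2.2.symm]

theorem runs_assignCmd {σ : Store} (p q : ℕ) (hp : p ≠ freeV ∧ p ≠ remA ∧ p ≠ colorA)
    (hq : q ≠ freeV ∧ q ≠ remA ∧ q ≠ colorA) :
    Runs (assignCmd (IExp.get p (ivar restV)) (IExp.get q (ivar restV))) σ 70 fun τ =>
      partialOf τ = (partialOf σ).assign (σ.int p (σ.int restV 0)) (σ.int q (σ.int restV 0)) := by
  obtain ⟨hp1, hp2, hp3⟩ := hp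
  obtain ⟨hq1, hq2, hq3⟩ := hq
  refine Runs.mono (Runs.ite (t := 45)
    (fun h => Runs.mono (Runs.consNum <| Runs.consInt <| Runs.consInt <| Runs.consInt <|
      Runs.nil ?_) (by simp) fun _ h => h)
    fun h => Runs.mono (Runs.ite (t := 4) (fun h2 => Runs.mono (Runs.skip ?_) (by norm_num)
      fun _ h => h) fun h2 => ⟨_, _, Exec.setNum _ _ _ _, by simp, ?_⟩) (by simp) fun _ h => h)
    (by simp) fun _ h => h
  · simp at h
    rw [Partial.assign, if_pos (by simpa [partialOf] using h)]
    simp only [partialOf, Partial.mk.injEq]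
    refine ⟨?_, ?_, ?_, ?_⟩
    · funext x; simp [Function.update_apply, hp1, hp2, hq1, hq2]
    · funext x; simp [Function.update_apply, hq1, hq2]
    · simp
    · simp
  · simp at h h2
    rw [Partial.assign, if_neg (by simpa [partialOf] using h),
      if_pos (by simpa [partialOf] using le_antisymm h2.1 h2.2)]
  · simp at h h2
    rw [Partial.assign, if_neg (by simpa [partialOf] using h), if_neg]
    · simp only [partialOf, Partial.mk.injEq]
      simp
    · simp [partialOf]; omega

theorem runs_divideCmd {σ : Store} {K r : ℕ} (hK : 0 < K) (hσK : σ.int entryV 0 = K)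
    (hr : σ.int restV 0 = r) :
    Runs divideCmd σ (r / K * 20 + 20) fun τ =>
      τ.int restV 0 = r % K ∧ τ.int quotV 0 = r / K := by
  refine Runs.mono (Runs.consInt <| Runs.cons (Runs.loop_const (r / K) 14 (fun m τ =>
    τ.int restV 0 = r - m * K ∧ τ.int quotV 0 = m) ?_ ?_ ?_)
    fun τ hτ _ => Runs.nil ⟨?_, hτ.1.2⟩) (by simp; omega) fun _ h => h
  · simp [hr]
  · rintro m hm τ hF ⟨h1, h2⟩
    have hτK : τ.int entryV 0 = K := by rw [hF.int entryV rfl]; simpa using hσK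
    have h3 : (m + 1) * K ≤ r := (Nat.mul_le_mul_right K hm).trans (Nat.div_mul_le_self r K)
    refine ⟨?_, Runs.mono (Runs.consInt <| Runs.consInt <| Runs.nil ?_) (by simp) fun _ h => h⟩
    · simp [h1, hτK]; rw [Nat.succ_mul] at h3; omega
    · simp [h1, h2, hτK]; rw [Nat.succ_mul]; omega
  · rintro τ hF ⟨h1, h2⟩
    have hτK : τ.int entryV 0 = K := by rw [hF.int entryV rfl]; simpa using hσK
    have := Nat.mod_lt r hK
    have h4 := Nat.div_add_mod' r K
    simp [h1, hτK]; omega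
  · rw [hτ.1.1]
    have h4 := Nat.div_add_mod' r K
    omega

theorem runs_resetCmd {σ : Store} {N k M : ℕ} (hN : σ.int 0 0 = N) (hk : σ.int 0 1 = k)
    (hM : σ.int 0 2 = M) :
    Runs resetCmd σ (30 * M + 30 * k + 50) fun τ =>
      (∀ e < M, τ.int colorA (σ.int fstA e) = 0 ∧ τ.int colorA (σ.int sndA e) = 0) ∧
      (∀ i < k, τ.int remA i = σ.int multA i) ∧ τ.int freeV 0 = N ∧ τ.num wtV 0 = 1 := by
  refine Runs.mono (Runs.consInt <| Runs.cons (Runs.loop_const M 20 (fun m τ =>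
      τ.int idxV 0 = m ∧
        ∀ e < m, τ.int colorA (σ.int fstA e) = 0 ∧ τ.int colorA (σ.int sndA e) = 0) ?_ ?_ ?_)
    fun τ₁ hτ₁ hF₁ => Runs.consInt <| Runs.cons (Runs.loop_const k 20 (fun m τ =>
      τ.int idxV 0 = m ∧ ∀ i < m, τ.int remA i = σ.int multA i) ?_ ?_ ?_)
    fun τ₂ hτ₂ hF₂ => Runs.consInt <| Runs.consNum <| Runs.nil ?_)
    (by simp; omega) fun _ h => h
  · exact ⟨by simp, fun e he => absurd he (Nat.not_lt_zero e)⟩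
  · rintro m hm τ hF ⟨h1, h2⟩
    have e0 : τ.int 0 = σ.int 0 := hF.int 0 rfl
    have e2 : τ.int fstA = σ.int fstA := hF.int fstA rfl
    have e3 : τ.int sndA = σ.int sndA := hF.int sndA rfl
    refine ⟨by simp [h1, e0, hM, hm], Runs.mono (Runs.consInt <| Runs.consInt <| Runs.consInt <|
      Runs.nil ⟨?_, fun e he => ?_⟩) (by simp) fun _ h => h⟩
    · simp [h1]
    · rcases Nat.lt_succ_iff_lt_or_eq.1 he with he | rfl
      · simp [h1, e2, e3, h2 e he]
      · simp [h1, e2, e3]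
  · rintro τ hF ⟨h1, h2⟩
    have e0 : τ.int 0 = σ.int 0 := hF.int 0 rfl
    simp [h1, e0, hM]
  · exact ⟨by simp, fun e he => absurd he (Nat.not_lt_zero e)⟩
  · rintro m hm τ hF ⟨h1, h2⟩
    have e0 : τ.int 0 = σ.int 0 := (hF.int 0 rfl).trans (hF₁.int 0 rfl)
    have e1 : τ.int multA = σ.int multA := (hF.int multA rfl).trans (hF₁.int multA rfl)
    refine ⟨by simp [h1, e0, hk, hm], Runs.mono (Runs.consInt <| Runs.consInt <|
      Runs.nil ⟨?_, fun e he => ?_⟩) (by simp) fun _ h => h⟩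
    · simp [h1]
    · rcases Nat.lt_succ_iff_lt_or_eq.1 he with he | rfl
      · simp [h1, h2 e he, he.ne]
      · simp [h1, e1]
  · rintro τ hF ⟨h1, h2⟩
    have e0 : τ.int 0 = σ.int 0 := (hF.int 0 rfl).trans (hF₁.int 0 rfl)
    simp [h1, e0, hk]
  · have e0 : τ₂.int 0 = σ.int 0 := (hF₂.int 0 rfl).trans (hF₁.int 0 rfl)
    have e22 : τ₂.int colorA = τ₁.int colorA := hF₂.int colorA rfl
    refine ⟨fun e he => ?_, fun i hi => ?_, by simp [e0, hN], by simp⟩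
    · simpa [e22] using hτ₁.1.2 e he
    · simpa using hτ₂.1.2 i hi

/-- The memory holds the graph with its multiplicities and the table of the entries `ent`. -/
structure Ready {N k M : ℕ} (μ : Fin k → ℕ) (edge : Fin M → Fin N × Fin N) (ent : ℕ → ℂ)
    (σ : Store) : Prop where
  vertices : σ.int 0 0 = N
  colors : σ.int 0 1 = k
  edges : σ.int 0 2 = M
  mult : ∀ i : Fin k, σ.int multA i = μ i
  fst : ∀ e : Fin M, σ.int fstA e = (edge e).1
  snd : ∀ e : Fin M, σ.int sndA e = (edge e).2
  base : σ.int entryV 0 = M * k * k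
  table : TableUpTo k (σ.int fstA) (σ.int sndA) ent (M * k * k) σ

theorem Ready.of_frame {N k M : ℕ} {μ : Fin k → ℕ} {edge : Fin M → Fin N × Fin N} {ent : ℕ → ℂ}
    {σ τ : Store} {c : Cmd} (h : Ready μ edge ent σ) (hF : Frame c σ τ)
    (hc : c.writesInt 0 = false ∧ c.writesInt multA = false ∧ c.writesInt fstA = false ∧
      c.writesInt sndA = false ∧ c.writesInt entryV = false ∧ c.writesInt headA = false ∧
      c.writesInt tailA = false ∧ c.writesInt headColorA = false ∧
      c.writesInt tailColorA = false ∧ c.writesNum entryA = false) :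
    Ready μ edge ent τ := by
  obtain ⟨c0, c1, c2, c3, c5, c10, c11, c12, c13, n5⟩ := hc
  refine ⟨?_, ?_, ?_, ?_, ?_, ?_, ?_, ?_⟩
  · rw [hF.int 0 c0, h.vertices]
  · rw [hF.int 0 c0, h.colors]
  · rw [hF.int 0 c0, h.edges]
  · rw [hF.int _ c1]; exact h.mult
  · rw [hF.int _ c2]; exact h.fst
  · rw [hF.int _ c3]; exact h.snd
  · rw [hF.int _ c5, h.base]
  · rw [hF.int _ c2, hF.int _ c3]
    exact ⟨by rw [hF.int _ c10]; exact h.table.head, by rw [hF.int _ c11]; exact h.table.tail,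
      by rw [hF.int _ c12]; exact h.table.headColor, by rw [hF.int _ c13]; exact h.table.tailColor,
      by rw [hF.num _ n5]; exact h.table.entry⟩

theorem Ready.setInt {N k M : ℕ} {μ : Fin k → ℕ} {edge : Fin M → Fin N × Fin N} {ent : ℕ → ℂ}
    {σ : Store} (h : Ready μ edge ent σ) {a : ℕ} (ha : tailColorA < a) (i x : ℕ) :
    Ready μ edge ent (σ.setInt a i x) := by
  have e : ∀ b ≤ tailColorA, (σ.setInt a i x).int b = σ.int b := fun b hb => by
    funext y; simp [(hb.trans_lt ha).ne]
  obtain ⟨h1, h2, h3, h4, h5, h6, h7, t1, t2, t3, t4, t5⟩ := h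
  constructor
  · rwa [e _ (by norm_num)]
  · rwa [e _ (by norm_num)]
  · rwa [e _ (by norm_num)]
  · rwa [e _ (by norm_num)]
  · rwa [e _ (by norm_num)]
  · rwa [e _ (by norm_num)]
  · rwa [e _ (by norm_num)]
  · rw [e fstA (by norm_num), e sndA (by norm_num)]
    constructor
    · rwa [e _ (by norm_num)]
    · rwa [e _ (by norm_num)]
    · rwa [e _ (by norm_num)]
    · rwa [e _ (by norm_num)]
    · exact t5

theorem Ready.setNum {N k M : ℕ} {μ : Fin k → ℕ} {edge : Fin M → Fin N × Fin N} {ent : ℕ → ℂ}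
    {σ : Store} (h : Ready μ edge ent σ) {a : ℕ} (ha : a ≠ entryA) (i : ℕ) (x : ℂ) :
    Ready μ edge ent (σ.setNum a i x) := by
  obtain ⟨h1, h2, h3, h4, h5, h6, h7, t1, t2, t3, t4, t5⟩ := h
  refine ⟨h1, h2, h3, h4, h5, h6, h7, t1, t2, t3, t4, fun y hy => ?_⟩
  simpa [ha.symm] using t5 y hy

/-- The deviation from one of the `x`-th matrix entry, if the map `φ` uses this entry, and `0`
otherwise. -/
noncomputable def usedEntry {N k M : ℕ} (edge : Fin M → Fin N × Fin N) (ent : ℕ → ℂ)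
    (φ : Fin N → Fin k) (x : ℕ) : ℂ :=
  if h : x / k / k < M ∧ 0 < k then
    (ent x - 1) * (if φ (edge ⟨x / k / k, h.1⟩).1 = ⟨x / k % k, Nat.mod_lt _ h.2⟩ then 1 else 0) *
      (if φ (edge ⟨x / k / k, h.1⟩).2 = ⟨x % k, Nat.mod_lt _ h.2⟩ then 1 else 0)
  else 0

/-- The vertices that are ends of edges. -/
def endpoints {N M : ℕ} (edge : Fin M → Fin N × Fin N) : Finset (Fin N) :=
  univ.filter fun v => ∃ e, v = (edge e).1 ∨ v = (edge e).2

section Word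

variable {N k M : ℕ} {μ : Fin k → ℕ} {edge : Fin M → Fin N × Fin N} {ent : ℕ → ℂ} {σ : Store}

/-- Reading a letter multiplies the represented function `F` by the factor of this letter. -/
theorem runs_letterCmd (h : Ready μ edge ent σ) {K r lo t : ℕ} (hK : K = M * k * k) (hK0 : 0 < K)
    (hr : σ.int restV 0 = r) (hlo : σ.int lowV 0 = lo) (ht : σ.int stepV 0 = t)
    {F : (Fin N → Fin k) → ℂ} (hF : (partialOf σ).Represents μ (endpoints edge) F) :
    Runs letterCmd σ (20 * r + 220) fun τ =>
      τ.int restV 0 = r / K ∧ τ.int lowV 0 = r % K + 1 ∧ τ.int stepV 0 = t + 1 ∧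
      (partialOf τ).Represents μ (endpoints edge)
        fun φ => F φ * if lo ≤ r % K then usedEntry edge ent φ (r % K) else 0 := by
  have hk : 0 < k := by
    rcases Nat.eq_zero_or_pos k with rfl | hk
    · simp [hK] at hK0
    · exact hk
  set x := r % K with hx
  have hxK : x < M * k * k := hK ▸ Nat.mod_lt r hK0
  have hxM : x / k / k < M := by
    rwa [Nat.div_lt_iff_lt_mul hk, Nat.div_lt_iff_lt_mul hk]
  set e : Fin M := ⟨x / k / k, hxM⟩
  set i : Fin k := ⟨x / k % k, Nat.mod_lt _ hk⟩
  set j : Fin k := ⟨x % k, Nat.mod_lt _ hk⟩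
  have hhead : σ.int headA x = (edge e).1 := by
    rw [h.table.head x hxK]; exact h.fst e
  have htail : σ.int tailA x = (edge e).2 := by
    rw [h.table.tail x hxK]; exact h.snd e
  have hc1 : σ.int headColorA x = i := h.table.headColor x hxK
  have hc2 : σ.int tailColorA x = j := h.table.tailColor x hxK
  have hent : σ.num entryA x = ent x - 1 := h.table.entry x hxK
  have hu : (edge e).1 ∈ endpoints edge := mem_filter.2 ⟨mem_univ _, e, Or.inl rfl⟩
  have hv : (edge e).2 ∈ endpoints edge := mem_filter.2 ⟨mem_univ _, e, Or.inr rfl⟩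
  have hused : ∀ φ, usedEntry edge ent φ x = (ent x - 1) * (if φ (edge e).1 = i then 1 else 0) *
      (if φ (edge e).2 = j then 1 else 0) := fun φ => by
    rw [usedEntry, dif_pos ⟨hxM, hk⟩]
  -- The factor of the letter apart from the two conditions on the colors.
  set A : ℂ := (ent x - 1) * if lo ≤ x then 1 else 0 with hA
  refine Runs.mono (Runs.cons (runs_divideCmd hK0 (hK ▸ h.base) hr) fun τ₁ hτ₁ hF₁ =>
    Runs.consNum <| Runs.cons (P := fun τ => partialOf τ =
        ({ partialOf σ with wt := (partialOf σ).wt * A } : Partial)) (Runs.ite (t := 4)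
      (fun hb => Runs.mono (Runs.skip ?_) (by norm_num) fun _ h => h)
      fun hb => ⟨_, _, Exec.setNum _ _ _ _, by simp, ?_⟩) fun τ₂ hτ₂ hF₂ => Runs.consInt <|
    Runs.cons (runs_assignCmd headA headColorA (by norm_num) (by norm_num)) fun τ₃ hτ₃ hF₃ =>
    Runs.cons (runs_assignCmd tailA tailColorA (by norm_num) (by norm_num)) fun τ₄ hτ₄ hF₄ =>
    Runs.consInt <| Runs.consInt <| Runs.nil ?_) ?_ fun _ h => h
  · have e20 : τ₁.int freeV = σ.int freeV := hF₁.int _ rfl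
    have e21 : τ₁.int remA = σ.int remA := hF₁.int _ rfl
    have e22 : τ₁.int colorA = σ.int colorA := hF₁.int _ rfl
    have e19 : τ₁.int lowV = σ.int lowV := hF₁.int _ rfl
    have n8 : τ₁.num wtV = σ.num wtV := hF₁.num _ rfl
    have n5 : τ₁.num entryA = σ.num entryA := hF₁.num _ rfl
    have r1 : τ₁.int restV 0 = x := hτ₁.1
    simp [e19, hlo, r1] at hb
    simp [partialOf, e20, e21, e22, n8, n5, r1, hent, hA, hb]
  · have e20 : τ₁.int freeV = σ.int freeV := hF₁.int _ rfl
    have e21 : τ₁.int remA = σ.int remA := hF₁.int _ rfl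
    have e22 : τ₁.int colorA = σ.int colorA := hF₁.int _ rfl
    have e19 : τ₁.int lowV = σ.int lowV := hF₁.int _ rfl
    have r1 : τ₁.int restV 0 = x := hτ₁.1
    simp [e19, hlo, r1] at hb
    simp [partialOf, e20, e21, e22, hA, hb]
  · have f : ∀ a, a = headA ∨ a = tailA ∨ a = headColorA ∨ a = tailColorA →
        τ₂.int a = σ.int a := by
      rintro a (rfl | rfl | rfl | rfl) <;> exact (hF₂.int _ rfl).trans (hF₁.int _ rfl)
    have r2 : τ₂.int restV 0 = x := by rw [hF₂.int _ rfl]; exact hτ₁.1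
    have f3 : ∀ a, a = tailA ∨ a = tailColorA → τ₃.int a = σ.int a := by
      rintro a (rfl | rfl)
      · rw [hF₃.int _ rfl]; exact f _ (by simp)
      · rw [hF₃.int _ rfl]; exact f _ (by simp)
    have r3 : τ₃.int restV 0 = x := by rw [hF₃.int _ rfl]; exact r2
    have p3 : partialOf τ₃ = ({ partialOf σ with wt := (partialOf σ).wt * A } : Partial).assign
        (edge e).1 i := by
      rw [hτ₃, ← hτ₂]
      have g : ∀ a, a ≠ lowV → (τ₂.setInt lowV ((IExp.lit 0).eval τ₂)
          (((ivar restV).add (IExp.lit 1)).eval τ₂)).int a = τ₂.int a := fun a ha => by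
        funext y; simp [ha]
      rw [partialOf_setInt (by norm_num), g _ (by norm_num), g _ (by norm_num), g _ (by norm_num),
        r2, f _ (by simp), f _ (by simp), hhead, hc1]
    have p4 : partialOf τ₄ = (({ partialOf σ with wt := (partialOf σ).wt * A } : Partial).assign
        (edge e).1 i).assign (edge e).2 j := by
      rw [hτ₄, p3, r3, f3 _ (by simp), f3 _ (by simp), htail, hc2]
    refine ⟨?_, ?_, ?_, ?_⟩
    · have : τ₄.int quotV 0 = r / K := by
        rw [hF₄.int _ rfl, hF₃.int _ rfl]
        simp only [Store.setInt_int]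
        rw [hF₂.int _ rfl]; simpa using hτ₁.2
      simp [this]
    · have : τ₄.int lowV 0 = x + 1 := by
        rw [hF₄.int _ rfl, hF₃.int _ rfl]
        simp [r2]
      simp [this]
    · have : τ₄.int stepV 0 = t := by
        rw [hF₄.int _ rfl, hF₃.int _ rfl]
        simp only [Store.setInt_int]
        rw [hF₂.int _ rfl]
        simp [hF₁.int stepV rfl, ht]
      simp [this]
    · have p5 := ((hF.mul A).assign hu i).assign hv j
      rw [← p4] at p5
      rw [partialOf_setInt (by norm_num), partialOf_setInt (by norm_num)]
      convert! p5 using 1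
      funext φ
      by_cases hlx : lo ≤ x <;> simp [hA, hlx, hused]
  · have := Nat.div_le_self r K
    simp
    omega

end Word

/-! ### The Taylor sum -/

section Taylor

open Polynomial

variable {N k M : ℕ} {μ : Fin k → ℕ} {edge : Fin M → Fin N × Fin N} {ent : ℕ → ℂ} {σ : Store}

/-- The invariant of the loop: the represented function `F`, times the product over the letters that
have not been read yet, is the product over all letters of the word. -/
theorem runs_wordCmd (h : Ready μ edge ent σ) {K c j : ℕ} (hK : K = M * k * k) (hK0 : 0 < K)
    (hS : (mapsWithMult μ : Finset (Fin N → Fin k)).Nonempty) (hc : σ.int wordV 0 = c)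
    (hj : σ.int levelV 0 = j) {s : ℂ} (hs : σ.num sumV 0 = s) :
    Runs wordCmd σ (30 * M + 30 * k + j * (20 * c + 230) + 100) fun τ =>
      τ.int wordV 0 = c + 1 ∧
      τ.num sumV 0 * (mapsWithMult μ : Finset (Fin N → Fin k)).card =
        s * (mapsWithMult μ : Finset (Fin N → Fin k)).card +
          ∑ φ ∈ (mapsWithMult μ : Finset (Fin N → Fin k)),
            wordProd K (usedEntry edge ent φ) j 0 c := by
  have : Nonempty (Fin N → Fin k) := ⟨hS.choose⟩
  refine Runs.mono (Runs.cons (runs_resetCmd h.vertices h.colors h.edges) fun τ₁ hτ₁ hF₁ =>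
    Runs.consInt <| Runs.consInt <| Runs.consInt <| Runs.cons
    (Runs.loop_const j (20 * c + 220) (fun m τ => ∃ r lo F, r ≤ c ∧ τ.int restV 0 = r ∧
      τ.int lowV 0 = lo ∧ τ.int stepV 0 = m ∧ (partialOf τ).Represents μ (endpoints edge) F ∧
      ∀ φ, F φ * wordProd K (usedEntry edge ent φ) (j - m) lo r =
        wordProd K (usedEntry edge ent φ) j 0 c) ?_ ?_ ?_) fun τ₂ hτ₂ hF₂ =>
    Runs.consNum <| Runs.consInt <| Runs.nil ?_) (by
      have := Nat.mul_le_mul_left j (by omega : 20 * c + 220 + 6 + 1 ≤ 20 * c + 230)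
      simp; omega) fun _ h => h
  · obtain ⟨hcol, hrem, hfree, hwt⟩ := hτ₁
    refine ⟨c, 0, fun _ => 1, le_rfl, ?_, ?_, ?_, ?_, fun φ => by simp⟩
    · simp [hF₁.int wordV rfl, hc]
    · simp
    · simp
    · rw [partialOf_setInt (by norm_num), partialOf_setInt (by norm_num),
        partialOf_setInt (by norm_num)]
      refine Partial.represents_init (fun v hv => ?_) (fun a => ?_) hfree hwt
      · obtain ⟨e, rfl | rfl⟩ := (mem_filter.1 hv).2
        · rw [← h.fst e]; exact (hcol e e.2).1
        · rw [← h.snd e]; exact (hcol e e.2).2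
      · rw [← h.mult a]; exact hrem a a.2
  · rintro m hm τ hF ⟨r, lo, F, hrc, hr, hlo, ht, hrep, hφ⟩
    have hτ : Ready μ edge ent τ := by
      have h1 : Ready μ edge ent τ₁ := h.of_frame hF₁ (by decide)
      exact (((h1.setInt (by norm_num) _ _).setInt (by norm_num) _ _).setInt (by norm_num) _
        _).of_frame hF (by decide)
    have e14 : τ.int levelV 0 = j := by
      rw [hF.int _ rfl]
      simp [hF₁.int levelV rfl, hj]
    refine ⟨by simp [ht, e14, hm], (runs_letterCmd hτ hK hK0 hr hlo ht hrep).mono (by omega) ?_⟩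
    rintro τ' ⟨h1, h2, h3, h4⟩
    refine ⟨_, _, _, (Nat.div_le_self r K).trans hrc, h1, h2, h3, h4, fun φ => ?_⟩
    rw [← hφ φ, show j - m = (j - (m + 1)) + 1 by omega, wordProd, mul_assoc]
  · rintro τ hF ⟨r, lo, F, hrc, hr, hlo, ht, hrep, hφ⟩
    have e14 : τ.int levelV 0 = j := by
      rw [hF.int _ rfl]
      simp [hF₁.int levelV rfl, hj]
    simp [ht, e14]
  · obtain ⟨⟨r, lo, F, -, -, -, -, hrep, hφ⟩, -⟩ := hτ₂
    have e1 : τ₂.int wordV 0 = c := by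
      rw [hF₂.int _ rfl]
      simp [hF₁.int wordV rfl, hc]
    have e2 : τ₂.num sumV 0 = s := by
      rw [hF₂.num _ rfl]
      simp [hF₁.num sumV rfl, hs]
    refine ⟨by simp [e1], ?_⟩
    have := hrep.sum_eq
    simp only [Nat.sub_self, wordProd, mul_one] at hφ
    rw [sum_congr rfl fun φ _ => hφ φ] at this
    rw [← this]
    simp [e2, add_mul, partialOf]

/-- The polynomial `g`, in terms of the table of entries. -/
noncomputable def tablePoly (μ : Fin k → ℕ) (edge : Fin M → Fin N × Fin N) (ent : ℕ → ℂ) : ℂ[X] :=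
  ∑ φ ∈ (mapsWithMult μ : Finset (Fin N → Fin k)),
    ∏ x ∈ range (M * k * k), (1 + X * C (usedEntry edge ent φ x))

theorem runs_coeffCmd (h : Ready μ edge ent σ) {K j : ℕ} (hK : K = M * k * k) (hK0 : 0 < K)
    (hS : (mapsWithMult μ : Finset (Fin N → Fin k)).Nonempty)
    (hj : σ.int levelV 0 = j) (hpow : σ.num powV 0 = ((K ^ j : ℕ) : ℂ)) :
    Runs coeffCmd σ (K ^ (j + 1) *
        (30 * M + 30 * k + (j + 1) * (20 * K ^ (j + 1) + 230) + 110) + 50) fun τ =>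
      τ.int levelV 0 = j + 1 ∧ τ.num powV 0 = ((K ^ (j + 1) : ℕ) : ℂ) ∧
      τ.num coeffA (j + 1) * (mapsWithMult μ : Finset (Fin N → Fin k)).card =
        (tablePoly μ edge ent).coeff (j + 1) ∧
      ∀ i ≤ j, τ.num coeffA i = σ.num coeffA i := by
  set s : ℂ := ((mapsWithMult μ : Finset (Fin N → Fin k)).card : ℂ) with hs
  refine Runs.mono (Runs.consInt <| Runs.consNum <| Runs.consInt <| Runs.consNum <| Runs.cons
    (Runs.loop_const (K ^ (j + 1)) (30 * M + 30 * k + (j + 1) * (20 * K ^ (j + 1) + 230) + 100)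
      (fun m τ => τ.int wordV 0 = m ∧ τ.num sumV 0 * s = ∑ c ∈ range m,
        ∑ φ ∈ (mapsWithMult μ : Finset (Fin N → Fin k)),
          wordProd K (usedEntry edge ent φ) (j + 1) 0 c) ?_ ?_ ?_) fun τ₁ hτ₁ hF₁ =>
    Runs.consNum <| Runs.nil ?_) ?_ fun _ h => h
  · simp
  · rintro m hm τ hF ⟨h1, h2⟩
    have hτ : Ready μ edge ent τ := by
      exact ((((h.setInt (by norm_num) _ _).setNum (by norm_num) _ _).setInt (by norm_num) _
        _).setNum (by norm_num) _ _).of_frame hF (by decide)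
    have e14 : τ.int levelV 0 = j + 1 := by rw [hF.int _ rfl]; simp [hj]
    have e7 : τ.num powV 0 = ((K ^ (j + 1) : ℕ) : ℂ) := by
      rw [hF.num _ rfl]; simp [hpow, h.base, hK, pow_succ]
    refine ⟨?_, (runs_wordCmd hτ hK hK0 hS h1 e14 rfl).mono ?_ ?_⟩
    · rw [BExp.Holds, BExp.Holds, CExp.eval, CExp.eval, IExp.eval, e7, IExp.eval, IExp.eval, h1,
        Complex.natCast_re, Complex.natCast_re, Nat.cast_le]
      omega
    · gcongr
    · rintro τ' ⟨h3, h4⟩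
      refine ⟨h3, ?_⟩
      rw [h4, sum_range_succ, ← h2]
  · rintro τ hF ⟨h1, h2⟩
    have e7 : τ.num powV 0 = ((K ^ (j + 1) : ℕ) : ℂ) := by
      rw [hF.num _ rfl]; simp [hpow, h.base, hK, pow_succ]
    rw [BExp.Holds, BExp.Holds, CExp.eval, CExp.eval, IExp.eval, e7, IExp.eval, IExp.eval, h1]
    simp
  · have e14 : τ₁.int levelV 0 = j + 1 := by rw [hF₁.int _ rfl]; simp [hj]
    have e7 : τ₁.num powV 0 = ((K ^ (j + 1) : ℕ) : ℂ) := by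
      rw [hF₁.num _ rfl]; simp [hpow, h.base, hK, pow_succ]
    refine ⟨by simpa using e14, by simpa using e7, ?_, fun i hi => ?_⟩
    · have h2 := hτ₁.1.2
      rw [sum_comm] at h2
      simp only [sum_wordProd] at h2
      simp [e14]
      rw [h2, tablePoly, finsetSum_coeff, hK, range_eq_Ico]
    · have : τ₁.num coeffA = σ.num coeffA := by
        rw [hF₁.num _ rfl]; funext y; simp
      have hi' : i ≠ j + 1 := by omega
      simp [e14, this, hi']
  · simp
    have e : 30 * M + 30 * k + (j + 1) * (20 * K ^ (j + 1) + 230) + 100 + 7 + 1 ≤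
      30 * M + 30 * k + (j + 1) * (20 * K ^ (j + 1) + 230) + 110 := by omega
    have := Nat.mul_le_mul_left (K ^ (j + 1)) e
    omega

/-- The stored coefficients are those of the polynomial divided by its value `s` at zero, to which
Newton's identities apply as well. -/
theorem runs_newtonCmd {j : ℕ} (hj : σ.int levelV 0 = j) (hj1 : 1 ≤ j) {s : ℂ} (hs : s ≠ 0)
    {p F : ℕ → ℂ} (hp0 : p 0 = s)
    (hp : ∀ i, 1 ≤ i → i ≤ j → σ.num coeffA i * s = p i)
    (hF : ∀ i, 1 ≤ i → i < j → σ.num logA i = F i)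
    (hN : (j : ℂ) * p j = ∑ i ∈ Icc 1 j, (i : ℂ) * F i * p (j - i)) :
    Runs newtonCmd σ (40 * j + 60) fun τ =>
      (∀ i, 1 ≤ i → i ≤ j → τ.num logA i = F i) ∧ τ.num 3 1 = σ.num 3 1 + F j := by
  refine Runs.mono (Runs.consNum <| Runs.consInt <| Runs.cons
    (Runs.loop_const (j - 1) 30 (fun m τ => τ.int idxV 0 = m + 1 ∧
      τ.num convV 0 * s = ∑ i ∈ Ico 1 (m + 1), (i : ℂ) * F i * p (j - i)) ?_ ?_ ?_)
    fun τ₁ hτ₁ hF₁ => Runs.consNum <| Runs.consNum <| Runs.nil ?_)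
    (by simp; omega) fun _ h => h
  · simp
  · rintro m hm τ hFr ⟨h1, h2⟩
    have e14 : τ.int levelV 0 = j := by rw [hFr.int _ rfl]; simpa using hj
    have e10 : τ.num logA (m + 1) = F (m + 1) := by
      rw [hFr.num _ rfl, ← hF (m + 1) (by omega) (by omega)]; simp
    have e9 : τ.num coeffA (j - (m + 1)) * s = p (j - (m + 1)) := by
      rw [hFr.num _ rfl, ← hp (j - (m + 1)) (by omega) (by omega)]; simp
    refine ⟨by simp [h1, e14]; omega, Runs.mono (Runs.consNum <| Runs.consInt <|
      Runs.nil ⟨?_, ?_⟩) (by simp) fun _ h => h⟩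
    · simp [h1]
    · rw [sum_Ico_succ_top (by omega), ← h2, ← e9]
      simp [h1, e14, e10]
      ring
  · rintro τ hFr ⟨h1, h2⟩
    have e14 : τ.int levelV 0 = j := by rw [hFr.int _ rfl]; simpa using hj
    simp [h1, e14]; omega
  · have e14 : τ₁.int levelV 0 = j := by rw [hF₁.int _ rfl]; simpa using hj
    have e10 : ∀ i, τ₁.num logA i = σ.num logA i := fun i => by
      rw [hF₁.num _ rfl]; simp
    have e9 : τ₁.num coeffA j * s = p j := by
      rw [hF₁.num _ rfl, ← hp j hj1 le_rfl]; simp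
    have e3 : τ₁.num 3 1 = σ.num 3 1 := by
      rw [hF₁.num _ rfl]; simp
    have hFj : τ₁.num coeffA j - τ₁.num convV 0 / (j : ℂ) = F j := by
      have h2 := hτ₁.1.2
      rw [show j - 1 + 1 = j by omega] at h2
      obtain ⟨j, rfl⟩ := Nat.exists_eq_add_of_le' hj1
      rw [← Ico_add_one_right_eq_Icc, sum_Ico_succ_top (by omega), ← h2, Nat.sub_self, hp0, ← e9]
        at hN
      have hj0 : ((j + 1 : ℕ) : ℂ) ≠ 0 := by exact_mod_cast Nat.succ_ne_zero j
      have : ((j + 1 : ℕ) : ℂ) * τ₁.num coeffA (j + 1) =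
          τ₁.num convV 0 + ((j + 1 : ℕ) : ℂ) * F (j + 1) := by
        apply mul_right_cancel₀ hs
        linear_combination hN
      field_simp
      linear_combination this
    refine ⟨fun i hi1 hij => ?_, ?_⟩
    · rcases eq_or_lt_of_le hij with rfl | hij
      · simp [e14, hFj]
      · simp [e14, hij.ne, e10, hF i hi1 hij]
    · simp [e14, hFj, e3]

theorem runs_taylorCmd (h : Ready μ edge ent σ) {K n : ℕ} (hK : K = M * k * k) (hK0 : 0 < K)
    (hS : (mapsWithMult μ : Finset (Fin N → Fin k)).Nonempty)
    (hn : σ.int degV 0 = n) {F : ℕ → ℂ}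
    (hp0 : (tablePoly μ edge ent).coeff 0 = (mapsWithMult μ : Finset (Fin N → Fin k)).card)
    (hN : ∀ j : ℕ, 1 ≤ j → (j : ℂ) * (tablePoly μ edge ent).coeff j =
      ∑ i ∈ Icc 1 j, (i : ℂ) * F i * (tablePoly μ edge ent).coeff (j - i)) :
    Runs taylorCmd σ (n * (K ^ n * (30 * M + 30 * k + n * (20 * K ^ n + 230) + 110) +
        40 * n + 120) + 30) fun τ =>
      τ.num 3 1 = ∑ j ∈ Icc 1 n, F j := by
  set p := fun j => (tablePoly μ edge ent).coeff j
  set s : ℂ := ((mapsWithMult μ : Finset (Fin N → Fin k)).card : ℂ) with hs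
  have hs0 : s ≠ 0 := by rw [hs]; exact_mod_cast (card_pos.2 hS).ne'
  refine Runs.mono (Runs.consInt <| Runs.consNum <| Runs.consNum <| Runs.cons
    (Runs.loop_const n (K ^ n * (30 * M + 30 * k + n * (20 * K ^ n + 230) + 110) + 40 * n + 111)
      (fun m τ => τ.int levelV 0 = m ∧ τ.num powV 0 = ((K ^ m : ℕ) : ℂ) ∧
        (∀ i, 1 ≤ i → i ≤ m → τ.num coeffA i * s = p i) ∧
        (∀ i, 1 ≤ i → i ≤ m → τ.num logA i = F i) ∧ τ.num 3 1 = ∑ j ∈ Icc 1 m, F j) ?_ ?_ ?_)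
    fun τ₁ hτ₁ _ => Runs.nil hτ₁.1.2.2.2.2) (by
      have := Nat.mul_le_mul_left n (by omega :
        K ^ n * (30 * M + 30 * k + n * (20 * K ^ n + 230) + 110) + 40 * n + 111 + 6 + 1 ≤
        K ^ n * (30 * M + 30 * k + n * (20 * K ^ n + 230) + 110) + 40 * n + 120)
      simp; omega) fun _ h => h
  · refine ⟨by simp, by simp, fun i h1 h2 => by omega, fun i h1 h2 => by omega, by simp⟩
  · rintro m hm τ hFr ⟨h1, h2, h3, h4, h5⟩
    have hτ : Ready μ edge ent τ := by
      exact (((h.setInt (by norm_num) _ _).setNum (by norm_num) _ _).setNum (by norm_num) _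
        _).of_frame hFr (by decide)
    have e4 : τ.int degV 0 = n := by rw [hFr.int _ rfl]; simpa using hn
    have hKn : K ^ (m + 1) ≤ K ^ n := Nat.pow_le_pow_right hK0 hm
    refine ⟨by simp [h1, e4, hm], Runs.mono (Runs.cons (t := 40 * (m + 1) + 60 + 1)
      (runs_coeffCmd hτ hK hK0 hS h1 h2) fun τ₁ hτ₁ hF₁ => ?_) ?_ fun _ h => h⟩
    · obtain ⟨g1, g2, g3, g4⟩ := hτ₁
      have hco : ∀ i, 1 ≤ i → i ≤ m + 1 → τ₁.num coeffA i * s = p i := by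
        intro i hi1 him
        rcases Nat.lt_or_ge i (m + 1) with him' | him'
        · rw [g4 i (by omega)]; exact h3 i hi1 (by omega)
        · obtain rfl : i = m + 1 := by omega
          exact g3
      have hlo : ∀ i, 1 ≤ i → i < m + 1 → τ₁.num logA i = F i := fun i hi1 him => by
        rw [hF₁.num _ rfl]; exact h4 i hi1 (by omega)
      refine Runs.cons (runs_newtonCmd (F := F) (p := p) g1 (by omega) hs0 hp0 hco hlo
        (hN (m + 1) (by omega))) fun τ₂ hτ₂ hF₂ => Runs.nil ⟨?_, ?_, ?_, hτ₂.1, ?_⟩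
      · rw [hF₂.int _ rfl]; exact g1
      · rw [hF₂.num _ rfl]; exact g2
      · rw [hF₂.num _ rfl]; exact hco
      · rw [hτ₂.2, hF₁.num _ rfl, h5, sum_Icc_succ_top (by omega)]
    · have e : K ^ (m + 1) * (30 * M + 30 * k + (m + 1) * (20 * K ^ (m + 1) + 230) + 110) ≤
          K ^ n * (30 * M + 30 * k + n * (20 * K ^ n + 230) + 110) := by gcongr; omega
      omega
  · rintro τ hFr ⟨h1, h2, h3, h4, h5⟩
    have e4 : τ.int degV 0 = n := by rw [hFr.int _ rfl]; simpa using hn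
    simp [h1, e4]

end Taylor

/-! ### The number of maps and the exponential -/

section Output

variable {N k M : ℕ} {μ : Fin k → ℕ} {σ : Store}

theorem runs_totalCmd (hk : σ.int 0 1 = k) (hμ : ∀ i : Fin k, σ.int multA i = μ i)
    (hN : ∑ i, μ i = N) :
    Runs totalCmd σ (60 * N + 60 * k + 60) fun τ =>
      τ.num totalV 0 = (mapsWithMult μ : Finset (Fin N → Fin k)).card := by
  set m' := σ.int multA with hm'
  have hsum : ∑ i ∈ range k, m' i = N := by
    rw [sum_range, ← hN]; exact sum_congr rfl fun i _ => hμ i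
  have hprod : ∏ i ∈ range k, (m' i).factorial = ∏ i, (μ i).factorial := by
    rw [prod_range]; exact prod_congr rfl fun i _ => by rw [hμ i]
  refine Runs.mono (Runs.consNum <| Runs.consInt <| Runs.consInt <| Runs.cons
    (Runs.loop k (fun m => m' m * 50 + 40) (fun m τ => τ.int idxV 0 = m ∧
      τ.int countV 0 = ∑ i ∈ range m, m' i ∧
      τ.num totalV 0 * ((∏ i ∈ range m, (m' i).factorial : ℕ) : ℂ) =
        (((∑ i ∈ range m, m' i).factorial : ℕ) : ℂ)) ?_ ?_ ?_)
    fun τ hτ _ => Runs.nil ?_) ?_ fun _ h => h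
  · simp
  · rintro m hm τ hF ⟨h1, h2, h3⟩
    have e0 : τ.int 0 = σ.int 0 := hF.int 0 rfl
    have e1 : τ.int multA = m' := hF.int multA rfl
    refine ⟨by simp [h1, e0, hk, hm], Runs.mono (Runs.consInt <| Runs.cons
      (Runs.loop_const (m' m) 30 (fun r τ => τ.int restV 0 = r ∧
        τ.int countV 0 = ∑ i ∈ range m, m' i + r ∧
        τ.num totalV 0 * ((∏ i ∈ range m, (m' i).factorial : ℕ) : ℂ) * (r.factorial : ℕ) =
          (((∑ i ∈ range m, m' i + r).factorial : ℕ) : ℂ)) ?_ ?_ ?_)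
      fun τ₁ hτ₁ hF₁ => Runs.consInt <| Runs.nil ?_) (by simp; omega) fun _ h => h⟩
    · simpa [h2] using h3
    · rintro r hr τ₁ hF₁ ⟨g1, g2, g3⟩
      have e23 : τ₁.int idxV 0 = m := by rw [hF₁.int _ rfl]; simpa using h1
      have e1' : τ₁.int multA = m' := by
        rw [hF₁.int _ rfl]; funext y; simp [e1]
      refine ⟨by simp [e23, e1', g1, hr], Runs.mono (Runs.consInt <| Runs.consInt <|
        Runs.consNum <| Runs.nil ⟨?_, ?_, ?_⟩) (by simp) fun _ h => h⟩
      · simp [g1]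
      · simp [g2, add_assoc]
      · have hr0 : ((r : ℂ) + 1) ≠ 0 := by exact_mod_cast Nat.succ_ne_zero r
        rw [← add_assoc, Nat.factorial_succ, Nat.factorial_succ]
        simp [g1, g2]
        push_cast at g3
        field_simp
        linear_combination (∑ i ∈ range m, (m' i : ℂ) + r + 1) * g3
    · rintro τ₁ hF₁ ⟨g1, g2, g3⟩
      have e23 : τ₁.int idxV 0 = m := by rw [hF₁.int _ rfl]; simpa using h1
      have e1' : τ₁.int multA = m' := by
        rw [hF₁.int _ rfl]; funext y; simp [e1]
      simp [e23, e1', g1]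
    · obtain ⟨⟨g1, g2, g3⟩, -⟩ := hτ₁
      have e23 : τ₁.int idxV 0 = m := by rw [hF₁.int _ rfl]; simpa using h1
      refine ⟨by simp [e23], by simp [g2, sum_range_succ], ?_⟩
      rw [prod_range_succ, sum_range_succ, ← g3, Nat.cast_mul]
      simp
      ring
  · rintro τ hF ⟨h1, h2, h3⟩
    have e0 : τ.int 0 = σ.int 0 := hF.int 0 rfl
    simp [h1, e0, hk]
  · obtain ⟨⟨h1, h2, h3⟩, -⟩ := hτ
    rw [hsum, hprod, ← card_mapsWithMult_mul hN, Nat.cast_mul] at h3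
    refine mul_right_cancel₀ ?_ h3
    exact_mod_cast (prod_pos fun i _ => (μ i).factorial_pos).ne'
  · simp [sum_add_distrib, ← sum_mul, hsum]
    omega

theorem runs_expCmd {tol : ℝ} {T g : ℂ} (hM : σ.int 0 2 = M) (htol : σ.num tolV 0 = (tol : ℂ))
    (hT : σ.num 3 1 = T) (hg : σ.num totalV 0 = g) {R : ℕ}
    (hR : R = ⌈160000 * (M : ℝ) * M / tol⌉₊) :
    Runs expCmd σ (60 * R + 80) fun τ =>
      τ.num 3 1 = T ∧ τ.num 3 0 = g * (1 + T / R) ^ R := by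
  refine Runs.mono (Runs.consNum <| Runs.consInt <| Runs.cons
    (Runs.loop_const R 10 (fun m τ => τ.int roundsV 0 = m) ?_ ?_ ?_) fun τ₁ hτ₁ hF₁ =>
    Runs.consNum <| Runs.consNum <| Runs.consInt <| Runs.cons
    (Runs.loop_const R 16 (fun m τ => τ.int idxV 0 = m ∧ τ.num 3 0 = g * (1 + T / R) ^ m ∧
      τ.num 3 1 = T) ?_ ?_ ?_) fun τ₂ hτ₂ _ => Runs.nil ⟨hτ₂.1.2.2, hτ₂.1.2.1⟩)
    (by simp; omega) fun _ h => h
  · simp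
  · intro m hm τ hF h1
    have e14 : τ.num needV 0 = ((160000 * (M : ℝ) * M / tol : ℝ) : ℂ) := by
      rw [hF.num _ rfl]; simp [hM, htol]
    refine ⟨?_, ⟨_, _, Exec.setInt _ _ _ _, by simp, by simp [h1]⟩⟩
    rw [BExp.Holds, BExp.Holds, CExp.eval, CExp.eval, IExp.eval, e14, IExp.eval, IExp.eval, h1,
      Complex.ofReal_re, Complex.natCast_re, not_le]
    exact Nat.lt_ceil.1 (hR ▸ hm)
  · intro τ hF h1
    have e14 : τ.num needV 0 = ((160000 * (M : ℝ) * M / tol : ℝ) : ℂ) := by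
      rw [hF.num _ rfl]; simp [hM, htol]
    rw [BExp.Holds, BExp.Holds, CExp.eval, CExp.eval, IExp.eval, e14, IExp.eval, IExp.eval, h1,
      Complex.ofReal_re, Complex.natCast_re, not_not, hR]
    exact Nat.le_ceil _
  · have e3 : τ₁.num 3 1 = T := by rw [hF₁.num _ rfl]; simpa using hT
    have e13 : τ₁.num totalV 0 = g := by rw [hF₁.num _ rfl]; simpa using hg
    simp [e3, e13]
  · rintro m hm τ hF ⟨h1, h2, h3⟩
    have e25 : τ.int roundsV 0 = R := by rw [hF.int _ rfl]; simpa using hτ₁.1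
    have e3 : τ₁.num 3 1 = T := by rw [hF₁.num _ rfl]; simpa using hT
    have e15 : τ.num factorV 0 = 1 + T / R := by
      rw [hF.num _ rfl]; simp [e3, hτ₁.1]
    refine ⟨by simp [h1, e25, hm], Runs.mono (Runs.consNum <| Runs.consInt <|
      Runs.nil ⟨?_, ?_, ?_⟩) (by simp) fun _ h => h⟩
    · simp [h1]
    · simp [h2, e15, pow_succ, mul_assoc]
    · simp [h3]
  · rintro τ hF ⟨h1, h2, h3⟩
    have e25 : τ.int roundsV 0 = R := by rw [hF.int _ rfl]; simpa using hτ₁.1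
    simp [h1, e25]

theorem runs_mainCmd {edge : Fin M → Fin N × Fin N} {ent : ℕ → ℂ} {ε : ℝ}
    (h : HoldsGraph σ μ edge ε) (hM : 0 < M) (hk : 0 < k) (hN : ∑ i, μ i = N) (src : CExp)
    (hsrc : ∀ τ : Store, τ.num 1 = σ.num 1 → τ.num 2 = σ.num 2 →
      τ.int posV 0 = τ.int entryV 0 % (k * k) → src.eval τ = ent (τ.int entryV 0))
    {n : ℕ} (hn : 800 * (M : ℝ) * (200 / 201) ^ n ≤ min ε 1)
    (hlt : ∀ m < n, min ε 1 < 800 * (M : ℝ) * (200 / 201) ^ m) {F : ℕ → ℂ}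
    (hp0 : (tablePoly μ edge ent).coeff 0 = (mapsWithMult μ : Finset (Fin N → Fin k)).card)
    (hF : ∀ j : ℕ, 1 ≤ j → (j : ℂ) * (tablePoly μ edge ent).coeff j =
      ∑ i ∈ Icc 1 j, (i : ℂ) * F i * (tablePoly μ edge ent).coeff (j - i))
    {K R : ℕ} (hK : K = M * k * k) (hR : R = ⌈160000 * (M : ℝ) * M / min ε 1⌉₊) :
    Runs (mainCmd src) σ
      (n * (K ^ n * (30 * M + 30 * k + n * (20 * K ^ n + 230) + 110) + 40 * n + 120) + 30 * n +
        K * (src.time + 100) + 60 * N + 60 * k + 60 * R + 280) fun τ =>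
      τ.int degV 0 = n ∧ τ.num 3 1 = ∑ j ∈ Icc 1 n, F j ∧
      τ.num 3 0 = (mapsWithMult μ : Finset (Fin N → Fin k)).card *
        (1 + (∑ j ∈ Icc 1 n, F j) / R) ^ R := by
  have hK0 : 0 < K := by rw [hK]; positivity
  have hS : (mapsWithMult μ : Finset (Fin N → Fin k)).Nonempty := mapsWithMult_nonempty hN
  refine Runs.mono (Runs.cons (t := M * k * k * (src.time + 100) + 30 +
      (n * (K ^ n * (30 * M + 30 * k + n * (20 * K ^ n + 230) + 110) + 40 * n + 120) + 30 +
      (60 * N + 60 * k + 60 + (60 * R + 80 + 1))))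
    (runs_degreeCmd h.edges h.accuracy hn hlt) fun τ₁ hτ₁ hF₁ => ?_) (by rw [hK]; omega)
    fun _ h => h
  have a0 : τ₁.int 0 = σ.int 0 := hF₁.int _ rfl
  have a1 : τ₁.int multA = σ.int multA := hF₁.int _ rfl
  have a2 : τ₁.int fstA = σ.int fstA := hF₁.int _ rfl
  have a3 : τ₁.int sndA = σ.int sndA := hF₁.int _ rfl
  have b1 : τ₁.num 1 = σ.num 1 := hF₁.num _ rfl
  have b2 : τ₁.num 2 = σ.num 2 := hF₁.num _ rfl
  refine Runs.cons (runs_tableCmd hk (a0 ▸ h.colors) (a0 ▸ h.edges) src ent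
    (by rw [b1, b2]; exact hsrc)) fun τ₂ hτ₂ hF₂ => ?_
  have hw : ∀ a, a ≤ 4 → (tableCmd src).writesInt a = false := fun a ha => by
    interval_cases a <;> rfl
  have hv : ∀ a, a = 3 ∨ a = tolV → (tableCmd src).writesNum a = false := by
    rintro a (rfl | rfl) <;> rfl
  have c0 : τ₂.int 0 = σ.int 0 := (hF₂.int _ (hw _ (by norm_num))).trans a0
  have c1 : τ₂.int multA = σ.int multA := (hF₂.int _ (hw _ (by norm_num))).trans a1
  have c2 : τ₂.int fstA = σ.int fstA := (hF₂.int _ (hw _ (by norm_num))).trans a2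
  have c3 : τ₂.int sndA = σ.int sndA := (hF₂.int _ (hw _ (by norm_num))).trans a3
  have c4 : τ₂.int degV 0 = n := by rw [hF₂.int _ (hw _ (by norm_num))]; exact hτ₁.1
  have d4 : τ₂.num tolV 0 = ((min ε 1 : ℝ) : ℂ) := by
    rw [hF₂.num _ (hv _ (by simp))]; exact hτ₁.2
  have hready : Ready μ edge ent τ₂ := by
    refine ⟨c0 ▸ h.vertices, c0 ▸ h.colors, c0 ▸ h.edges, c1 ▸ h.mult, c2 ▸ h.fst, c3 ▸ h.snd,
      hτ₂.1, ?_⟩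
    rw [c2, c3, ← a2, ← a3]; exact hτ₂.2
  refine Runs.cons (runs_taylorCmd hready hK hK0 hS c4 hp0 hF) fun τ₃ hτ₃ hF₃ => ?_
  have e0 : τ₃.int 0 = σ.int 0 := (hF₃.int _ rfl).trans c0
  have e1 : τ₃.int multA = σ.int multA := (hF₃.int _ rfl).trans c1
  refine Runs.cons (runs_totalCmd (e0 ▸ h.colors) (e1 ▸ h.mult) hN) fun τ₄ hτ₄ hF₄ => ?_
  refine Runs.cons (runs_expCmd (M := M) (tol := min ε 1) (T := ∑ j ∈ Icc 1 n, F j)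
    (g := (mapsWithMult μ : Finset (Fin N → Fin k)).card) ?_ ?_ ?_ hτ₄ hR) fun τ₅ hτ₅ hF₅ =>
    Runs.nil ⟨?_, hτ₅.1, hτ₅.2⟩
  · rw [hF₄.int _ rfl, e0]; exact h.edges
  · rw [hF₄.num _ rfl, hF₃.num _ rfl]; exact d4
  · rw [hF₄.num _ rfl]; exact hτ₃
  · rw [hF₅.int _ rfl, hF₄.int _ rfl, hF₃.int _ rfl]; exact c4

end Output

/-! ### The partition function as a polynomial -/

section PartitionPolynomial

open Polynomial

variable {N k M : ℕ} {μ : Fin k → ℕ} {edge : Fin M → Fin N × Fin N} {ent : ℕ → ℂ}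

/-- Of the entries that belong to an edge, exactly one is used by `φ`. -/
theorem prod_one_add_usedEntry {b : Fin M → Fin k → Fin k → ℂ}
    (hent : ∀ (e : Fin M) (i j : Fin k), ent (((e : ℕ) * k + i) * k + j) = b e i j)
    (φ : Fin N → Fin k) :
    ∏ x ∈ range (M * k * k), (1 + X * C (usedEntry edge ent φ x)) =
      ∏ e, (1 + X * C (b e (φ (edge e).1) (φ (edge e).2) - 1)) := by
  have key : ∀ (e : Fin M) (i j : Fin k), usedEntry edge ent φ (((e : ℕ) * k + i) * k + j) =
      if φ (edge e).1 = i then if φ (edge e).2 = j then b e i j - 1 else 0 else 0 := by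
    intro e i j
    obtain ⟨h1, -, h2, h3, -⟩ := entry_decode (e := e) i.2 j.2
    have hk : 0 < k := i.pos
    simp only [usedEntry, h1, h2, h3, hent, e.2, hk, and_self, dite_true, Fin.eta]
    split_ifs <;> simp
  rw [prod_range_mul_add, prod_range_mul_add, prod_range]
  refine prod_congr rfl fun e _ => ?_
  rw [prod_range, prod_eq_single (φ (edge e).1), prod_range, prod_eq_single (φ (edge e).2)]
  · simp [key]
  · intro j _ hj
    simp [key, hj.symm]
  · simp
  · intro i _ hi
    rw [prod_range]
    refine prod_eq_one fun j _ => ?_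
    simp [key, hi.symm]
  · simp

theorem tablePoly_coeff_zero :
    (tablePoly μ edge ent).coeff 0 = (mapsWithMult μ : Finset (Fin N → Fin k)).card := by
  simp [tablePoly, coeff_zero_eq_eval_zero, eval_finsetSum, eval_prod]

variable {b : Fin M → Fin k → Fin k → ℂ}

theorem tablePoly_natDegree_le
    (hent : ∀ (e : Fin M) (i j : Fin k), ent (((e : ℕ) * k + i) * k + j) = b e i j) :
    (tablePoly μ edge ent).natDegree ≤ M := by
  refine natDegree_sum_le_of_forall_le _ _ fun φ _ => ?_
  rw [prod_one_add_usedEntry hent]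
  refine (natDegree_prod_le _ _).trans ?_
  refine (sum_le_card_nsmul _ _ 1 fun e _ => ?_).trans (by simp)
  compute_degree

theorem eval_tablePoly {G : SimpleGraph (Fin N)} [DecidableRel G.Adj] (hedge : IsEdgeList G edge)
    {B : Sym2 (Fin N) → Sym2 (Fin k) → ℂ}
    (hent : ∀ (e : Fin M) (i j : Fin k), ent (((e : ℕ) * k + i) * k + j) =
      B s((edge e).1, (edge e).2) s(i, j)) (z : ℂ) :
    (tablePoly μ edge ent).eval z = segQ G μ B z := by
  rw [tablePoly, eval_finsetSum, segQ, partQ]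
  refine sum_congr rfl fun φ _ => ?_
  rw [prod_one_add_usedEntry hent, eval_prod]
  refine prod_bij (fun e _ => s((edge e).1, (edge e).2)) ?_ ?_ ?_ ?_
  · intro e _
    exact SimpleGraph.mem_edgeFinset.2 (hedge.mapsTo (Set.mem_univ e))
  · intro e _ e' _ h
    exact hedge.injOn (Set.mem_univ e) (Set.mem_univ e') h
  · intro s hs
    obtain ⟨e, -, he⟩ := hedge.surjOn (SimpleGraph.mem_edgeFinset.1 hs)
    exact ⟨e, mem_univ e, he⟩
  · intro e _
    simp

theorem segQ_one (G : SimpleGraph (Fin N)) [DecidableRel G.Adj]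
    (B : Sym2 (Fin N) → Sym2 (Fin k) → ℂ) : segQ G μ B 1 = partQ G μ B := by
  simp [segQ]

theorem segP_one (G : SimpleGraph (Fin N)) [DecidableRel G.Adj]
    (A : Matrix (Fin k) (Fin k) ℂ) : segP G μ A 1 = partP G μ A := by
  simp [segP, partP]

/-- The factor `1.005` turns the radius `0.1 / Δ(G)` into the radius of `sum_prod_ne_zero`. -/
theorem segQ_ne_zero (G : SimpleGraph (Fin N)) [DecidableRel G.Adj] (hG : 1 ≤ G.maxDegree)
    (hN : ∑ i, μ i = N) {B : Sym2 (Fin N) → Sym2 (Fin k) → ℂ}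
    (hB : ∀ e ∈ G.edgeSet, ∀ p, ‖B e p - 1‖ ≤ 0.1 / (G.maxDegree : ℝ)) {z : ℂ}
    (hz : ‖z‖ ≤ 1.005) : segQ G μ B z ≠ 0 := by
  refine sum_prod_ne_zero (d := G.maxDegree)
    (W := fun e φ => 1 + z * (B e (e.map φ) - 1)) hG (fun u => ?_) ⟨?_, ?_⟩
    (mapsWithMult_nonempty hN)
  · refine le_trans (le_of_eq ?_) (G.degree_le_maxDegree u)
    rw [← G.card_incidenceFinset_eq_degree, G.incidenceFinset_eq_filter]
  · intro e φ φ' h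
    rw [Sym2.map_congr h]
  · intro e he φ
    have h1 := hB e (SimpleGraph.mem_edgeFinset.1 he) (e.map φ)
    calc ‖1 + z * (B e (e.map φ) - 1) - 1‖ = ‖z‖ * ‖B e (e.map φ) - 1‖ := by
          rw [add_sub_cancel_left, norm_mul]
      _ ≤ 1.005 * (0.1 / (G.maxDegree : ℝ)) := by gcongr
      _ = 0.1005 / (G.maxDegree : ℝ) := by ring

/-- A symmetric matrix, as a matrix indexed by unordered pairs. -/
def symEntries (A : Matrix (Fin k) (Fin k) ℂ) (hA : A.IsSymm) : Sym2 (Fin k) → ℂ :=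
  Sym2.lift ⟨fun i j => A i j, fun i j => hA.apply j i⟩

theorem segP_eq_segQ (G : SimpleGraph (Fin N)) [DecidableRel G.Adj]
    (A : Matrix (Fin k) (Fin k) ℂ) (hA : A.IsSymm) :
    segP G μ A = segQ G μ fun _ => symEntries A hA := by
  funext z
  refine sum_congr rfl fun φ _ => prod_congr rfl fun e _ => ?_
  have h : e.map φ = s(φ e.out.1, φ e.out.2) := by
    conv_lhs => rw [← Quot.out_eq e]
    rfl
  simp [h, symEntries]

end PartitionPolynomial

/-! ### The accuracy of the output -/

section Accuracy

/-- The logarithm of `(1 + T / R) ^ R` is `T` up to an error of at most `‖T‖ ^ 2 / R`; this is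
where `160000 = 4 * 200 ^ 2` comes from. -/
theorem exists_exp_eq_one_add_div_pow {T : ℂ} {R : ℕ} {M δ : ℝ} (hM : 1 ≤ M) (hδ : 0 < δ)
    (hδ1 : δ ≤ 1) (hT : ‖T‖ ≤ 200 * M) (hR : 160000 * M * M / δ ≤ R) :
    ∃ w : ℂ, Complex.exp w = (1 + T / R) ^ R ∧ ‖w - T‖ ≤ δ / 4 := by
  rw [div_le_iff₀ hδ] at hR
  have hR0 : (0 : ℝ) < R := by
    by_contra! h
    nlinarith
  have hz : ‖T / R‖ ≤ 1 / 2 := by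
    rw [norm_div, Complex.norm_natCast, div_le_iff₀ hR0]
    nlinarith
  have hne : 1 + T / R ≠ 0 := by
    intro h
    rw [eq_neg_of_add_eq_zero_right h, norm_neg, norm_one] at hz
    norm_num at hz
  refine ⟨R * Complex.log (1 + T / R), ?_, ?_⟩
  · rw [Complex.exp_nat_mul, Complex.exp_log hne]
  · have hRT : T = R * (T / R) := by
      have : (R : ℂ) ≠ 0 := by exact_mod_cast hR0.ne'
      field_simp
    have hlog : ‖Complex.log (1 + T / R) - T / R‖ ≤ ‖T / R‖ ^ 2 := by
      refine (Complex.norm_log_one_add_sub_self_le (by linarith)).trans ?_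
      have h2 : (1 - ‖T / R‖)⁻¹ ≤ 2 := by
        rw [inv_le_comm₀ (by linarith) two_pos]; linarith
      nlinarith [sq_nonneg ‖T / R‖]
    calc ‖R * Complex.log (1 + T / R) - T‖
        = R * ‖Complex.log (1 + T / R) - T / R‖ := by
          conv_lhs => rw [hRT, ← hRT]
          rw [← Complex.norm_natCast, ← norm_mul, mul_sub, ← hRT]
      _ ≤ R * ‖T / R‖ ^ 2 := by gcongr
      _ = ‖T‖ ^ 2 / R := by
          rw [norm_div, Complex.norm_natCast]; field_simp
      _ ≤ (200 * M) ^ 2 / R := by gcongr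
      _ ≤ δ / 4 := by
          rw [div_le_iff₀ hR0]; nlinarith

/-- The truncation of the Taylor series and the approximation of the exponential each contribute an
error of at most a quarter of `min ε 1`. -/
theorem isApproximation_of_isLogExpansion {p : Polynomial ℂ} {M : ℕ} {f : ℂ → ℂ} {F : ℕ → ℂ}
    (h : IsLogExpansion p M f F) (hM : 0 < M) {ε D : ℝ} (hε : 0 < ε) {n R : ℕ}
    (hn : 800 * (M : ℝ) * (200 / 201) ^ n ≤ min ε 1) (hnD : (n : ℝ) ≤ D)
    (hR : R = ⌈160000 * (M : ℝ) * M / min ε 1⌉₊) {τ : Store} (hτn : τ.int 4 0 = n)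
    (hτT : τ.num 3 1 = ∑ j ∈ Icc 1 n, F j)
    (hτg : τ.num 3 0 = p.coeff 0 * (1 + (∑ j ∈ Icc 1 n, F j) / R) ^ R) :
    IsApproximation τ (fun z => p.eval z) ε D := by
  have hδ : 0 < min ε 1 := lt_min hε one_pos
  obtain ⟨w, hw, hwT⟩ := exists_exp_eq_one_add_div_pow (T := ∑ j ∈ Icc 1 n, F j) (R := R)
    (M := M) (by exact_mod_cast hM) hδ (min_le_right _ _) (h.norm_sum_le n)
    (hR ▸ Nat.le_ceil _)
  have hT := h.error n
  set T := ∑ j ∈ Icc 1 n, F j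
  have hexp : Complex.exp (f 0 + w) = τ.num 3 0 := by
    rw [Complex.exp_add, h.branch.exp_eq 0 (by simp), hw, hτg, Polynomial.coeff_zero_eq_eval_zero]
  have hT4 : ‖f 1 - (f 0 + T)‖ ≤ min ε 1 / 4 := by linarith
  have hfw : ‖f 1 - (f 0 + w)‖ ≤ min ε 1 / 2 := by
    calc ‖f 1 - (f 0 + w)‖ = ‖(f 1 - (f 0 + T)) - (w - T)‖ := by congr 1; ring
      _ ≤ _ := norm_sub_le _ _
      _ ≤ min ε 1 / 2 := by linarith
  have hδε : min ε 1 ≤ ε := min_le_left _ _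
  refine ⟨f, h.branch, hτn ▸ hnD, ?_, ?_, ?_, ⟨f 0 + w, hexp, by linarith⟩, ?_⟩
  · rw [hτT, hτn]
    exact sum_congr rfl fun j hj => h.coeff j (mem_Icc.1 hj).1
  · rw [hτT]; linarith
  · rw [← hexp]; exact Complex.exp_ne_zero _
  · have h1 : p.eval 1 = Complex.exp (f 1) := (h.branch.exp_eq 1 (by simp)).symm
    have hs : ‖f 0 + w - f 1‖ ≤ min ε 1 / 2 := by rwa [norm_sub_rev]
    have h2 := Complex.norm_exp_sub_one_le (x := f 0 + w - f 1)
      (by linarith [min_le_right ε 1])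
    calc ‖τ.num 3 0 - p.eval 1‖
        = ‖p.eval 1‖ * ‖Complex.exp (f 0 + w - f 1) - 1‖ := by
          rw [← norm_mul, mul_sub, h1, ← Complex.exp_add, add_sub_cancel, hexp, mul_one]
      _ ≤ ‖p.eval 1‖ * ε := by gcongr; linarith
      _ = ε * ‖p.eval 1‖ := mul_comm _ _

end Accuracy

/-! ### The running time -/

section Time

theorem log_two_le_logSize {M : ℕ} (hM : 0 < M) (ε : ℝ) : Real.log 2 ≤ logSize M ε := by
  have h : (1 : ℝ) ≤ M := by exact_mod_cast hM
  have := Real.log_le_log two_pos (by linarith : (2 : ℝ) ≤ M + 1)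
  have := le_max_left 0 (-Real.log ε)
  rw [logSize]
  linarith

theorem neg_log_min_one {ε : ℝ} (hε : 0 < ε) : -Real.log (min ε 1) = max 0 (-Real.log ε) := by
  rcases le_total ε 1 with h | h
  · rw [min_eq_left h, max_eq_right (neg_nonneg.2 (Real.log_nonpos hε.le h))]
  · rw [min_eq_right h, max_eq_left (neg_nonpos.2 (Real.log_nonneg h)), Real.log_one, neg_zero]

theorem inv_min_one_le_exp_logSize {M : ℕ} {ε : ℝ} (hε : 0 < ε) :
    (min ε 1)⁻¹ ≤ Real.exp (logSize M ε) := by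
  rw [← Real.exp_log (inv_pos.2 (lt_min hε one_pos)), Real.log_inv, neg_log_min_one hε, logSize]
  have : 0 ≤ Real.log ((M : ℝ) + 1) := Real.log_nonneg (by linarith [(M.cast_nonneg : (0:ℝ) ≤ M)])
  exact Real.exp_le_exp.2 (by linarith)

/-- The degree of the Taylor polynomial: the first exponent at which the error bound is small
enough. -/
theorem exists_degree {M : ℕ} (hM : 0 < M) {ε : ℝ} (hε : 0 < ε) :
    ∃ n : ℕ, 800 * (M : ℝ) * (200 / 201) ^ n ≤ min ε 1 ∧
      (∀ m < n, min ε 1 < 800 * (M : ℝ) * (200 / 201) ^ m) ∧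
      (n : ℝ) ≤ 2213 * logSize M ε := by
  have hδ : 0 < min ε 1 := lt_min hε one_pos
  have hM1 : (1 : ℝ) ≤ M := by exact_mod_cast hM
  have hL := log_two_le_logSize hM ε
  have h2 := Real.log_two_gt_d9
  have hex : ∃ n : ℕ, 800 * (M : ℝ) * (200 / 201) ^ n ≤ min ε 1 := by
    obtain ⟨n, hn⟩ := exists_pow_lt_of_lt_one (div_pos hδ (by positivity : 0 < 800 * (M : ℝ)))
      (by norm_num : (200 / 201 : ℝ) < 1)
    exact ⟨n, by rw [lt_div_iff₀ (by positivity)] at hn; linarith⟩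
  classical
  refine ⟨Nat.find hex, Nat.find_spec hex, fun m hm => not_le.1 (Nat.find_min hex hm), ?_⟩
  rcases Nat.eq_zero_or_pos (Nat.find hex) with h0 | h0
  · rw [h0, Nat.cast_zero]; linarith
  obtain ⟨m, hm⟩ := Nat.exists_eq_add_of_lt h0
  rw [zero_add] at hm
  have hlt := not_le.1 (Nat.find_min hex (show m < Nat.find hex by omega))
  have hlog := Real.log_lt_log hδ hlt
  rw [Real.log_mul (by positivity) (by positivity), Real.log_mul (by norm_num) (by positivity),
    Real.log_pow, ← neg_neg (Real.log (min ε 1)), neg_log_min_one hε] at hlog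
  have hq : Real.log (200 / 201) ≤ -(1 / 201) := by
    have := Real.log_le_sub_one_of_pos (by norm_num : (0 : ℝ) < 200 / 201)
    linarith
  have h800 : Real.log 800 ≤ 10 * Real.log 2 := by
    rw [show (10 : ℝ) * Real.log 2 = Real.log (2 ^ 10) by rw [Real.log_pow]; norm_num]
    exact Real.log_le_log (by norm_num) (by norm_num)
  have hMlog : Real.log M ≤ Real.log ((M : ℝ) + 1) :=
    Real.log_le_log (by linarith) (by linarith)
  have hmq : (m : ℝ) * Real.log (200 / 201) ≤ m * -(1 / 201) := by gcongr
  rw [hm]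
  push_cast
  rw [logSize] at hL ⊢
  linarith

/-- The number of steps is bounded by a power of `M k + 1` whose exponent is of order
`n + logSize M ε`. -/
theorem steps_le_timeBound {N k M n R s : ℕ} (hM : 0 < M) (hk : 0 < k) {ε : ℝ} (hε : 0 < ε)
    (hs : s ≤ 10) (hn : (n : ℝ) ≤ 2213 * logSize M ε)
    (hR : R = ⌈160000 * (M : ℝ) * M / min ε 1⌉₊) :
    ((n * ((M * k * k) ^ n * (30 * M + 30 * k + n * (20 * (M * k * k) ^ n + 230) + 110) +
        40 * n + 120) + 30 * n + (M * k * k) * (s + 100) + 60 * N + 60 * k + 60 * R + 280 : ℕ) : ℝ) ≤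
      timeBound 14000 N k M ε := by
  have hδ : 0 < min ε 1 := lt_min hε one_pos
  set L := logSize M ε with hLdef
  -- Apart from `N` and `R`, the quantities in the bound are at most `Z ^ 2`.
  set X := M * k + 1 with hX
  set Z := X ^ (n + 1) with hZ
  have hL : 1 / 2 ≤ L := by
    have := log_two_le_logSize hM ε
    have := Real.log_two_gt_d9
    linarith
  have hMk : 0 < M * k := Nat.mul_pos hM hk
  have hX2 : 2 ≤ X := by omega
  have hX1 : 1 ≤ X := by omega
  have hXZ : X ≤ Z := Nat.le_self_pow n.succ_ne_zero X
  have hMX : M ≤ X := (Nat.le_mul_of_pos_right M hk).trans (Nat.le_succ _)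
  have hkX : k ≤ X := (Nat.le_mul_of_pos_left k hM).trans (Nat.le_succ _)
  have hMZ := hMX.trans hXZ
  have hkZ := hkX.trans hXZ
  have hnZ : n ≤ Z := (Nat.lt_pow_self (by omega : 1 < X)).le.trans
    (Nat.pow_le_pow_right hX1 n.le_succ)
  have hKX : M * k * k ≤ X ^ 2 := by
    rw [sq]; exact Nat.mul_le_mul (Nat.le_succ _) hkX
  have hKZ : M * k * k ≤ Z ^ 2 := hKX.trans (Nat.pow_le_pow_left hXZ 2)
  have hKnZ : (M * k * k) ^ n ≤ Z ^ 2 := by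
    refine (Nat.pow_le_pow_left hKX n).trans ?_
    rw [hZ, ← pow_mul, ← pow_mul]
    exact Nat.pow_le_pow_right hX1 (by omega)
  have hZ1 : 1 ≤ Z := hX1.trans hXZ
  have hmain : n * ((M * k * k) ^ n * (30 * M + 30 * k + n * (20 * (M * k * k) ^ n + 230) + 110) +
      40 * n + 120) + 30 * n + (M * k * k) * (s + 100) + 60 * k + 280 ≤ 1060 * Z ^ 6 := by
    have e1 : Z ≤ Z ^ 6 := Nat.le_self_pow (by norm_num) Z
    have e2 : Z ^ 2 ≤ Z ^ 6 := Nat.pow_le_pow_right hZ1 (by norm_num)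
    have e3 : Z ^ 3 ≤ Z ^ 6 := Nat.pow_le_pow_right hZ1 (by norm_num)
    have e4 : Z ^ 4 ≤ Z ^ 6 := Nat.pow_le_pow_right hZ1 (by norm_num)
    calc _ ≤ Z * (Z ^ 2 * (30 * Z + 30 * Z + Z * (20 * Z ^ 2 + 230) + 110) + 40 * Z + 120) +
          30 * Z + Z ^ 2 * (10 + 100) + 60 * Z + 280 := by gcongr
      _ ≤ 1060 * Z ^ 6 := by
          ring_nf
          omega
  have hXr : (2 : ℝ) ≤ X := by exact_mod_cast hX2
  have hX0 : (0 : ℝ) < X := by linarith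
  have hZr : (1 : ℝ) ≤ Z := by exact_mod_cast hZ1
  have hinv : (min ε 1)⁻¹ ≤ Real.exp L := inv_min_one_le_exp_logSize hε
  have hE1 : 1 ≤ Real.exp L := Real.one_le_exp (by linarith)
  have hRle : (R : ℝ) ≤ 160001 * ((Z : ℝ) ^ 6 * Real.exp L) := by
    have h1 : (R : ℝ) ≤ 160000 * (M : ℝ) * M / min ε 1 + 1 := by
      rw [hR]; exact (Nat.ceil_lt_add_one (by positivity)).le
    have h2 : 160000 * (M : ℝ) * M / min ε 1 ≤ 160000 * ((Z : ℝ) ^ 6 * Real.exp L) := by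
      have hMZr : (M : ℝ) ≤ Z := by exact_mod_cast hMZ
      have h3 : (M : ℝ) * M ≤ Z ^ 6 :=
        calc (M : ℝ) * M ≤ Z * Z := by gcongr
          _ = (Z : ℝ) ^ 2 := (sq _).symm
          _ ≤ Z ^ 6 := pow_le_pow_right₀ hZr (by norm_num)
      rw [div_eq_mul_inv, mul_assoc (160000 : ℝ), mul_assoc (160000 : ℝ)]
      gcongr
    have h4 : (1 : ℝ) ≤ Z ^ 6 * Real.exp L := one_le_mul_of_one_le_of_one_le (one_le_pow₀ hZr) hE1
    linarith
  have hexp : Real.exp L ≤ (X : ℝ) ^ (2 * L) := by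
    have he : Real.exp 1 ≤ (X : ℝ) ^ (2 : ℝ) := by
      have := Real.exp_one_lt_d9
      rw [Real.rpow_two]
      nlinarith
    rw [Real.rpow_mul hX0.le, ← Real.exp_one_rpow]
    exact Real.rpow_le_rpow (Real.exp_pos 1).le he (by linarith)
  have hZpow : (Z : ℝ) ^ 6 = (X : ℝ) ^ ((n : ℝ) * 6 + 6) := by
    rw [hZ, Nat.cast_pow, ← pow_mul, ← Real.rpow_natCast]
    push_cast
    ring_nf
  have hconst : (10 : ℝ) ^ 7 ≤ (X : ℝ) ^ (24 : ℝ) := by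
    rw [show (24 : ℝ) = ((24 : ℕ) : ℝ) by norm_num, Real.rpow_natCast]
    calc (10 : ℝ) ^ 7 ≤ 2 ^ 24 := by norm_num
      _ ≤ (X : ℝ) ^ 24 := pow_le_pow_left₀ (by norm_num) hXr 24
  have hpow : 10 ^ 7 * ((Z : ℝ) ^ 6 * Real.exp L) ≤ (X : ℝ) ^ (14000 * L) := by
    calc 10 ^ 7 * ((Z : ℝ) ^ 6 * Real.exp L)
        ≤ (X : ℝ) ^ (24 : ℝ) * ((X : ℝ) ^ ((n : ℝ) * 6 + 6) * (X : ℝ) ^ (2 * L)) := by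
          rw [hZpow]; gcongr
      _ = (X : ℝ) ^ (24 + ((n : ℝ) * 6 + 6 + 2 * L)) := by
          rw [← Real.rpow_add hX0, ← Real.rpow_add hX0]
      _ ≤ (X : ℝ) ^ (14000 * L) :=
          Real.rpow_le_rpow_of_exponent_le (by linarith) (by linarith)
  have hZE : (Z : ℝ) ^ 6 ≤ Z ^ 6 * Real.exp L := le_mul_of_one_le_right (by positivity) hE1
  have hmainr : ((n * ((M * k * k) ^ n * (30 * M + 30 * k + n * (20 * (M * k * k) ^ n + 230) +
      110) + 40 * n + 120) + 30 * n + (M * k * k) * (s + 100) + 60 * k + 280 : ℕ) : ℝ) ≤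
      1060 * (Z : ℝ) ^ 6 := by exact_mod_cast hmain
  have hXcast : (X : ℝ) = (M : ℝ) * k + 1 := by rw [hX]; push_cast; ring
  rw [timeBound, ← hXcast, ← hLdef]
  have hN : (0 : ℝ) ≤ N := N.cast_nonneg
  push_cast at hmainr ⊢
  linarith

end Time

/-! ### The algorithms for the two partition functions -/

section Algorithm

variable {N k M : ℕ} {μ : Fin k → ℕ}

/-- The algorithm, for any way `src` to read the entries of `B` from the memory. -/
theorem exists_exec_mainCmd {G : SimpleGraph (Fin N)} [DecidableRel G.Adj]
    (hG : 1 ≤ G.maxDegree) (hN : ∑ i, μ i = N) (hM : 0 < M) {edge : Fin M → Fin N × Fin N}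
    (hedge : IsEdgeList G edge) {ε : ℝ} (hε : 0 < ε) {σ : Store} (h : HoldsGraph σ μ edge ε)
    {B : Sym2 (Fin N) → Sym2 (Fin k) → ℂ}
    (hB : ∀ e ∈ G.edgeSet, ∀ p, ‖B e p - 1‖ ≤ 0.1 / (G.maxDegree : ℝ)) {ent : ℕ → ℂ}
    (hent : ∀ (e : Fin M) (i j : Fin k), ent (((e : ℕ) * k + i) * k + j) =
      B s((edge e).1, (edge e).2) s(i, j)) {src : CExp} (hs : src.time ≤ 10)
    (hsrc : ∀ τ : Store, τ.num 1 = σ.num 1 → τ.num 2 = σ.num 2 →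
      τ.int posV 0 = τ.int entryV 0 % (k * k) → src.eval τ = ent (τ.int entryV 0)) :
    ∃ t τ, Exec (mainCmd src) σ t τ ∧ (t : ℝ) ≤ timeBound 14000 N k M ε ∧
      IsApproximation τ (segQ G μ B) ε (14000 * logSize M ε) := by
  have hk : 0 < k := by
    rcases Nat.eq_zero_or_pos k with rfl | hk
    · have : N = 0 := by simpa using hN.symm
      subst this
      exact absurd (edge ⟨0, hM⟩).1.2 (Nat.not_lt_zero _)
    · exact hk
  have hgeval := eval_tablePoly (μ := μ) hedge hent
  have hp0 := tablePoly_coeff_zero (μ := μ) (edge := edge) (ent := ent)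
  obtain ⟨f, F, hf⟩ := exists_isLogExpansion (tablePoly μ edge ent)
    (tablePoly_natDegree_le hent)
    (c := (mapsWithMult μ : Finset (Fin N → Fin k)).card)
    (by exact_mod_cast (mapsWithMult_nonempty hN).card_pos) (by rw [hp0]; simp)
    fun z hz => hgeval z ▸ segQ_ne_zero G hG hN hB hz
  obtain ⟨n, hn, hlt, hnL⟩ := exists_degree hM hε
  obtain ⟨t, τ, hexec, ht, hτn, hτT, hτg⟩ :=
    runs_mainCmd h hM hk hN src hsrc hn hlt hp0 hf.newton rfl rfl
  refine ⟨t, τ, hexec, le_trans (Nat.cast_le.2 ht) (steps_le_timeBound hM hk hε hs hnL rfl), ?_⟩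
  have hg : segQ G μ B = fun z => (tablePoly μ edge ent).eval z := funext fun z => (hgeval z).symm
  rw [hg]
  have hL : 0 ≤ logSize M ε := (Real.log_nonneg one_le_two).trans (log_two_le_logSize hM ε)
  exact isApproximation_of_isLogExpansion hf hM hε hn (by linarith) rfl hτn hτT (hp0 ▸ hτg)

end Algorithm

theorem mainTheorem3 :
    ∃ (progQ progP : Cmd) (C : ℝ),
      ∀ (N k : ℕ) (G : SimpleGraph (Fin N)) [DecidableRel G.Adj],
        1 ≤ G.maxDegree →
        ∀ μ : Fin k → ℕ, (∀ i, 0 < μ i) → ∑ i, μ i = N →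
        ∀ edge : Fin G.edgeFinset.card → Fin N × Fin N, IsEdgeList G edge →
        ∀ ε : ℝ, 0 < ε →
        ∀ σ : Store, HoldsGraph σ μ edge ε →
          (∀ B : Sym2 (Fin N) → Sym2 (Fin k) → ℂ,
            (∀ e ∈ G.edgeSet, ∀ p, ‖B e p - 1‖ ≤ 0.1 / (G.maxDegree : ℝ)) →
            HoldsEdgeMatrix σ edge B →
            partQ G μ B ≠ 0 ∧
            ∃ (t : ℕ) (τ : Store), Exec progQ σ t τ ∧
              (t : ℝ) ≤ timeBound C N k G.edgeFinset.card ε ∧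
              IsApproximation τ (segQ G μ B) ε (C * logSize G.edgeFinset.card ε)) ∧
          (∀ A : Matrix (Fin k) (Fin k) ℂ, A.IsSymm →
            (∀ i j, ‖A i j - 1‖ ≤ 0.1 / (G.maxDegree : ℝ)) →
            HoldsMatrix σ A →
            partP G μ A ≠ 0 ∧
            ∃ (t : ℕ) (τ : Store), Exec progP σ t τ ∧
              (t : ℝ) ≤ timeBound C N k G.edgeFinset.card ε ∧
              IsApproximation τ (segP G μ A) ε (C * logSize G.edgeFinset.card ε)) := by
  refine ⟨mainCmd (CExp.get 1 (ivar entryV)), mainCmd (CExp.get 2 (ivar posV)), 14000,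
    fun N k G _ hG μ _ hN edge hedge ε hε σ h => ?_⟩
  have hM : 0 < G.edgeFinset.card := by
    refine card_pos.2 (G.edgeFinset_nonempty.2 ?_)
    intro hbot
    have := SimpleGraph.maxDegree_eq_zero_iff.2 hbot
    omega
  constructor
  · intro B hB hσB
    refine ⟨?_, exists_exec_mainCmd hG hN hM hedge hε h hB (ent := σ.num 1) hσB
      (by norm_num [CExp.time, IExp.time]) fun τ h1 _ _ => by simp [h1]⟩
    rw [← segQ_one]
    exact segQ_ne_zero G hG hN hB (by norm_num)
  · intro A hA hA1 hσA
    have hB : ∀ e ∈ G.edgeSet, ∀ p, ‖symEntries A hA p - 1‖ ≤ 0.1 / (G.maxDegree : ℝ) := by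
      rintro - - ⟨i, j⟩
      exact hA1 i j
    rw [← segP_one, segP_eq_segQ G A hA]
    refine ⟨segQ_ne_zero G hG hN hB (by norm_num), exists_exec_mainCmd hG hN hM hedge hε h hB
      (ent := fun x => σ.num 2 (x % (k * k))) (fun e i j => ?_)
      (by norm_num [CExp.time, IExp.time]) fun τ _ h2 h5 => by simp [h2, h5]⟩
    simp only [(entry_decode i.2 j.2).2.2.2.2]
    exact hσA i j
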